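/- **Setting.** Let $d\ge 1$, let $\mathcal A\subset\mathbb R^d$ be a finite set spanning $\mathbb R^d$, and let $\rho\in(0,1]$, $\delta\in(0,1)$, $\delta'=\delta/|\mathcal A|$. Let $E$ be the ellipsoid of minimal volume, among the origin-centred ellipsoids (unit balls of scalar products $\langle\cdot,\cdot\rangle_E$), that encloses $\mathcal A$. A *John's exploration distribution* for $\mathcal A$ is a probability distribution $p_E$ on $\mathcal A$, supported on at most $d(d+1)/2+1$ points lying on the boundary of $E$, such that $y=d\sum_{a}p_E(a)\langle a,y\rangle_E\,a$ for all $y\in\mathbb R^d$. **Protocol.** In each round $t=1,2,\dots$ the learner determines a distribution $p_t$ on $\mathcal A$ from its past actions and observations; an adaptive, possibly randomized, adversary chooses $\omega_t\in\mathbb R^d$ with $|a^\top\omega_t|\le 1$ for all $a\in\mathcal A$; then, given the past and $\omega_t$, $a_t\sim p_t$ and $b_t\sim\mathrm{Ber}(\rho)$ are drawn independently, and the learner observes $o_t=b_t r_t/\rho$, where $r_t=a_t^\top\omega_t$. The regret is $\mathrm{Reg}(t)=\max_{a\in\mathcal A}\sum_{\ell=1}^t\left(a^\top\omega_\ell-r_\ell\right)$.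 **Algorithm (Anytime Weighted Geometric Hedge).** Given a constant $c>0$ and a John's exploration distribution $p_E$, put $$\gamma_t=\min\Big\{\sqrt{\tfrac{d\ln|\mathcal A|\ln(t/\delta)}{\rho t}},\tfrac12\Big\},\qquad \eta_t=\frac{c\,\rho\,\gamma_t}{d+\sqrt{d/t}\,\sqrt{\rho\ln|\mathcal A|\ln(t/\delta)}},$$ $$p_t(a)=(1-\gamma_t)\frac{\exp\big(\eta_t\sum_{\ell<t}\tilde r_\ell(a)\big)}{\sum_{a'\in\mathcal A}\exp\big(\eta_t\sum_{\ell<t}\tilde r_\ell(a')\big)}+\gamma_t\,p_E(a),\qquad \Sigma_t=\sum_{a\in\mathcal A} p_t(a)\,aa^\top,$$ $$\hat\omega_t=o_t\,\Sigma_t^{-1}a_t,\qquad \tilde r_t(a)=a^\top\hat\omega_t+2\,a^\top\Sigma_t^{-1}a\,\sqrt{\frac{\ln(12t^2/\delta')}{\rho\,d\,t}} .$$ **Theorem.** Every finite set spanning $\mathbb R^d$, $d\ge1$, has a John's exploration distribution. Moreover there is an absolute constant $c_0>0$ such that for every $c\in(0,c_0]$ there is a constant $C>0$, depending on $c$ only,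 with the following properties for all $d$, $\mathcal A$ and John's exploration distributions $p_E$ as above. 1. For all $\rho\in(0,1]$ and $\delta\in(0,1)$ and against every adversary, with probability at least $1-\delta(3+2d^2)$, simultaneously for all $t\ge 1$, $$\mathrm{Reg}(t)\le C\left(\sqrt{\frac{d\,t\ln|\mathcal A|}{\rho}\ln\frac t\delta}+\rho\ln|\mathcal A|\ln\frac t\delta\ln t+\Big(\frac{\ln|\mathcal A|}{d}\ln\frac t\delta\Big)^{1/4}t^{1/4}\Big(\frac1\rho\Big)^{3/4}+\frac1\rho\ln\frac t\delta\right).$$ 2. The algorithm is h-stable with complexity $R(\Pi)=\sqrt{d\ln|\mathcal A|}$: for all $\rho\in(0,1]$ and $\delta\in(0,1)$ there is a function $f(t)=o(\sqrt{t\ln t})$ as $t\to\infty$, which may depend on $d,\mathcal A,p_E,c,\rho,\delta$ but not on the adversary or on chance, such that against every adversary, with probability at least $1-\delta$, simultaneously for all $t\ge1$, $$\mathrm{Reg}(t)\le C\,R(\Pi)\sqrt{\frac t\rho\ln\frac t\delta}+f(t).$$ -/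

import Mathlib

universe u

noncomputable section

open MeasureTheory Filter Asymptotics Matrix

namespace GeoHedge

variable {d : ℕ}

/-! ### John's exploration -/

/-- The ellipsoid `{x | xᵀ Q x ≤ 1}`, centred at the origin; for positive definite `Q` it is the
unit ball of the norm derived from the scalar product `⟨x, y⟩ = xᵀ Q y`. -/
def ellipsoid (Q : Matrix (Fin d) (Fin d) ℝ) : Set (Fin d → ℝ) :=
  {x | x ⬝ᵥ (Q *ᵥ x) ≤ 1}

/-- `Q` describes John's ellipsoid of `K`: the ellipsoid of minimal volume, among those which are
unit balls of a scalar product, that encloses `K`. -/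
structure IsJohnEllipsoid (K : Set (Fin d → ℝ)) (Q : Matrix (Fin d) (Fin d) ℝ) : Prop where
  posDef : Q.PosDef
  subset : K ⊆ ellipsoid Q
  minimal : ∀ Q' : Matrix (Fin d) (Fin d) ℝ, Q'.PosDef → K ⊆ ellipsoid Q' →
    volume (ellipsoid Q) ≤ volume (ellipsoid Q')

/-- `pE` is a John's exploration distribution on the finite set `A`: a probability distribution
supported on at most `d (d + 1) / 2 + 1` contact points of `A` with its John's ellipsoid, which
decomposes the identity: `y = d ∑ₓ pE(x) ⟨x, y⟩ x` for the scalar product of the ellipsoid. -/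
def IsJohnExploration (A : Finset (Fin d → ℝ)) (pE : A → ℝ) : Prop :=
  ∃ Q : Matrix (Fin d) (Fin d) ℝ, IsJohnEllipsoid (A : Set (Fin d → ℝ)) Q ∧
    (∀ x, 0 ≤ pE x) ∧ ∑ x, pE x = 1 ∧
    (∀ x : A, pE x ≠ 0 → (x : Fin d → ℝ) ⬝ᵥ (Q *ᵥ x) = 1) ∧
    {x : A | pE x ≠ 0}.ncard ≤ d * (d + 1) / 2 + 1 ∧
    ∀ y : Fin d → ℝ, y = (d : ℝ) • ∑ x : A, (pE x * ((x : Fin d → ℝ) ⬝ᵥ (Q *ᵥ y))) • (x : Fin d → ℝ)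

/-! ### The interaction protocol

Rounds are numbered `t = 1, 2, …`; the value of a sequence at index `0` is never used. -/

/-- A randomized learner with action set `A`: given the round `t`, the sequence of its actions and
the sequence of its observations (of which only the entries of rounds `1, …, t - 1` may be used),
it returns the probability of each action. -/
abbrev Learner (A : Finset (Fin d → ℝ)) : Type := ℕ → (ℕ → A) → (ℕ → ℝ) → A → ℝ

variable {Ω : Type*} [mΩ : MeasurableSpace Ω]

/-- The importance-weighted observation `oₜ = bₜ rₜ / ρ`, where `rₜ = aₜᵀ ωₜ`. -/
def obs {A : Finset (Fin d → ℝ)} (ρ : ℝ) (θ : ℕ → Ω → Fin d → ℝ) (a : ℕ → Ω → A)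
    (b : ℕ → Ω → Bool) (t : ℕ) (w : Ω) : ℝ :=
  if b t w then ((a t w : Fin d → ℝ) ⬝ᵥ θ t w) / ρ else 0

/-- The processes `θ` (reward vectors), `a` (actions) and `b` (Bernoulli variables) are a run of the
learner `L` against an adaptive, possibly randomized, adversary, with importance weight `ρ`.
`G t` is the information before the draw of `(aₜ, bₜ)`: it contains the past, the reward vector of
round `t`, and possibly private randomness of the adversary. -/
structure IsRun {A : Finset (Fin d → ℝ)} (L : Learner A) (ρ : ℝ) (μ : Measure Ω)
    (G : Filtration ℕ mΩ)
    (θ : ℕ → Ω → Fin d → ℝ) (a : ℕ → Ω → A) (b : ℕ → Ω → Bool) : Prop where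
  measurable_reward : ∀ t, 1 ≤ t → Measurable[G t] (θ t)
  measurable_action : ∀ s t, 1 ≤ s → s < t → Measurable[G t] (a s)
  measurable_bern : ∀ s t, 1 ≤ s → s < t → Measurable[G t] (b s)
  /-- all rewards lie in `[-1, 1]` -/
  bounded : ∀ t, 1 ≤ t → ∀ w, ∀ x ∈ A, |x ⬝ᵥ θ t w| ≤ 1
  /-- given the past and `ωₜ`, the action `aₜ` is drawn from the learner's distribution and,
  independently, `bₜ ∼ Ber(ρ)` -/
  law : ∀ t, 1 ≤ t → ∀ (x : A) (β : Bool),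
    μ[({w | a t w = x ∧ b t w = β}).indicator (fun _ => (1 : ℝ)) | G t] =ᵐ[μ]
      fun w => L t (fun s => a s w) (fun s => obs ρ θ a b s w) x * (if β then ρ else 1 - ρ)

/-- The regret after `t` rounds, `max_{x ∈ A} ∑_{ℓ ≤ t} (xᵀ ωₗ - aₗᵀ ωₗ)`. -/
def regret {A : Finset (Fin d → ℝ)} (θ : ℕ → Ω → Fin d → ℝ) (a : ℕ → Ω → A)
    (t : ℕ) (w : Ω) : ℝ :=
  ⨆ x : A, ∑ l ∈ Finset.Icc 1 t,
    ((x : Fin d → ℝ) ⬝ᵥ θ l w - (a l w : Fin d → ℝ) ⬝ᵥ θ l w)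

/-- High-probability stability in adversarial linear bandits with rewards in `[-1, 1]`, with
complexity `R` and constant `C`, of an algorithm `alg` with inputs `ρ` and `δ`: for every `ρ`, `δ`
and against every adversary, with probability at least `1 - δ` and simultaneously for all `t`, the
regret is at most `C R √((t / ρ) ln (t / δ))` up to terms of lower order than `√(t ln t)`, which may
depend on `A`, `ρ`, `δ` but neither on the adversary nor on chance. -/
def HStable (A : Finset (Fin d → ℝ)) (alg : ℝ → ℝ → Learner A) (R C : ℝ) : Prop :=
  ∀ ρ δ : ℝ, 0 < ρ → ρ ≤ 1 → 0 < δ → δ < 1 →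
    ∃ f : ℕ → ℝ, f =o[atTop] (fun t : ℕ => √((t : ℝ) * Real.log t)) ∧
      ∀ (Ω : Type u) [mΩ : MeasurableSpace Ω] (μ : Measure Ω) [IsProbabilityMeasure μ]
        (G : Filtration ℕ mΩ)
        (θ : ℕ → Ω → Fin d → ℝ) (a : ℕ → Ω → A) (b : ℕ → Ω → Bool),
        IsRun (alg ρ δ) ρ μ G θ a b →
        1 - δ ≤ μ.real {w | ∀ t : ℕ, 1 ≤ t →
          regret θ a t w ≤ C * (R * √((t : ℝ) / ρ * Real.log (t / δ))) + f t}

/-! ### Anytime Weighted Geometric Hedge -/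

section Algorithm

variable (A : Finset (Fin d → ℝ))

/-- The mixing coefficient `γₜ = min {√(d ln|A| ln(t/δ) / (ρ t)), 1/2}`. -/
def gam (ρ δ : ℝ) (t : ℕ) : ℝ :=
  min (√((d : ℝ) * Real.log A.card * Real.log (t / δ) / (ρ * t))) (1 / 2)

/-- The learning rate `ηₜ = c ρ γₜ / (d + √(d/t) √(ρ ln|A| ln(t/δ)))`. -/
def eta (c ρ δ : ℝ) (t : ℕ) : ℝ :=
  c * (ρ * gam A ρ δ t /
    ((d : ℝ) + √((d : ℝ) / t) * √(ρ * Real.log A.card * Real.log (t / δ))))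

variable {A}

/-- The sampling distribution `pₜ = (1 - γ) qₜ + γ pE`, where `qₜ` is the exponential weights
distribution with learning rate `η` for the cumulative reward estimates `S`. -/
def mixDist (pE : A → ℝ) (η γ : ℝ) (S : A → ℝ) (x : A) : ℝ :=
  (1 - γ) * (Real.exp (η * S x) / ∑ y : A, Real.exp (η * S y)) + γ * pE x

/-- The covariance matrix `E_{a ∼ p}[a aᵀ]`. -/
def cov (p : A → ℝ) : Matrix (Fin d) (Fin d) ℝ :=
  ∑ x : A, p x • vecMulVec (x : Fin d → ℝ) (x : Fin d → ℝ)

/-- The reward upper bound `r̃ₜ(x) = xᵀ ω̂ₜ + 2 xᵀ Σ⁻¹ x √(ln(12 t² / δ') / (ρ d t))`, where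
`ω̂ₜ = o Σ⁻¹ act`, `δ' = δ / |A|`, the sampling distribution is `p`, the action played is `act`
and the (importance-weighted) observation is `o = bₜ rₜ / ρ`. -/
def rewardUpper (ρ δ : ℝ) (t : ℕ) (p : A → ℝ) (act : A) (o : ℝ) (x : A) : ℝ :=
  (x : Fin d → ℝ) ⬝ᵥ (o • ((cov p)⁻¹ *ᵥ (act : Fin d → ℝ)))
    + 2 * ((x : Fin d → ℝ) ⬝ᵥ ((cov p)⁻¹ *ᵥ (x : Fin d → ℝ)))
      * √(Real.log (12 * (t : ℝ) ^ 2 / (δ / A.card)) / (ρ * d * t))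

/-- The cumulative reward upper bounds `∑_{ℓ ≤ t} r̃ₗ(x)` computed by the algorithm with exploration
distribution `pE` from its actions `act` and observations `o`. -/
def cumUpper (pE : A → ℝ) (c ρ δ : ℝ) (act : ℕ → A) (o : ℕ → ℝ) : ℕ → A → ℝ
  | 0 => fun _ => 0
  | t + 1 => fun x => cumUpper pE c ρ δ act o t x +
      rewardUpper ρ δ (t + 1)
        (mixDist pE (eta A c ρ δ (t + 1)) (gam A ρ δ (t + 1)) (cumUpper pE c ρ δ act o t))
        (act (t + 1)) (o (t + 1)) x

/-- Anytime Weighted Geometric Hedge: the sampling distribution `pₜ` of round `t ≥ 1`. -/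
def geoHedge (pE : A → ℝ) (c ρ δ : ℝ) : Learner A := fun t act o =>
  mixDist pE (eta A c ρ δ t) (gam A ρ δ t) (cumUpper pE c ρ δ act o (t - 1))

end Algorithm

/-- The rate `√(d t ln|A| ln(t/δ) / ρ) + ρ ln|A| ln(t/δ) ln t
+ ((ln|A| / d) ln(t/δ))^{1/4} t^{1/4} (1/ρ)^{3/4} + (1/ρ) ln(t/δ)`. -/
def rate (A : Finset (Fin d → ℝ)) (ρ δ : ℝ) (t : ℕ) : ℝ :=
  √((d : ℝ) * t * Real.log A.card / ρ * Real.log (t / δ))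
    + ρ * Real.log A.card * Real.log (t / δ) * Real.log t
    + (Real.log A.card / d * Real.log (t / δ)) ^ (1 / 4 : ℝ) * (t : ℝ) ^ (1 / 4 : ℝ)
        * (1 / ρ) ^ (3 / 4 : ℝ)
    + 1 / ρ * Real.log (t / δ)

end GeoHedge

end

noncomputable section

open MeasureTheory Filter Asymptotics Matrix

namespace GeoHedge

/-! ### Exploration: the inverse covariance form and John's constant -/

section Design

variable {d : ℕ} {A : Finset (Fin d → ℝ)}

/-! The regret part is an exponential weights analysis with optimistic estimates, done separately
for each horizon `T`. Mixing in a John distribution with weight `γ` keeps `xᵀ Σ⁻¹ y` at most `d / γ`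
on actions (`IsJohnExploration.spreads`, `IsMixture.spreads`). With the prescribed `η`, one round
changes the exponents by at most one, so the potential argument `exponential_weights_bound` applies,
at a cost of `ln|A| / η` plus the second moments.

The random sums are controlled by exponential supermartingales (`lintegral_exp_sum_le_one`) with a
deterministic scale fixed by the horizon. For the estimates and the rewards the scale is `± ρ W /
6`, where `W` is the confidence width at `T`; for the squared norms it is `ρ η`. The variance of the
estimate of an action `x` is of order `xᵀ Σ⁻¹ x / ρ`; after multiplication by the scale it is
dominated by the bonus `2 xᵀ Σ⁻¹ x W` in the upper estimate, because widths decrease in time. The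
bonus itself is cheap on average, since the mean of `xᵀ Σ⁻¹ x` under `p` is `d`. At each horizon
there are at most `2|A| + 3` bad events, with total probability at most `δ / (3 T²)`, so a union
bound over all `T` costs at most `δ`.

Two initial phases need separate care. While `γ` is clipped at `1/2`, `η` is not decreasing, so
exponential weights is restarted at the end of this phase, from scores bounded above by a deviation
estimate. The phase has length at most twice the leading term. A further burn-in covers rounds with
`t / δ < e`, where `ln(t/δ) / t` need not decrease. For the rate bound it is empty whenever the
probability claim is not trivial. For stability it lasts two rounds and contributes a deterministic
constant. The outcome is `(240 + 2 / c)` times the leading term alone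
(`sum_regret_le_of_deviations`, `IsRun.exists_exceptional_set`, `IsRun.regret_bound`).

Existence of John's distribution follows from maximizing `det B ^ 2` over the matrices `B` mapping
the actions into the unit ball. If the normalized inverse of `Bᵀ B` were not a convex combination of
`x xᵀ` over contact points `x`, a separating functional would give a direction that increases the
determinant (`trace_le_zero_of_max`, `inv_mem_convexHull`). Carathéodory's theorem and the dimension
of the symmetric matrices bound the support. -/

/-- The bilinear form of the inverse covariance matrix of `p`. -/
def invForm (p : A → ℝ) (x y : Fin d → ℝ) : ℝ := x ⬝ᵥ ((cov p)⁻¹ *ᵥ y)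

/-- The covariance of `p` controls all actions: `(xᵀ z)² ≤ κ zᵀ Σ z` for `x ∈ A`. -/
def Spreads (p : A → ℝ) (κ : ℝ) : Prop :=
  ∀ x ∈ A, ∀ z : Fin d → ℝ, (x ⬝ᵥ z) ^ 2 ≤ κ * ∑ b : A, p b * ((b : Fin d → ℝ) ⬝ᵥ z) ^ 2

lemma cov_mulVec (p : A → ℝ) (z : Fin d → ℝ) :
    cov p *ᵥ z = ∑ x : A, (p x * ((x : Fin d → ℝ) ⬝ᵥ z)) • (x : Fin d → ℝ) := by
  simp only [cov, Matrix.sum_mulVec, Matrix.smul_mulVec]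
  refine Finset.sum_congr rfl fun x _ => ?_
  rw [Matrix.vecMulVec_mulVec]
  ext i
  simp
  ring

lemma dotProduct_cov_mulVec (p : A → ℝ) (y z : Fin d → ℝ) :
    y ⬝ᵥ (cov p *ᵥ z) =
      ∑ x : A, p x * ((x : Fin d → ℝ) ⬝ᵥ z) * ((x : Fin d → ℝ) ⬝ᵥ y) := by
  rw [cov_mulVec, dotProduct_sum]
  refine Finset.sum_congr rfl fun x _ => ?_
  rw [dotProduct_smul, smul_eq_mul, dotProduct_comm y]

lemma cov_isSymm (p : A → ℝ) : (cov p).IsSymm := by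
  unfold Matrix.IsSymm cov
  rw [Matrix.transpose_sum]
  refine Finset.sum_congr rfl fun x _ => ?_
  rw [Matrix.transpose_smul, Matrix.transpose_vecMulVec]

/-- A vector in the kernel of the quadratic form is, by `Spreads`, orthogonal to every action, hence
to the whole space. -/
lemma cov_posDef {p : A → ℝ} {κ : ℝ} (hp : ∀ x, 0 ≤ p x) (hκ : Spreads p κ)
    (hA : Submodule.span ℝ (A : Set (Fin d → ℝ)) = ⊤) : (cov p).PosDef := by
  have hsum : ∀ z, z ⬝ᵥ (cov p *ᵥ z) = ∑ x : A, p x * ((x : Fin d → ℝ) ⬝ᵥ z) ^ 2 := fun z => by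
    rw [dotProduct_cov_mulVec]
    exact Finset.sum_congr rfl fun x _ => by ring
  refine Matrix.PosDef.of_dotProduct_mulVec_pos ?_ fun z hz => ?_
  · have := cov_isSymm p
    rwa [Matrix.IsHermitian, Matrix.conjTranspose_eq_transpose_of_trivial]
  · simp only [star_trivial]
    have h0 : 0 ≤ z ⬝ᵥ (cov p *ᵥ z) := by
      rw [hsum]
      exact Finset.sum_nonneg fun x _ => mul_nonneg (hp x) (sq_nonneg _)
    refine lt_of_le_of_ne h0 fun h => hz ?_
    have hx : ∀ x ∈ A, x ⬝ᵥ z = 0 := fun x hx => by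
      have := hκ x hx z
      rw [← hsum, ← h, mul_zero] at this
      exact pow_eq_zero_iff two_ne_zero |>.1 (le_antisymm this (sq_nonneg _))
    have hall : ∀ y : Fin d → ℝ, y ⬝ᵥ z = 0 := fun y => by
      have hy : y ∈ Submodule.span ℝ (A : Set (Fin d → ℝ)) := hA ▸ Submodule.mem_top
      induction hy using Submodule.span_induction with
      | mem x h => exact hx x h
      | zero => simp
      | add x y _ _ h1 h2 => rw [add_dotProduct, h1, h2, add_zero]
      | smul r x _ h1 => rw [smul_dotProduct, h1, smul_zero]
    exact dotProduct_self_eq_zero.1 (hall z)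

lemma invForm_comm (p : A → ℝ) (x y : Fin d → ℝ) : invForm p x y = invForm p y x := by
  have h : ((cov p)⁻¹)ᵀ = (cov p)⁻¹ := by rw [Matrix.transpose_nonsing_inv, cov_isSymm p]
  unfold invForm
  rw [Matrix.dotProduct_mulVec, ← Matrix.mulVec_transpose, h, dotProduct_comm]

lemma invForm_sum_left {ι : Type*} (p : A → ℝ) (s : Finset ι) (q : ι → ℝ) (f : ι → Fin d → ℝ)
    (y : Fin d → ℝ) : invForm p (∑ i ∈ s, q i • f i) y = ∑ i ∈ s, q i * invForm p (f i) y := by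
  simp [invForm, sum_dotProduct, smul_dotProduct]

/-- Unbiasedness of least squares: the mean of `(yᵀ z) Σ⁻¹ y` under `p` is `Σ⁻¹ Σ z = z`. -/
lemma sum_mul_dotProduct_mul_invForm {p : A → ℝ} (hp : (cov p).PosDef) (x z : Fin d → ℝ) :
    ∑ y : A, p y * ((y : Fin d → ℝ) ⬝ᵥ z) * invForm p x y = x ⬝ᵥ z := by
  have h := dotProduct_cov_mulVec p ((cov p)⁻¹ *ᵥ x) z
  rw [Matrix.dotProduct_mulVec, ← Matrix.mulVec_transpose, cov_isSymm, Matrix.mulVec_mulVec,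
    Matrix.mul_nonsing_inv _ (hp.det_pos.ne'.isUnit),
    Matrix.one_mulVec] at h
  rw [h]
  refine Finset.sum_congr rfl fun y _ => ?_
  rw [invForm_comm]
  rfl

lemma sum_mul_invForm_sq {p : A → ℝ} (hp : (cov p).PosDef) (x : Fin d → ℝ) :
    ∑ y : A, p y * invForm p x y ^ 2 = invForm p x x := by
  have h := sum_mul_dotProduct_mul_invForm hp x ((cov p)⁻¹ *ᵥ x)
  rw [← invForm] at h
  rw [← h]
  refine Finset.sum_congr rfl fun y _ => ?_
  rw [← invForm, invForm_comm p y x]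
  ring

/-- The left side is the trace of `Σ Σ⁻¹`. This makes the average bonus of order `d`, although a
single one may be as large as `d / γ`. -/
lemma sum_mul_invForm_self {p : A → ℝ} (hp : (cov p).PosDef) :
    ∑ x : A, p x * invForm p x x = d := by
  have h1 : (cov p * (cov p)⁻¹).trace = d := by
    rw [Matrix.mul_nonsing_inv _ (hp.det_pos.ne'.isUnit), Matrix.trace_one, Fintype.card_fin]
  rw [← h1]
  conv_rhs => rw [cov, Matrix.sum_mul, Matrix.trace_sum]
  refine Finset.sum_congr rfl fun x _ => ?_
  rw [Matrix.smul_mul, Matrix.trace_smul, Matrix.trace_mul_comm, Matrix.mul_vecMulVec,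
    Matrix.trace_vecMulVec, smul_eq_mul, dotProduct_comm]
  rfl

lemma invForm_self_nonneg {p : A → ℝ} (hp : (cov p).PosDef) (hp0 : ∀ x, 0 ≤ p x)
    (x : Fin d → ℝ) : 0 ≤ invForm p x x := by
  rw [← sum_mul_invForm_sq hp]
  exact Finset.sum_nonneg fun y _ => mul_nonneg (hp0 y) (sq_nonneg _)

/-- This is `Spreads` tested on `z = Σ⁻¹ y`. Taking `y = x` bounds the squared norm of an action by
`κ`. -/
lemma invForm_sq_le {p : A → ℝ} {κ : ℝ} (hp : (cov p).PosDef) (hκ : Spreads p κ)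
    {x : Fin d → ℝ} (hx : x ∈ A) (y : Fin d → ℝ) : invForm p x y ^ 2 ≤ κ * invForm p y y := by
  refine (hκ x hx _).trans_eq ?_
  rw [← sum_mul_invForm_sq hp]
  refine congrArg _ (Finset.sum_congr rfl fun b _ => ?_)
  rw [invForm_comm]
  rfl

lemma invForm_self_le {p : A → ℝ} {κ : ℝ} (hp : (cov p).PosDef) (hκ : Spreads p κ)
    (hκ0 : 0 ≤ κ) {x : Fin d → ℝ} (hx : x ∈ A) : invForm p x x ≤ κ := by
  have h := invForm_sq_le hp hκ hx x
  by_contra! hlt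
  nlinarith

lemma abs_invForm_le {p : A → ℝ} {κ : ℝ} (hp : (cov p).PosDef) (hκ : Spreads p κ)
    (hκ0 : 0 ≤ κ) {x y : Fin d → ℝ} (hx : x ∈ A) (hy : y ∈ A) : |invForm p x y| ≤ κ := by
  refine abs_le_of_sq_le_sq ?_ hκ0
  have h1 := invForm_sq_le hp hκ hx y
  have h2 := invForm_self_le hp hκ hκ0 hy
  nlinarith

/-- The mean of a distribution dominated by `2 p` has norm at most `√2`. -/
lemma invForm_mean_le {p q : A → ℝ} (hp : (cov p).PosDef) (hq0 : ∀ x, 0 ≤ q x)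
    (hq1 : ∑ x, q x = 1) (hqp : ∀ x, q x ≤ 2 * p x) :
    invForm p (∑ x : A, q x • (x : Fin d → ℝ)) (∑ x : A, q x • (x : Fin d → ℝ)) ≤ 2 := by
  set m := ∑ x : A, q x • (x : Fin d → ℝ) with hm
  have h1 : invForm p m m = ∑ x : A, q x * invForm p m x := by
    conv_lhs => rw [hm, invForm_sum_left, ← hm]
    exact Finset.sum_congr rfl fun x _ => by rw [invForm_comm]
  -- Jensen, followed by `q ≤ 2 p`, gives `‖m‖⁴ ≤ 2 ‖m‖²`.
  have h2 : (∑ x : A, q x * invForm p m x) ^ 2 ≤ ∑ x : A, q x * invForm p m x ^ 2 :=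
    even_two.convexOn_pow.map_sum_le (fun x _ => hq0 x) hq1 fun x _ => Set.mem_univ _
  have h3 : ∑ x : A, q x * invForm p m x ^ 2 ≤ 2 * invForm p m m := by
    rw [← sum_mul_invForm_sq hp m, Finset.mul_sum]
    refine Finset.sum_le_sum fun x _ => ?_
    rw [← mul_assoc]
    exact mul_le_mul_of_nonneg_right (hqp x) (sq_nonneg _)
  rw [← h1] at h2
  by_contra! hlt
  nlinarith

/-- John's exploration controls all actions with constant `d`. -/
lemma IsJohnExploration.spreads {pE : A → ℝ}
    (h : IsJohnExploration A pE) : Spreads pE d := by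
  obtain ⟨Q, hQ, h0, -, -, -, hdec⟩ := h
  intro x hx z
  have hsymm : Qᵀ = Q := by
    have := hQ.posDef.isHermitian
    rwa [Matrix.IsHermitian, Matrix.conjTranspose_eq_transpose_of_trivial] at this
  have key : ∀ v : Fin d → ℝ, v ⬝ᵥ x =
      d * ∑ b : A, pE b * ((b : Fin d → ℝ) ⬝ᵥ (Q *ᵥ x)) * ((b : Fin d → ℝ) ⬝ᵥ v) := fun v => by
    conv_lhs => rw [hdec x, dotProduct_smul, dotProduct_sum, smul_eq_mul]
    congr 1
    exact Finset.sum_congr rfl fun b _ => by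
      rw [dotProduct_smul, smul_eq_mul, dotProduct_comm v]
  -- The decomposition of `x` paired with `Q x` is exactly `xᵀ Q x`, which is at most one inside the
  -- ellipsoid. Cauchy–Schwarz then needs no contact property.
  have h1 : d * ∑ b : A, pE b * ((b : Fin d → ℝ) ⬝ᵥ (Q *ᵥ x)) ^ 2 ≤ 1 := by
    have h2 := hQ.subset hx
    simp only [ellipsoid, Set.mem_ofPred_eq] at h2
    rw [dotProduct_comm, key] at h2
    refine le_trans (le_of_eq ?_) h2
    congr 1
    exact Finset.sum_congr rfl fun b _ => by ring
  rw [dotProduct_comm, key]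
  set f : A → ℝ := fun b => (b : Fin d → ℝ) ⬝ᵥ (Q *ᵥ x)
  set g : A → ℝ := fun b => (b : Fin d → ℝ) ⬝ᵥ z
  have hcs : (∑ b, pE b * f b * g b) ^ 2 ≤ (∑ b, pE b * f b ^ 2) * ∑ b, pE b * g b ^ 2 := by
    have := Finset.sum_mul_sq_le_sq_mul_sq Finset.univ (fun b => √(pE b) * f b)
      (fun b => √(pE b) * g b)
    refine le_trans (le_of_eq ?_) (this.trans (le_of_eq ?_))
    · congr 1
      exact Finset.sum_congr rfl fun b _ => by
        rw [mul_mul_mul_comm, Real.mul_self_sqrt (h0 b), mul_assoc]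
    · congr 1 <;> exact Finset.sum_congr rfl fun b _ => by rw [mul_pow, Real.sq_sqrt (h0 b)]
  have hg : 0 ≤ ∑ b, pE b * g b ^ 2 := Finset.sum_nonneg fun b _ => mul_nonneg (h0 b) (sq_nonneg _)
  have hd : (0 : ℝ) ≤ d := Nat.cast_nonneg d
  calc (d * ∑ b, pE b * f b * g b) ^ 2 = d * (d * (∑ b, pE b * f b * g b) ^ 2) := by ring
    _ ≤ d * (d * ((∑ b, pE b * f b ^ 2) * ∑ b, pE b * g b ^ 2)) := by gcongr
    _ = d * ((d * ∑ b, pE b * f b ^ 2) * ∑ b, pE b * g b ^ 2) := by ring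
    _ ≤ d * (1 * ∑ b, pE b * g b ^ 2) := by gcongr
    _ = d * ∑ b, pE b * g b ^ 2 := by ring

end Design

/-! ### Exponential supermartingales and Chernoff bounds -/

section Supermartingale

lemma measurable_apply_of_finite {Ω ι : Type*} [Fintype ι] [MeasurableSpace ι]
    [MeasurableSingletonClass ι] {m : MeasurableSpace Ω} {Z : Ω → ι} {y : ι → Ω → ℝ}
    (hZ : Measurable[m] Z) (hy : ∀ i, Measurable[m] (y i)) :
    Measurable[m] fun w => y (Z w) w := by
  have : (fun w => y (Z w) w) = fun w => ∑ i, ({w | Z w = i}).indicator (y i) w := by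
    funext w
    rw [Finset.sum_eq_single (Z w)]
    · simp
    · exact fun i _ hi => Set.indicator_of_notMem (fun h => hi h.symm) _
    · simp
  rw [this]
  exact Finset.measurable_fun_sum _ fun i _ => (hy i).indicator (hZ (measurableSet_singleton i))

variable {Ω : Type*} [mΩ : MeasurableSpace Ω] {μ : Measure Ω}

/-- Conditional probabilities integrate functions which are measurable with respect to the
conditioning σ-algebra. -/
lemma setLIntegral_eq_lintegral_mul_condExp [IsFiniteMeasure μ] {m : MeasurableSpace Ω}
    (hm : m ≤ mΩ) {E : Set Ω} (hE : MeasurableSet[mΩ] E) {g : Ω → ℝ}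
    (hg : μ[E.indicator (fun _ => (1 : ℝ)) | m] =ᵐ[μ] g) {f : Ω → ENNReal}
    (hf : Measurable[m] f) :
    ∫⁻ w in E, f w ∂μ = ∫⁻ w, f w * ENNReal.ofReal (g w) ∂μ := by
  set c := μ[E.indicator (fun _ => (1 : ℝ)) | m] with hc
  have hint : Integrable (E.indicator (fun _ => (1 : ℝ))) μ := (integrable_const 1).indicator hE
  have hc0 : 0 ≤ᵐ[μ] c := condExp_nonneg <| ae_of_all _ fun w =>
    Set.indicator_nonneg (fun _ _ => zero_le_one) w
  have hcm : Measurable[m] fun w => ENNReal.ofReal (c w) :=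
    ENNReal.measurable_ofReal.comp stronglyMeasurable_condExp.measurable
  -- By definition of the conditional expectation, restriction to `E` and density `c` give the same
  -- measure on the conditioning σ-algebra.
  have htrim : (μ.restrict E).trim hm
      = (μ.withDensity fun w => ENNReal.ofReal (c w)).trim hm := by
    refine @Measure.ext _ m _ _ fun s hs => ?_
    rw [trim_measurableSet_eq hm hs, trim_measurableSet_eq hm hs, Measure.restrict_apply (hm s hs),
      withDensity_apply _ (hm s hs),
      ← ofReal_integral_eq_lintegral_ofReal integrable_condExp.integrableOn (ae_restrict_of_ae hc0),
      setIntegral_condExp hm hint hs, setIntegral_indicator hE, setIntegral_const, smul_eq_mul,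
      mul_one, ofReal_measureReal]
  calc ∫⁻ w in E, f w ∂μ = ∫⁻ w, f w ∂((μ.restrict E).trim hm) := (lintegral_trim hm hf).symm
    _ = ∫⁻ w, f w ∂(μ.withDensity fun w => ENNReal.ofReal (c w)) := by
      rw [htrim, lintegral_trim hm hf]
    _ = ∫⁻ w, ENNReal.ofReal (c w) * f w ∂μ :=
      lintegral_withDensity_eq_lintegral_mul _ (hcm.mono hm le_rfl) (hf.mono hm le_rfl)
    _ = ∫⁻ w, f w * ENNReal.ofReal (g w) ∂μ := lintegral_congr_ae <| by
      filter_upwards [hg] with w hw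
      rw [hw, mul_comm]

variable {ι : Type*} [Fintype ι] [MeasurableSpace ι] [MeasurableSingletonClass ι]

/-- If each increment has conditional exponential moment at most one, then so has their sum. -/
theorem lintegral_exp_sum_le_one [IsProbabilityMeasure μ] {G : Filtration ℕ mΩ}
    {Z : ℕ → Ω → ι} {g y : ℕ → ι → Ω → ℝ} {s : ℕ}
    (hZ : ∀ l k, s < l → l < k → Measurable[G k] (Z l))
    (hlaw : ∀ l, s < l → ∀ i, μ[({w | Z l w = i}).indicator (fun _ => (1 : ℝ)) | G l]
      =ᵐ[μ] g l i)
    (hy : ∀ l, s < l → ∀ i, Measurable[G l] (y l i))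
    (hg : ∀ l, s < l → ∀ i w, 0 ≤ g l i w) (n : ℕ)
    (h1 : ∀ l, s < l → l ≤ n → ∀ w, ∑ i, g l i w * Real.exp (y l i w) ≤ 1) :
    ∫⁻ w, ENNReal.ofReal (Real.exp (∑ l ∈ Finset.Ioc s n, y l (Z l w) w)) ∂μ ≤ 1 := by
  rcases lt_or_ge n s with hn | hn
  · simp [Finset.Ioc_eq_empty_of_le hn.le]
  induction n, hn using Nat.le_induction with
  | base => simp
  | succ n hn ih =>
    have hlt : s < n + 1 := Nat.lt_succ_of_le hn
    set f : Ω → ENNReal := fun w =>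
      ENNReal.ofReal (Real.exp (∑ l ∈ Finset.Ioc s n, y l (Z l w) w)) with hf
    have hyZ : ∀ l ∈ Finset.Ioc s n, Measurable[G (n + 1)] fun w => y l (Z l w) w := by
      intro l hl
      rw [Finset.mem_Ioc] at hl
      exact measurable_apply_of_finite (hZ l (n + 1) hl.1 (by omega)) fun i =>
        (hy l hl.1 i).mono (G.mono (by omega)) le_rfl
    have hfm : Measurable[G (n + 1)] f :=
      ENNReal.measurable_ofReal.comp (Real.measurable_exp.comp (Finset.measurable_fun_sum _ hyZ))
    -- The draw of round `n + 1` is known only to `G (n + 2)`; `G (n + 1)` contains everything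
    -- before it.
    have hZm : ∀ i, MeasurableSet {w | Z (n + 1) w = i} := fun i =>
      G.le (n + 2) _ (hZ (n + 1) (n + 2) hlt (by omega) (measurableSet_singleton i))
    have hym : ∀ i, Measurable[G (n + 1)] fun w => ENNReal.ofReal (Real.exp (y (n + 1) i w)) :=
      fun i => ENNReal.measurable_ofReal.comp (Real.measurable_exp.comp (hy (n + 1) hlt i))
    calc ∫⁻ w, ENNReal.ofReal (Real.exp (∑ l ∈ Finset.Ioc s (n + 1), y l (Z l w) w)) ∂μ
        = ∫⁻ w, ∑ i, ({w | Z (n + 1) w = i}).indicator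
            (fun w => f w * ENNReal.ofReal (Real.exp (y (n + 1) i w))) w ∂μ := by
          refine lintegral_congr fun w => ?_
          rw [Finset.sum_eq_single (Z (n + 1) w)]
          · rw [Set.indicator_of_mem (by simp), hf,
              ← ENNReal.ofReal_mul (Real.exp_pos _).le, ← Real.exp_add,
              ← Finset.sum_Ioc_succ_top (by omega)]
          · intro i _ hi
            exact Set.indicator_of_notMem (fun h => hi h.symm) _
          · simp
      _ = ∑ i, ∫⁻ w in {w | Z (n + 1) w = i},
            f w * ENNReal.ofReal (Real.exp (y (n + 1) i w)) ∂μ := by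
          rw [lintegral_finsetSum]
          · exact Finset.sum_congr rfl fun i _ => lintegral_indicator (hZm i) _
          · exact fun i _ => ((hfm.mul (hym i)).mono (G.le _) le_rfl).indicator (hZm i)
      _ = ∑ i, ∫⁻ w, f w * ENNReal.ofReal (Real.exp (y (n + 1) i w))
            * ENNReal.ofReal (μ[({w | Z (n + 1) w = i}).indicator
              (fun _ => (1 : ℝ)) | G (n + 1)] w) ∂μ :=
          Finset.sum_congr rfl fun i _ =>
            setLIntegral_eq_lintegral_mul_condExp (G.le _) (hZm i) (ae_eq_refl _)
              (hfm.mul (hym i))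
      _ = ∫⁻ w, ∑ i, f w * ENNReal.ofReal (Real.exp (y (n + 1) i w))
            * ENNReal.ofReal (μ[({w | Z (n + 1) w = i}).indicator
              (fun _ => (1 : ℝ)) | G (n + 1)] w) ∂μ := by
          rw [lintegral_finsetSum]
          exact fun i _ => ((hfm.mul (hym i)).mul (ENNReal.measurable_ofReal.comp
            stronglyMeasurable_condExp.measurable)).mono (G.le _) le_rfl
      _ ≤ ∫⁻ w, f w ∂μ := by
          refine lintegral_mono_ae ?_
          have hall : ∀ᵐ w ∂μ, ∀ i, μ[({w | Z (n + 1) w = i}).indicator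
              (fun _ => (1 : ℝ)) | G (n + 1)] w = g (n + 1) i w :=
            ae_all_iff.2 fun i => hlaw (n + 1) hlt i
          filter_upwards [hall] with w hw
          simp only [hw, mul_assoc, ← Finset.mul_sum]
          refine mul_le_of_le_one_right' ?_
          simp only [← ENNReal.ofReal_mul (Real.exp_pos _).le]
          rw [← ENNReal.ofReal_sum_of_nonneg fun i _ =>
            mul_nonneg (Real.exp_pos _).le (hg (n + 1) hlt i w), ← ENNReal.ofReal_one]
          refine ENNReal.ofReal_le_ofReal (le_trans (le_of_eq ?_) (h1 (n + 1) hlt le_rfl w))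
          exact Finset.sum_congr rfl fun i _ => mul_comm _ _
      _ ≤ 1 := ih fun l hl hln => h1 l hl (by omega)

/-- Chernoff bound for sums of increments with conditional exponential moments at most one. -/
theorem measure_lt_sum_le_exp_neg [IsProbabilityMeasure μ] {G : Filtration ℕ mΩ}
    {Z : ℕ → Ω → ι} {g y : ℕ → ι → Ω → ℝ} {s : ℕ}
    (hZ : ∀ l k, s < l → l < k → Measurable[G k] (Z l))
    (hlaw : ∀ l, s < l → ∀ i, μ[({w | Z l w = i}).indicator (fun _ => (1 : ℝ)) | G l]
      =ᵐ[μ] g l i)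
    (hy : ∀ l, s < l → ∀ i, Measurable[G l] (y l i))
    (hg : ∀ l, s < l → ∀ i w, 0 ≤ g l i w) (n : ℕ)
    (h1 : ∀ l, s < l → l ≤ n → ∀ w, ∑ i, g l i w * Real.exp (y l i w) ≤ 1) (r : ℝ) :
    μ {w | r < ∑ l ∈ Finset.Ioc s n, y l (Z l w) w} ≤ ENNReal.ofReal (Real.exp (-r)) := by
  have h := lintegral_exp_sum_le_one hZ hlaw hy hg n h1
  have hm : Measurable fun w =>
      ENNReal.ofReal (Real.exp (∑ l ∈ Finset.Ioc s n, y l (Z l w) w)) := by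
    refine ENNReal.measurable_ofReal.comp (Real.measurable_exp.comp
      (Finset.measurable_fun_sum _ fun l hl => ?_))
    rw [Finset.mem_Ioc] at hl
    exact (measurable_apply_of_finite (hZ l (l + 1) hl.1 (by omega)) fun i =>
      (hy l hl.1 i).mono (G.mono (by omega)) le_rfl).mono (G.le _) le_rfl
  calc μ {w | r < ∑ l ∈ Finset.Ioc s n, y l (Z l w) w}
      ≤ μ {w | ENNReal.ofReal (Real.exp r) ≤
          ENNReal.ofReal (Real.exp (∑ l ∈ Finset.Ioc s n, y l (Z l w) w))} :=
        measure_mono fun w hw =>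
          ENNReal.ofReal_le_ofReal (Real.exp_le_exp.2 (le_of_lt hw))
    _ ≤ (∫⁻ w, ENNReal.ofReal (Real.exp (∑ l ∈ Finset.Ioc s n, y l (Z l w) w)) ∂μ)
          / ENNReal.ofReal (Real.exp r) :=
        meas_ge_le_lintegral_div hm.aemeasurable (by simp [Real.exp_pos]) ENNReal.ofReal_ne_top
    _ ≤ 1 / ENNReal.ofReal (Real.exp r) := ENNReal.div_le_div_right h _
    _ = ENNReal.ofReal (Real.exp (-r)) := by
        rw [Real.exp_neg, ENNReal.ofReal_inv_of_pos (Real.exp_pos _), one_div]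

end Supermartingale

/-! ### Exponential moments and exponential weights -/

lemma exp_le_one_add_add_sq {u : ℝ} (hu : |u| ≤ 1) : Real.exp u ≤ 1 + u + u ^ 2 := by
  have := (abs_le.1 (Real.abs_exp_sub_one_sub_id_le hu)).2
  linarith

section Exponential

variable {ι : Type*} [Fintype ι]

lemma sum_mul_exp_le {g u : ι → ℝ} (hg0 : ∀ i, 0 ≤ g i) (hg1 : ∑ i, g i = 1)
    (hu : ∀ i, |u i| ≤ 1) :
    ∑ i, g i * Real.exp (u i) ≤ Real.exp (∑ i, g i * u i + ∑ i, g i * u i ^ 2) := by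
  calc ∑ i, g i * Real.exp (u i) ≤ ∑ i, g i * (1 + u i + u i ^ 2) :=
        Finset.sum_le_sum fun i _ =>
          mul_le_mul_of_nonneg_left (exp_le_one_add_add_sq (hu i)) (hg0 i)
    _ = (∑ i, g i * u i + ∑ i, g i * u i ^ 2) + 1 := by
        simp only [mul_add, Finset.sum_add_distrib, mul_one, hg1]
        ring
    _ ≤ _ := Real.add_one_le_exp _

/-- All supermartingales below come from this: a bound `V` on first plus second moment compensates
the exponential of an increment in `[-1, 1]`. -/
lemma sum_mul_exp_sub_le_one {g u : ι → ℝ} {V : ℝ} (hg0 : ∀ i, 0 ≤ g i) (hg1 : ∑ i, g i = 1)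
    (hu : ∀ i, |u i| ≤ 1) (hV : ∑ i, g i * u i + ∑ i, g i * u i ^ 2 ≤ V) :
    ∑ i, g i * Real.exp (u i - V) ≤ 1 := by
  calc ∑ i, g i * Real.exp (u i - V) = (∑ i, g i * Real.exp (u i)) * Real.exp (-V) := by
        rw [Finset.sum_mul]
        exact Finset.sum_congr rfl fun i _ => by rw [mul_assoc, ← Real.exp_add, sub_eq_add_neg]
    _ ≤ Real.exp V * Real.exp (-V) := by
        gcongr
        exact (sum_mul_exp_le hg0 hg1 hu).trans (Real.exp_le_exp.2 hV)
    _ = 1 := by rw [← Real.exp_add, add_neg_cancel, Real.exp_zero]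

/-! ### Exponential weights -/

/-- The exponential weights distribution. -/
def softmax (η : ℝ) (S : ι → ℝ) (i : ι) : ℝ := Real.exp (η * S i) / ∑ j, Real.exp (η * S j)

lemma softmax_nonneg (η : ℝ) (S : ι → ℝ) (i : ι) : 0 ≤ softmax η S i := by
  unfold softmax
  positivity

variable [Nonempty ι]

lemma sum_exp_pos (η : ℝ) (S : ι → ℝ) : 0 < ∑ j, Real.exp (η * S j) :=
  Finset.sum_pos (fun _ _ => Real.exp_pos _) Finset.univ_nonempty

lemma sum_softmax (η : ℝ) (S : ι → ℝ) : ∑ i, softmax η S i = 1 := by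
  unfold softmax
  rw [← Finset.sum_div, div_self (sum_exp_pos η S).ne']

/-- Monotonicity of power means, with exponent `η' / η ≥ 1`. It lets the potential survive a
decrease of the learning rate. -/
lemma sum_exp_le_of_le {S : ι → ℝ} {η η' B : ℝ} (hη : 0 < η) (hle : η ≤ η')
    (h : ∑ i, Real.exp (η' * S i) ≤ Fintype.card ι * Real.exp (η' * B)) :
    ∑ i, Real.exp (η * S i) ≤ Fintype.card ι * Real.exp (η * B) := by
  have hN : (0 : ℝ) < Fintype.card ι := Nat.cast_pos.2 Fintype.card_pos
  set w : ι → ℝ := fun _ => (Fintype.card ι : ℝ)⁻¹ with hw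
  have hp : 1 ≤ η' / η := (one_le_div hη).2 hle
  have hw1 : ∑ i, w i = 1 := by simp [hw, hN.ne']
  have h1 := Real.rpow_arith_mean_le_arith_mean_rpow Finset.univ w
    (fun i => Real.exp (η * S i)) (fun i _ => by positivity) hw1
    (fun i _ => (Real.exp_pos _).le) hp
  have h2 : ∀ i, Real.exp (η * S i) ^ (η' / η) = Real.exp (η' * S i) := fun i => by
    rw [← Real.exp_mul]
    congr 1
    field_simp
  simp only [h2, hw, ← Finset.mul_sum] at h1
  have h3 : (Fintype.card ι : ℝ)⁻¹ * ∑ i, Real.exp (η' * S i) ≤ Real.exp (η * B) ^ (η' / η) := by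
    rw [← Real.exp_mul, inv_mul_le_iff₀ hN]
    refine h.trans (le_of_eq ?_)
    congr 2
    field_simp
  have h4 := h1.trans h3
  rw [Real.rpow_le_rpow_iff (by positivity) (Real.exp_pos _).le (by positivity)] at h4
  rwa [inv_mul_le_iff₀ hN] at h4

/-- Potential bound for exponential weights with antitone learning rates. -/
lemma sum_exp_le_exp_potential {S r : ℕ → ι → ℝ} {η : ℕ → ℝ} {M : ℝ} {s : ℕ} (n : ℕ) (hn : s ≤ n)
    (hM : ∀ i, S s i ≤ M)
    (hS : ∀ l, s < l → l ≤ n → ∀ i, S l i = S (l - 1) i + r l i)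
    (hη0 : ∀ l, s < l → l ≤ n → 0 < η l)
    (hη : ∀ k l, s < k → k ≤ l → l ≤ n → η l ≤ η k)
    (hr : ∀ l, s < l → l ≤ n → ∀ i, |η l * r l i| ≤ 1)
    (η' : ℝ) (hη' : 0 < η') (hle : ∀ l, s < l → l ≤ n → η' ≤ η l) :
    ∑ i, Real.exp (η' * S n i) ≤ Fintype.card ι * Real.exp (η' * (M + ∑ l ∈ Finset.Ioc s n,
      (∑ i, softmax (η l) (S (l - 1)) i * r l i
        + η l * ∑ i, softmax (η l) (S (l - 1)) i * r l i ^ 2))) := by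
  induction n, hn using Nat.le_induction generalizing η' with
  | base =>
    calc ∑ i, Real.exp (η' * S s i) ≤ ∑ _i : ι, Real.exp (η' * M) :=
          Finset.sum_le_sum fun i _ =>
            Real.exp_le_exp.2 (mul_le_mul_of_nonneg_left (hM i) hη'.le)
      _ = _ := by simp
  | succ n hn ih =>
    have hs : s < n + 1 := Nat.lt_succ_of_le hn
    -- The step is carried out at the rate of round `n + 1` and then lowered to `η'`; the induction
    -- hypothesis is therefore used at the rate `η (n + 1)`.
    refine sum_exp_le_of_le hη' (hle (n + 1) hs le_rfl) ?_
    have hpos := hη0 (n + 1) hs le_rfl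
    have ih' := ih (fun l h1 h2 => hS l h1 (by omega)) (fun l h1 h2 => hη0 l h1 (by omega))
      (fun k l h1 h2 h3 => hη k l h1 h2 (by omega)) (fun l h1 h2 => hr l h1 (by omega))
      (η (n + 1)) hpos (fun l h1 h2 => hη l (n + 1) h1 (by omega) le_rfl)
    rw [Finset.sum_Ioc_succ_top (by omega)]
    set e := η (n + 1) with he
    set q := softmax e (S n) with hq
    simp only [Nat.add_sub_cancel, ← hq]
    have hD := sum_exp_pos e (S n)
    have h1 : ∑ i, Real.exp (e * S (n + 1) i)
        = (∑ i, Real.exp (e * S n i)) * ∑ i, q i * Real.exp (e * r (n + 1) i) := by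
      rw [Finset.mul_sum]
      refine Finset.sum_congr rfl fun i _ => ?_
      rw [hS (n + 1) hs le_rfl, mul_add, Real.exp_add, hq, softmax, Nat.add_sub_cancel]
      field_simp
    have h2 := sum_mul_exp_le (softmax_nonneg e (S n)) (sum_softmax e (S n))
      (hr (n + 1) hs le_rfl)
    rw [h1]
    refine (mul_le_mul ih' h2 (Finset.sum_nonneg fun i _ =>
      mul_nonneg (softmax_nonneg _ _ _) (Real.exp_pos _).le) (by positivity)).trans (le_of_eq ?_)
    rw [mul_assoc, ← Real.exp_add]
    congr 2
    simp only [mul_pow, Finset.mul_sum, mul_add, ← hq, ← he]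
    rw [add_assoc]
    congr 3
    all_goals
      refine Finset.sum_congr rfl fun i _ => ?_
      ring

/-- Regret of exponential weights with antitone learning rates. -/
lemma exponential_weights_bound {S r : ℕ → ι → ℝ} {η : ℕ → ℝ} {M : ℝ} {s n : ℕ} (hn : s < n)
    (hM : ∀ i, S s i ≤ M)
    (hS : ∀ l, s < l → l ≤ n → ∀ i, S l i = S (l - 1) i + r l i)
    (hη0 : ∀ l, s < l → l ≤ n → 0 < η l)
    (hη : ∀ k l, s < k → k ≤ l → l ≤ n → η l ≤ η k)
    (hr : ∀ l, s < l → l ≤ n → ∀ i, |η l * r l i| ≤ 1) (i : ι) :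
    S n i ≤ M + ∑ l ∈ Finset.Ioc s n,
      (∑ i, softmax (η l) (S (l - 1)) i * r l i
        + η l * ∑ i, softmax (η l) (S (l - 1)) i * r l i ^ 2)
      + Real.log (Fintype.card ι) / η n := by
  have hpos := hη0 n hn le_rfl
  have hN : (0 : ℝ) < Fintype.card ι := Nat.cast_pos.2 Fintype.card_pos
  have h := sum_exp_le_exp_potential n hn.le hM hS hη0 hη hr (η n) hpos
    fun l h1 h2 => hη l n h1 h2 le_rfl
  have h1 := (Finset.single_le_sum (f := fun i => Real.exp (η n * S n i))
    (fun i _ => (Real.exp_pos _).le) (Finset.mem_univ i)).trans h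
  have h2 := Real.log_le_log (Real.exp_pos _) h1
  rw [Real.log_exp, Real.log_mul hN.ne' (Real.exp_pos _).ne', Real.log_exp] at h2
  rw [← sub_le_iff_le_add', le_div_iff₀ hpos]
  nlinarith

end Exponential

/-! ### One-round exponential moments under the sampling law -/

section Bernoulli

variable {d : ℕ} {A : Finset (Fin d → ℝ)}

/-- The joint law of an action drawn from `p` and an independent `Ber(ρ)` variable. -/
def drawLaw (p : A → ℝ) (ρ : ℝ) (i : A × Bool) : ℝ := p i.1 * (if i.2 then ρ else 1 - ρ)

/-- The importance-weighted observation as a function of the action and the Bernoulli variable. -/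
def drawObs (ρ : ℝ) (θ : Fin d → ℝ) (i : A × Bool) : ℝ :=
  if i.2 then ((i.1 : Fin d → ℝ) ⬝ᵥ θ) / ρ else 0

variable {p : A → ℝ} {ρ : ℝ}

lemma drawLaw_nonneg (hp : ∀ x, 0 ≤ p x) (hρ : 0 ≤ ρ) (hρ1 : ρ ≤ 1) (i : A × Bool) :
    0 ≤ drawLaw p ρ i := by
  unfold drawLaw
  refine mul_nonneg (hp _) ?_
  split_ifs <;> linarith

lemma sum_drawLaw_mul (f : A × Bool → ℝ) : ∑ i, drawLaw p ρ i * f i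
    = ∑ x, p x * (ρ * f (x, true) + (1 - ρ) * f (x, false)) := by
  rw [Fintype.sum_prod_type]
  refine Finset.sum_congr rfl fun x _ => ?_
  simp [drawLaw]
  ring

lemma sum_drawLaw (hp1 : ∑ x, p x = 1) : ∑ i, drawLaw p ρ i = 1 := by
  have := sum_drawLaw_mul (p := p) (ρ := ρ) fun _ => 1
  simp only [mul_one, add_sub_cancel, hp1] at this
  exact this

/-- Exponential moment of the error of the least squares estimate in a direction `v`. -/
lemma sum_drawLaw_mul_exp_estimate (hp0 : ∀ x, 0 ≤ p x) (hp1 : ∑ x, p x = 1)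
    (hp : (cov p).PosDef) (hρ : 0 < ρ) (hρ1 : ρ ≤ 1) {θ v : Fin d → ℝ} {lam κ : ℝ}
    (hθ : ∀ x ∈ A, |x ⬝ᵥ θ| ≤ 1) (hv : |v ⬝ᵥ θ| ≤ 1) (hκ : ∀ x ∈ A, |invForm p v x| ≤ κ)
    (hlam : |lam| * (1 + κ / ρ) ≤ 1) :
    ∑ i : A × Bool, drawLaw p ρ i * Real.exp (lam * (v ⬝ᵥ θ - drawObs ρ θ i * invForm p v i.1)
      - lam ^ 2 * invForm p v v / ρ) ≤ 1 := by
  refine sum_mul_exp_sub_le_one (drawLaw_nonneg hp0 hρ.le hρ1) (sum_drawLaw hp1) ?_ ?_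
  · intro i
    rw [abs_mul]
    refine le_trans (mul_le_mul_of_nonneg_left ?_ (abs_nonneg _)) hlam
    refine (abs_sub _ _).trans (add_le_add hv ?_)
    have hk := hκ i.1 i.1.2
    have hk0 : 0 ≤ κ := (abs_nonneg _).trans hk
    rw [abs_mul]
    have ho : |drawObs ρ θ i| ≤ 1 / ρ := by
      unfold drawObs
      split_ifs
      · rw [abs_div, abs_of_pos hρ]
        exact div_le_div_of_nonneg_right (hθ _ i.1.2) hρ.le
      · rw [abs_zero]
        positivity
    calc |drawObs ρ θ i| * |invForm p v i.1| ≤ 1 / ρ * κ :=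
          mul_le_mul ho hk (abs_nonneg _) (by positivity)
      _ = κ / ρ := by ring
  · have hmean := sum_mul_dotProduct_mul_invForm hp v θ
    have hsq := sum_mul_invForm_sq hp v
    rw [sum_drawLaw_mul, sum_drawLaw_mul]
    simp only [drawObs, if_true, Bool.false_eq_true, if_false, zero_mul, sub_zero]
    set m := v ⬝ᵥ θ
    -- The first moment vanishes because the importance-weighted estimate is unbiased.
    have e1 : ∑ x : A, p x * (ρ * (lam * (m - (x : Fin d → ℝ) ⬝ᵥ θ / ρ * invForm p v x))
        + (1 - ρ) * (lam * m)) = 0 := by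
      calc _ = lam * (m * ∑ x : A, p x
            - ∑ x : A, p x * ((x : Fin d → ℝ) ⬝ᵥ θ) * invForm p v x) := by
            rw [Finset.mul_sum, ← Finset.sum_sub_distrib, Finset.mul_sum]
            refine Finset.sum_congr rfl fun x _ => ?_
            field_simp
            ring
        _ = 0 := by rw [hp1, hmean]; ring
    -- Importance weighting inflates the second moment by `1 / ρ`, since the squared `1 / ρ` is seen
    -- with probability `ρ` only.
    have e2 : ∑ x : A, p x * (ρ * (lam * (m - (x : Fin d → ℝ) ⬝ᵥ θ / ρ * invForm p v x)) ^ 2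
        + (1 - ρ) * (lam * m) ^ 2)
        = lam ^ 2 * (1 / ρ * ∑ x : A, p x * (((x : Fin d → ℝ) ⬝ᵥ θ) ^ 2 * invForm p v x ^ 2)
          - m ^ 2) := by
      calc _ = lam ^ 2 * (m ^ 2 * ∑ x : A, p x
            - 2 * m * ∑ x : A, p x * ((x : Fin d → ℝ) ⬝ᵥ θ) * invForm p v x
            + 1 / ρ * ∑ x : A, p x * (((x : Fin d → ℝ) ⬝ᵥ θ) ^ 2 * invForm p v x ^ 2)) := by
            simp only [Finset.mul_sum]
            rw [← Finset.sum_sub_distrib, ← Finset.sum_add_distrib, Finset.mul_sum]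
            refine Finset.sum_congr rfl fun x _ => ?_
            field_simp
            ring
        _ = _ := by rw [hp1, hmean]; ring
    rw [e1, e2, zero_add, ← hsq, mul_div_assoc]
    refine mul_le_mul_of_nonneg_left ?_ (sq_nonneg _)
    have h3 : ∑ x : A, p x * (((x : Fin d → ℝ) ⬝ᵥ θ) ^ 2 * invForm p v x ^ 2)
        ≤ ∑ x : A, p x * invForm p v x ^ 2 :=
      Finset.sum_le_sum fun x _ => mul_le_mul_of_nonneg_left
        (mul_le_of_le_one_left (sq_nonneg _) ((sq_le_one_iff_abs_le_one _).2 (hθ x x.2))) (hp0 x)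
    have h4 : 1 / ρ * ∑ x : A, p x * (((x : Fin d → ℝ) ⬝ᵥ θ) ^ 2 * invForm p v x ^ 2)
        ≤ 1 / ρ * ∑ x : A, p x * invForm p v x ^ 2 := by gcongr
    have h5 : (∑ x : A, p x * invForm p v x ^ 2) / ρ = 1 / ρ * ∑ x : A, p x * invForm p v x ^ 2 := by
      ring
    linarith [sq_nonneg m]

/-- Exponential moment of the difference between the mean reward and the reward. -/
lemma sum_drawLaw_mul_exp_reward (hp0 : ∀ x, 0 ≤ p x) (hp1 : ∑ x, p x = 1)
    (hρ : 0 < ρ) (hρ1 : ρ ≤ 1) {θ : Fin d → ℝ} {lam : ℝ}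
    (hθ : ∀ x ∈ A, |x ⬝ᵥ θ| ≤ 1) (hlam : |lam| * 2 ≤ 1) :
    ∑ i : A × Bool, drawLaw p ρ i * Real.exp (lam * (∑ x : A, p x * ((x : Fin d → ℝ) ⬝ᵥ θ)
      - (i.1 : Fin d → ℝ) ⬝ᵥ θ) - lam ^ 2) ≤ 1 := by
  set m := ∑ x : A, p x * ((x : Fin d → ℝ) ⬝ᵥ θ) with hm
  have hm1 : |m| ≤ 1 := by
    calc |m| ≤ ∑ x : A, |p x * ((x : Fin d → ℝ) ⬝ᵥ θ)| := Finset.abs_sum_le_sum_abs _ _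
      _ ≤ ∑ x : A, p x := Finset.sum_le_sum fun x _ => by
          rw [abs_mul, abs_of_nonneg (hp0 x)]
          exact mul_le_of_le_one_right (hp0 x) (hθ x x.2)
      _ = 1 := hp1
  refine sum_mul_exp_sub_le_one (drawLaw_nonneg hp0 hρ.le hρ1) (sum_drawLaw hp1) ?_ ?_
  · intro i
    rw [abs_mul]
    refine le_trans (mul_le_mul_of_nonneg_left ?_ (abs_nonneg _)) hlam
    exact (abs_sub _ _).trans (by linarith [hθ i.1 i.1.2])
  · rw [sum_drawLaw_mul, sum_drawLaw_mul]
    have e1 : ∑ x : A, p x * (ρ * (lam * (m - (x : Fin d → ℝ) ⬝ᵥ θ))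
        + (1 - ρ) * (lam * (m - (x : Fin d → ℝ) ⬝ᵥ θ))) = 0 := by
      calc _ = lam * (m * ∑ x : A, p x - m) := by
            conv_rhs => rw [hm, ← hm, Finset.mul_sum]
            conv_rhs => enter [2, 2]; rw [hm]
            rw [← Finset.sum_sub_distrib, Finset.mul_sum]
            exact Finset.sum_congr rfl fun x _ => by ring
        _ = 0 := by rw [hp1]; ring
    have e2 : ∑ x : A, p x * (ρ * (lam * (m - (x : Fin d → ℝ) ⬝ᵥ θ)) ^ 2
        + (1 - ρ) * (lam * (m - (x : Fin d → ℝ) ⬝ᵥ θ)) ^ 2)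
        = lam ^ 2 * (∑ x : A, p x * ((x : Fin d → ℝ) ⬝ᵥ θ) ^ 2 - m ^ 2) := by
      calc _ = lam ^ 2 * (m ^ 2 * ∑ x : A, p x - 2 * m * ∑ x : A, p x * ((x : Fin d → ℝ) ⬝ᵥ θ)
            + ∑ x : A, p x * ((x : Fin d → ℝ) ⬝ᵥ θ) ^ 2) := by
            simp only [Finset.mul_sum]
            rw [← Finset.sum_sub_distrib, ← Finset.sum_add_distrib, Finset.mul_sum]
            exact Finset.sum_congr rfl fun x _ => by ring
        _ = _ := by rw [hp1, ← hm]; ring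
    rw [e1, e2, zero_add]
    refine mul_le_of_le_one_right (sq_nonneg _) ?_
    have : ∑ x : A, p x * ((x : Fin d → ℝ) ⬝ᵥ θ) ^ 2 ≤ ∑ x : A, p x :=
      Finset.sum_le_sum fun x _ => mul_le_of_le_one_right (hp0 x)
        ((sq_le_one_iff_abs_le_one _).2 (hθ x x.2))
    linarith [sq_nonneg m]

/-- Exponential moment of the squared norm of the least squares estimate. -/
lemma sum_drawLaw_mul_exp_norm (hp0 : ∀ x, 0 ≤ p x) (hp1 : ∑ x, p x = 1)
    (hp : (cov p).PosDef) (hρ : 0 < ρ) (hρ1 : ρ ≤ 1) {θ : Fin d → ℝ} {lam κ : ℝ}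
    (hθ : ∀ x ∈ A, |x ⬝ᵥ θ| ≤ 1) (hlam0 : 0 ≤ lam)
    (hκ : ∀ x ∈ A, invForm p x x ≤ κ) (hlam : lam * (κ / ρ ^ 2) ≤ 1) :
    ∑ i : A × Bool, drawLaw p ρ i * Real.exp (lam * (drawObs ρ θ i ^ 2 * invForm p i.1 i.1)
      - 2 * (lam * (d / ρ))) ≤ 1 := by
  have hK0 : ∀ x : A, 0 ≤ invForm p x x := fun x => invForm_self_nonneg hp hp0 x
  have ho : ∀ i : A × Bool, drawObs ρ θ i ^ 2 ≤ 1 / ρ ^ 2 := fun i => by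
    unfold drawObs
    split_ifs
    · rw [div_pow]
      exact div_le_div_of_nonneg_right ((sq_le_one_iff_abs_le_one _).2 (hθ _ i.1.2))
        (sq_nonneg _)
    · rw [zero_pow two_ne_zero]
      positivity
  have hu0 : ∀ i : A × Bool, 0 ≤ lam * (drawObs ρ θ i ^ 2 * invForm p i.1 i.1) := fun i =>
    mul_nonneg hlam0 (mul_nonneg (sq_nonneg _) (hK0 _))
  have hu1 : ∀ i : A × Bool, lam * (drawObs ρ θ i ^ 2 * invForm p i.1 i.1) ≤ 1 := fun i => by
    refine le_trans (mul_le_mul_of_nonneg_left ?_ hlam0) hlam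
    calc drawObs ρ θ i ^ 2 * invForm p i.1 i.1 ≤ 1 / ρ ^ 2 * κ :=
          mul_le_mul (ho i) (hκ _ i.1.2) (hK0 _) (by positivity)
      _ = κ / ρ ^ 2 := by ring
  have hg := drawLaw_nonneg hp0 hρ.le hρ1
  refine sum_mul_exp_sub_le_one hg (sum_drawLaw hp1)
    (fun i => by rw [abs_of_nonneg (hu0 i)]; exact hu1 i) ?_
  have h1 : ∑ i : A × Bool, drawLaw p ρ i * (lam * (drawObs ρ θ i ^ 2 * invForm p i.1 i.1))
      ≤ lam * (d / ρ) := by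
    rw [sum_drawLaw_mul]
    simp only [drawObs, if_true, Bool.false_eq_true, if_false]
    rw [← sum_mul_invForm_self hp, Finset.sum_div, Finset.mul_sum]
    refine Finset.sum_le_sum fun x _ => ?_
    have hx := (sq_le_one_iff_abs_le_one _).2 (hθ x x.2)
    have hpos : 0 ≤ lam * (p x * invForm p x x / ρ) :=
      mul_nonneg hlam0 (div_nonneg (mul_nonneg (hp0 x) (hK0 x)) hρ.le)
    calc _ = (lam * (p x * invForm p x x / ρ)) * ((x : Fin d → ℝ) ⬝ᵥ θ) ^ 2 := by
          field_simp
          ring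
      _ ≤ _ := mul_le_of_le_one_right hpos hx
  -- The increments lie in `[0, 1]`, so the second moment costs at most another first moment; hence
  -- the factor 2 in the compensator.
  have h2 : ∑ i : A × Bool, drawLaw p ρ i * (lam * (drawObs ρ θ i ^ 2 * invForm p i.1 i.1)) ^ 2
      ≤ ∑ i : A × Bool, drawLaw p ρ i * (lam * (drawObs ρ θ i ^ 2 * invForm p i.1 i.1)) :=
    Finset.sum_le_sum fun i _ => mul_le_mul_of_nonneg_left (by nlinarith [hu0 i, hu1 i]) (hg i)
  linarith

end Bernoulli

/-! ### Measurability of the algorithm along a run -/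

section Run

variable {d : ℕ} {A : Finset (Fin d → ℝ)}

lemma continuous_cov : Continuous (cov : (A → ℝ) → Matrix (Fin d) (Fin d) ℝ) := by
  unfold cov
  fun_prop

/-- Cramer's rule: determinant and adjugate are continuous in `p`, so measurability of the form
needs no invertibility of the covariance. -/
lemma invForm_eq (p : A → ℝ) (x y : Fin d → ℝ) :
    invForm p x y = (cov p).det⁻¹ * (x ⬝ᵥ ((cov p).adjugate *ᵥ y)) := by
  unfold invForm
  rw [Matrix.inv_def, Ring.inverse_eq_inv', Matrix.smul_mulVec, dotProduct_smul, smul_eq_mul]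

lemma measurable_invForm {Ω : Type*} {m : MeasurableSpace Ω} {p : Ω → A → ℝ}
    {x y : Ω → Fin d → ℝ} (hp : ∀ i, Measurable fun w => p w i) (hx : Measurable x)
    (hy : Measurable y) : Measurable fun w => invForm (p w) (x w) (y w) := by
  have hp' : Measurable p := measurable_pi_lambda _ hp
  simp only [invForm_eq]
  have h1 : Continuous fun q : A → ℝ => (cov q).det := continuous_cov.matrix_det
  have h2 : Continuous fun z : (A → ℝ) × (Fin d → ℝ) × (Fin d → ℝ) =>
      z.2.1 ⬝ᵥ ((cov z.1).adjugate *ᵥ z.2.2) :=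
    (continuous_fst.comp continuous_snd).dotProduct
      ((continuous_cov.comp continuous_fst).matrix_adjugate.matrix_mulVec
        (continuous_snd.comp continuous_snd))
  exact (h1.measurable.comp hp').inv.mul (h2.measurable.comp (hp'.prodMk (hx.prodMk hy)))

lemma measurable_dotProduct {Ω : Type*} {m : MeasurableSpace Ω} {x y : Ω → Fin d → ℝ}
    (hx : Measurable x) (hy : Measurable y) : Measurable fun w => x w ⬝ᵥ y w := by
  have h : Continuous fun z : (Fin d → ℝ) × (Fin d → ℝ) => z.1 ⬝ᵥ z.2 :=
    continuous_fst.dotProduct continuous_snd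
  exact h.measurable.comp (hx.prodMk hy)

/-- The width `√(ln(12 t² / δ') / (ρ d t))` of the confidence interval. -/
def width (A : Finset (Fin d → ℝ)) (ρ δ : ℝ) (t : ℕ) : ℝ :=
  √(Real.log (12 * (t : ℝ) ^ 2 / (δ / A.card)) / (ρ * d * t))

lemma rewardUpper_eq (ρ δ : ℝ) (t : ℕ) (p : A → ℝ) (act : A) (o : ℝ) (x : A) :
    rewardUpper ρ δ t p act o x
      = o * invForm p x act + 2 * invForm p x x * width A ρ δ t := by
  rw [rewardUpper, dotProduct_smul, smul_eq_mul]
  rfl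

variable {Ω : Type*} (pE : A → ℝ) (c ρ δ : ℝ) (θ : ℕ → Ω → Fin d → ℝ) (a : ℕ → Ω → A)
  (b : ℕ → Ω → Bool)

/-- The cumulative reward upper bounds along a run. -/
def cumProc (t : ℕ) (w : Ω) : A → ℝ :=
  cumUpper pE c ρ δ (fun s => a s w) (fun s => obs ρ θ a b s w) t

/-- The exponential weights distribution along a run. -/
def hedgeProc (t : ℕ) (w : Ω) : A → ℝ := softmax (eta A c ρ δ t) (cumProc pE c ρ δ θ a b (t - 1) w)

/-- The sampling distribution along a run. -/
def policyProc (t : ℕ) (w : Ω) : A → ℝ :=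
  geoHedge pE c ρ δ t (fun s => a s w) (fun s => obs ρ θ a b s w)

lemma policyProc_apply (t : ℕ) (w : Ω) (x : A) : policyProc pE c ρ δ θ a b t w x
    = (1 - gam A ρ δ t) * hedgeProc pE c ρ δ θ a b t w x + gam A ρ δ t * pE x := rfl

lemma cumProc_succ (t : ℕ) (w : Ω) (x : A) : cumProc pE c ρ δ θ a b (t + 1) w x
    = cumProc pE c ρ δ θ a b t w x
      + (obs ρ θ a b (t + 1) w * invForm (policyProc pE c ρ δ θ a b (t + 1) w) x (a (t + 1) w)
        + 2 * invForm (policyProc pE c ρ δ θ a b (t + 1) w) x x * width A ρ δ (t + 1)) := by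
  rw [cumProc, cumUpper]
  beta_reduce
  rw [rewardUpper_eq]
  rfl

variable {pE c ρ δ θ a b}

section Measurable

lemma measurable_drawObs {m : MeasurableSpace Ω} {ϑ : Ω → Fin d → ℝ} (hϑ : Measurable[m] ϑ)
    (i : A × Bool) : Measurable[m] fun w => drawObs ρ (ϑ w) i := by
  unfold drawObs
  split_ifs
  · exact (measurable_dotProduct measurable_const hϑ).div_const ρ
  · exact measurable_const

lemma measurable_policyProc_of_cumProc {m : MeasurableSpace Ω} {t : ℕ}
    (h : ∀ x, Measurable[m] fun w => cumProc pE c ρ δ θ a b (t - 1) w x) (x : A) :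
    Measurable[m] fun w => policyProc pE c ρ δ θ a b t w x := by
  simp only [policyProc_apply, hedgeProc, softmax]
  have hexp : ∀ y, Measurable[m] fun w =>
      Real.exp (eta A c ρ δ t * cumProc pE c ρ δ θ a b (t - 1) w y) := fun y =>
    Real.measurable_exp.comp ((h y).const_mul _)
  exact (((hexp x).div (Finset.measurable_fun_sum _ fun y _ => hexp y)).const_mul _).add_const _

variable [mΩ : MeasurableSpace Ω] {μ : Measure Ω} {G : Filtration ℕ mΩ} {L : Learner A}

lemma IsRun.measurable_draw (h : IsRun L ρ μ G θ a b) {l k : ℕ} (hl : 1 ≤ l) (hlk : l < k) :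
    Measurable[G k] fun w => (a l w, b l w) :=
  (h.measurable_action l k hl hlk).prodMk (h.measurable_bern l k hl hlk)

lemma IsRun.measurable_reward_of_le (h : IsRun L ρ μ G θ a b) {l k : ℕ} (hl : 1 ≤ l)
    (hlk : l ≤ k) : Measurable[G k] (θ l) :=
  (h.measurable_reward l hl).mono (G.mono hlk) le_rfl

lemma IsRun.measurable_obs (h : IsRun L ρ μ G θ a b) {l k : ℕ} (hl : 1 ≤ l) (hlk : l < k) :
    Measurable[G k] (obs ρ θ a b l) :=
  measurable_apply_of_finite (y := fun i w => drawObs ρ (θ l w) i) (h.measurable_draw hl hlk)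
    fun i => measurable_drawObs (h.measurable_reward_of_le hl hlk.le) i

lemma IsRun.measurable_cumProc (h : IsRun L ρ μ G θ a b) (t : ℕ) {k : ℕ} (hk : t < k) (x : A) :
    Measurable[G k] fun w => cumProc pE c ρ δ θ a b t w x := by
  induction t generalizing x with
  | zero => exact measurable_const
  | succ t ih =>
    simp only [cumProc_succ]
    have hP : ∀ y, Measurable[G k] fun w => policyProc pE c ρ δ θ a b (t + 1) w y :=
      measurable_policyProc_of_cumProc fun y => ih (by omega) y
    have ha : Measurable[G k] fun w => (a (t + 1) w : Fin d → ℝ) :=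
      measurable_subtype_coe.comp (h.measurable_action (t + 1) k (by omega) hk)
    exact (ih (by omega) x).add
      (((h.measurable_obs (by omega) hk).mul (measurable_invForm hP measurable_const ha)).add
        (((measurable_invForm hP measurable_const measurable_const).const_mul 2).mul_const _))

lemma IsRun.measurable_policyProc (h : IsRun L ρ μ G θ a b) {t : ℕ} (ht : 1 ≤ t) (x : A) :
    Measurable[G t] fun w => policyProc pE c ρ δ θ a b t w x :=
  measurable_policyProc_of_cumProc (fun y => h.measurable_cumProc (t - 1) (by omega) y) x

lemma IsRun.measurable_hedgeProc (h : IsRun L ρ μ G θ a b) {t : ℕ} (ht : 1 ≤ t) (x : A) :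
    Measurable[G t] fun w => hedgeProc pE c ρ δ θ a b t w x := by
  simp only [hedgeProc, softmax]
  have hexp : ∀ y, Measurable[G t] fun w =>
      Real.exp (eta A c ρ δ t * cumProc pE c ρ δ θ a b (t - 1) w y) := fun y =>
    Real.measurable_exp.comp ((h.measurable_cumProc (t - 1) (by omega) y).const_mul _)
  exact (hexp x).div (Finset.measurable_fun_sum _ fun y _ => hexp y)

/-- Deviation bound for sums of functions of the draws along a run of the algorithm. -/
lemma IsRun.measure_lt_sum_le [IsProbabilityMeasure μ]
    (h : IsRun (geoHedge pE c ρ δ) ρ μ G θ a b) {y : ℕ → A × Bool → Ω → ℝ} {s : ℕ}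
    (hρ : 0 ≤ ρ) (hρ1 : ρ ≤ 1)
    (hP : ∀ l, s < l → ∀ w x, 0 ≤ policyProc pE c ρ δ θ a b l w x)
    (hy : ∀ l, s < l → ∀ i, Measurable[G l] (y l i)) (n : ℕ)
    (h1 : ∀ l, s < l → l ≤ n → ∀ w,
      ∑ i, drawLaw (policyProc pE c ρ δ θ a b l w) ρ i * Real.exp (y l i w) ≤ 1) (r : ℝ) :
    μ {w | r < ∑ l ∈ Finset.Ioc s n, y l (a l w, b l w) w} ≤ ENNReal.ofReal (Real.exp (-r)) := by
  refine measure_lt_sum_le_exp_neg (Z := fun l w => (a l w, b l w))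
    (g := fun l i w => drawLaw (policyProc pE c ρ δ θ a b l w) ρ i)
    (fun l k hl hk => h.measurable_draw (by omega) hk) ?_ hy
    (fun l hl i w => drawLaw_nonneg (hP l hl w) hρ hρ1 i) n h1 r
  rintro l hl ⟨x, β⟩
  have := h.law l (by omega) x β
  simp only [Prod.mk.injEq]
  exact this

end Measurable

end Run

/-! ### Monotonicity and comparison of the tuning parameters -/

section Scalars

lemma mul_sqrt_eq {k : ℝ} (hk : 0 ≤ k) (y : ℝ) : k * √y = √(k ^ 2 * y) := by
  rw [Real.sqrt_mul (sq_nonneg k), Real.sqrt_sq hk]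

variable {d : ℕ} (A : Finset (Fin d → ℝ)) (ρ δ : ℝ)

/-- The unclipped mixing coefficient. -/
def ratio (t : ℕ) : ℝ := √((d : ℝ) * Real.log A.card * Real.log (t / δ) / (ρ * t))

/-- The logarithmic confidence level `ln(12 t² / δ')`. -/
def conf (t : ℕ) : ℝ := Real.log (12 * (t : ℝ) ^ 2 / (δ / A.card))

/-- The leading term of the regret. -/
def lead (t : ℕ) : ℝ := √((d : ℝ) * t * Real.log A.card / ρ * Real.log (t / δ))

variable {A ρ δ}

lemma gam_eq (t : ℕ) : gam A ρ δ t = min (ratio A ρ δ t) (1 / 2) := rfl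

lemma width_eq (t : ℕ) : width A ρ δ t = √(conf A δ t / (ρ * d * t)) := rfl

lemma lead_nonneg (t : ℕ) : 0 ≤ lead A ρ δ t := Real.sqrt_nonneg _

lemma width_nonneg (t : ℕ) : 0 ≤ width A ρ δ t := Real.sqrt_nonneg _

variable (hd : 0 < d) (hN : 2 ≤ A.card) (hρ : 0 < ρ) (hδ : 0 < δ) (hδ1 : δ < 1)

/-- In particular a round with `ratio ≥ 1/2` has `t ≤ 2 * lead`, so the clipped phase can be paid
for trivially. -/
lemma lead_eq (hρ : 0 < ρ) {t : ℕ} (ht : 0 < t) : lead A ρ δ t = t * ratio A ρ δ t := by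
  have ht' : (0 : ℝ) < t := Nat.cast_pos.2 ht
  rw [lead, ratio, mul_sqrt_eq ht'.le]
  congr 1
  field_simp

lemma one_le_log {t : ℕ} (ht : Real.exp 1 ≤ t / δ) : 1 ≤ Real.log (t / δ) :=
  (Real.le_log_iff_exp_le ((Real.exp_pos 1).trans_le ht)).2 ht

lemma pos_of_exp_le {t : ℕ} (ht : Real.exp 1 ≤ t / δ) : 0 < t := by
  rcases Nat.eq_zero_or_pos t with rfl | h
  · have := Real.exp_pos 1
    simp only [Nat.cast_zero, zero_div] at ht
    linarith
  · exact h

lemma log_card_gt (hN : 2 ≤ A.card) : 0.69 < Real.log A.card := by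
  have h2 : Real.log 2 ≤ Real.log A.card :=
    Real.log_le_log (by norm_num) (by exact_mod_cast hN)
  linarith [Real.log_two_gt_d9]

include hN hδ in
lemma conf_eq {t : ℕ} (ht : 0 < t) :
    conf A δ t = Real.log 12 + 2 * Real.log t + Real.log A.card - Real.log δ := by
  have ht' : (t : ℝ) ≠ 0 := by positivity
  have hN' : (A.card : ℝ) ≠ 0 := by
    have : 0 < A.card := by omega
    positivity
  rw [conf, Real.log_div (by positivity) (by positivity), Real.log_mul (by norm_num) (by positivity),
    Real.log_div hδ.ne' hN', Real.log_pow]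
  push_cast
  ring

lemma log_twelve_bounds : 2 ≤ Real.log 12 ∧ Real.log 12 ≤ 2.5 := by
  have h1 : Real.log 12 = 2 * Real.log 2 + Real.log 3 := by
    rw [show (12 : ℝ) = 2 ^ 2 * 3 by norm_num, Real.log_mul (by norm_num) (by norm_num),
      Real.log_pow]
    norm_num
  have h2 := Real.log_two_gt_d9
  have h3 := Real.log_two_lt_d9
  have h4 := Real.log_three_gt_d9
  have h5 := Real.log_three_lt_d9
  constructor <;> linarith

include hN hδ hδ1 in
lemma one_le_conf {t : ℕ} (ht : 0 < t) : 1 ≤ conf A δ t := by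
  rw [conf_eq hN hδ ht]
  have h1 := log_twelve_bounds.1
  have h2 : 0 ≤ Real.log t := Real.log_natCast_nonneg t
  have h3 := log_card_gt hN
  have h4 := Real.log_neg hδ hδ1
  linarith

include hN hδ in
-- The level is at most `2.5 + ln|A| + 2 ln(t/δ)`; as `ln|A| > 0.69` and `ln(t/δ) ≥ 1`, each summand
-- is a multiple of the product, and the multiples add up to less than 8.
lemma conf_le {t : ℕ} (ht : Real.exp 1 ≤ t / δ) (hδ1 : δ < 1) :
    conf A δ t ≤ 8 * (Real.log A.card * Real.log (t / δ)) := by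
  have htp := pos_of_exp_le ht
  have ht' : (t : ℝ) ≠ 0 := by positivity
  have hL := one_le_log ht
  have hA := log_card_gt hN
  have h4 := Real.log_neg hδ hδ1
  have h1 := log_twelve_bounds.2
  rw [conf_eq hN hδ htp]
  rw [Real.log_div ht' hδ.ne'] at hL ⊢
  nlinarith

include hN hδ hδ1 in
-- The level is `2 ln(k t)` with `k = √(12 |A| / δ) ≥ 3 > e`, and `ln y / y` decreases beyond `e`.
-- No burn-in is needed here.
lemma conf_div_anti {s t : ℕ} (hs : 0 < s) (hst : s ≤ t) :
    conf A δ t / t ≤ conf A δ s / s := by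
  have hN' : (2 : ℝ) ≤ A.card := by exact_mod_cast hN
  set k : ℝ := √(12 * A.card / δ) with hk
  have hk3 : 3 ≤ k := by
    refine Real.le_sqrt_of_sq_le ?_
    rw [le_div_iff₀ hδ]
    nlinarith
  have hk0 : 0 < k := by linarith
  have hconf : ∀ r : ℕ, 0 < r → conf A δ r / r = 2 * k * (Real.log (k * r) / (k * r)) := by
    intro r hr
    have hr' : (0 : ℝ) < r := Nat.cast_pos.2 hr
    have : conf A δ r = Real.log ((k * r) ^ 2) := by
      rw [conf, mul_pow, hk, Real.sq_sqrt (by positivity)]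
      congr 1
      field_simp
    rw [this, Real.log_pow]
    push_cast
    field_simp
  rw [hconf s hs, hconf t (hs.trans_le hst)]
  have hs1 : (1 : ℝ) ≤ s := by exact_mod_cast hs
  have hst' : (s : ℝ) ≤ t := by exact_mod_cast hst
  have he := Real.exp_one_lt_d9
  refine mul_le_mul_of_nonneg_left (Real.log_div_self_antitoneOn ?_ ?_ ?_) (by positivity)
  · simp only [Set.mem_Ici]
    nlinarith
  · simp only [Set.mem_Ici]
    nlinarith
  · gcongr

include hN hδ hδ1 in
lemma width_anti (hρ : 0 < ρ) {s t : ℕ} (hs : 0 < s) (hst : s ≤ t) :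
    width A ρ δ t ≤ width A ρ δ s := by
  rw [width_eq, width_eq]
  refine Real.sqrt_le_sqrt ?_
  have e : ∀ r : ℕ, conf A δ r / (ρ * d * r) = conf A δ r / r / (ρ * d) := fun r => by
    rw [div_div, mul_comm (r : ℝ)]
  rw [e, e]
  exact div_le_div_of_nonneg_right (conf_div_anti hN hδ hδ1 hs hst) (by positivity)

/-- Here `ln y / y` is taken at `y = t / δ`, which may lie below `e` in the first rounds; this is
the origin of the burn-in condition. -/
lemma log_div_anti (hδ : 0 < δ) {s t : ℕ} (hs : Real.exp 1 ≤ s / δ) (hst : s ≤ t) :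
    Real.log (t / δ) / t ≤ Real.log (s / δ) / s := by
  have hst' : (s : ℝ) / δ ≤ t / δ := by gcongr
  have h := Real.log_div_self_antitoneOn (a := s / δ) (b := t / δ) hs (hs.trans hst') hst'
  simp only at h
  have hsp : (0 : ℝ) < s := Nat.cast_pos.2 (pos_of_exp_le hs)
  have htp : (0 : ℝ) < t := Nat.cast_pos.2 (pos_of_exp_le (hs.trans hst'))
  have e : ∀ r : ℝ, 0 < r → Real.log (r / δ) / r = Real.log (r / δ) / (r / δ) / δ := fun r hr => by
    field_simp
  rw [e _ hsp, e _ htp]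
  gcongr

lemma ratio_pos_of_one_lt (hd : 0 < d) (hN : 2 ≤ A.card) (hρ : 0 < ρ) {t : ℕ}
    (ht0 : 0 < t) (ht : 1 < t / δ) : 0 < ratio A ρ δ t := by
  have h3 : (0 : ℝ) < t := Nat.cast_pos.2 ht0
  have h4 : (0 : ℝ) < d := Nat.cast_pos.2 hd
  have h5 : 0 < Real.log A.card := by linarith [log_card_gt hN]
  have h6 : 0 < Real.log (t / δ) := Real.log_pos ht
  unfold ratio
  positivity

lemma ratio_pos (hd : 0 < d) (hN : 2 ≤ A.card) (hρ : 0 < ρ) {t : ℕ} (ht : Real.exp 1 ≤ t / δ) :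
    0 < ratio A ρ δ t :=
  ratio_pos_of_one_lt hd hN hρ (pos_of_exp_le ht)
    ((Real.one_lt_exp_iff.2 zero_lt_one).trans_le ht)

lemma ratio_anti (hρ : 0 < ρ) (hδ : 0 < δ) {s t : ℕ} (hs : Real.exp 1 ≤ s / δ) (hst : s ≤ t) :
    ratio A ρ δ t ≤ ratio A ρ δ s := by
  refine Real.sqrt_le_sqrt ?_
  have e : ∀ r : ℕ, (d : ℝ) * Real.log A.card * Real.log (r / δ) / (ρ * r)
      = d * Real.log A.card / ρ * (Real.log (r / δ) / r) := fun r => by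
    rw [div_mul_div_comm]
  rw [e, e]
  have : 0 ≤ Real.log A.card := Real.log_natCast_nonneg _
  exact mul_le_mul_of_nonneg_left (log_div_anti hδ hs hst) (by positivity)

lemma lead_mono (hρ : 0 < ρ) (hδ : 0 < δ) (hδ1 : δ < 1) {s t : ℕ} (hs : 0 < s) (hst : s ≤ t) :
    lead A ρ δ s ≤ lead A ρ δ t := by
  have hA : 0 ≤ Real.log A.card := Real.log_natCast_nonneg _
  have hs' : (1 : ℝ) ≤ s := by exact_mod_cast hs
  have hst' : (s : ℝ) ≤ t := by exact_mod_cast hst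
  have hlog : 0 ≤ Real.log (s / δ) := Real.log_nonneg <| by
    rw [le_div_iff₀ hδ]
    linarith
  unfold lead
  gcongr

include hN hδ hδ1 hρ hd in
/-- The width of the confidence interval is comparable to the mixing coefficient. -/
lemma mul_width_le {t : ℕ} (ht : Real.exp 1 ≤ t / δ) :
    d * width A ρ δ t ≤ 3 * ratio A ρ δ t := by
  have htp : (0 : ℝ) < t := Nat.cast_pos.2 (pos_of_exp_le ht)
  have hd' : (0 : ℝ) < d := Nat.cast_pos.2 hd
  have hA : 0 < Real.log A.card := by linarith [log_card_gt hN]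
  have hL : 0 < Real.log (t / δ) := by linarith [one_le_log ht]
  rw [width_eq, ratio, mul_sqrt_eq hd'.le, mul_sqrt_eq zero_le_three]
  refine Real.sqrt_le_sqrt ?_
  have h := conf_le hN hδ ht hδ1
  have h9 : conf A δ t ≤ 9 * (Real.log A.card * Real.log (t / δ)) := by
    nlinarith [mul_pos hA hL]
  calc (d : ℝ) ^ 2 * (conf A δ t / (ρ * d * t)) = d / (ρ * t) * conf A δ t := by field_simp
    _ ≤ d / (ρ * t) * (9 * (Real.log A.card * Real.log (t / δ))) := by gcongr
    _ = 3 ^ 2 * (d * Real.log A.card * Real.log (t / δ) / (ρ * t)) := by ring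

include hN hδ hδ1 hρ hd in
lemma conf_eq_mul_width_sq {t : ℕ} (ht : 0 < t) :
    conf A δ t = ρ * d * t * width A ρ δ t ^ 2 := by
  have hc := one_le_conf hN hδ hδ1 ht
  have ht' : (0 : ℝ) < t := Nat.cast_pos.2 ht
  have hd' : (0 : ℝ) < d := Nat.cast_pos.2 hd
  rw [width_eq, Real.sq_sqrt (by positivity)]
  field_simp

include hN hδ hδ1 hρ hd in
lemma width_pos {t : ℕ} (ht : 0 < t) : 0 < width A ρ δ t := by
  have hc := one_le_conf hN hδ hδ1 ht
  have ht' : (0 : ℝ) < t := Nat.cast_pos.2 ht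
  have hd' : (0 : ℝ) < d := Nat.cast_pos.2 hd
  rw [width_eq]
  positivity

lemma gam_pos (hd : 0 < d) (hN : 2 ≤ A.card) (hρ : 0 < ρ) {t : ℕ} (ht : Real.exp 1 ≤ t / δ) : 0 < gam A ρ δ t :=
  lt_min (ratio_pos hd hN hρ ht) (by norm_num)

lemma gam_le_half (t : ℕ) : gam A ρ δ t ≤ 1 / 2 := min_le_right _ _

lemma gam_nonneg (t : ℕ) : 0 ≤ gam A ρ δ t := le_min (Real.sqrt_nonneg _) (by norm_num)

/-- The second summand of the denominator of `η` is just `ρ` times the unclipped mixing coefficient,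
so all tuning reduces to `ratio`. -/
lemma eta_eq (hρ : 0 < ρ) {t : ℕ} (ht : 0 < t) (c : ℝ) :
    eta A c ρ δ t = c * (ρ * gam A ρ δ t / (d + ρ * ratio A ρ δ t)) := by
  have ht' : (0 : ℝ) < t := Nat.cast_pos.2 ht
  rw [eta, ratio, ← Real.sqrt_mul (by positivity), mul_sqrt_eq hρ.le]
  congr 4
  field_simp

include hd hN hρ in
lemma eta_pos {c : ℝ} (hc : 0 < c) {t : ℕ} (ht : Real.exp 1 ≤ t / δ) : 0 < eta A c ρ δ t := by
  rw [eta_eq hρ (pos_of_exp_le ht)]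
  have := gam_pos hd hN hρ ht
  have := ratio_pos hd hN hρ ht
  have hd' : (0 : ℝ) < d := Nat.cast_pos.2 hd
  positivity

include hd hN hρ hδ hδ1 in
/-- The learning rate is small compared to the range of the reward upper bounds. -/
lemma eta_mul_le {c : ℝ} (hc : 0 < c) (hc1 : c ≤ 1 / 7) {t : ℕ} (ht : Real.exp 1 ≤ t / δ) :
    eta A c ρ δ t * (d / gam A ρ δ t / ρ + 2 * (d / gam A ρ δ t) * width A ρ δ t) ≤ 1 := by
  have hg := gam_pos hd hN hρ ht
  have hr := ratio_pos hd hN hρ ht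
  have hd' : (0 : ℝ) < d := Nat.cast_pos.2 hd
  have hw := mul_width_le hd hN hρ hδ hδ1 ht
  rw [eta_eq hρ (pos_of_exp_le ht)]
  set g := gam A ρ δ t
  set x := ratio A ρ δ t
  have e : c * (ρ * g / (d + ρ * x)) * (d / g / ρ + 2 * (d / g) * width A ρ δ t)
      = c * ((d + 2 * ρ * (d * width A ρ δ t)) / (d + ρ * x)) := by
    field_simp
  -- Inserting `d * width ≤ 3 * ratio` bounds the quotient by 6; this is what limits `c`, with a
  -- little room, to `1 / 7`.
  have h1 : (d + 2 * ρ * (d * width A ρ δ t)) / (d + ρ * x) ≤ 6 := by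
    rw [div_le_iff₀ (by positivity)]
    nlinarith [mul_le_mul_of_nonneg_left hw hρ.le]
  rw [e]
  nlinarith

include hd hN hρ hδ in
-- Without clipping, `η` is an increasing function of `ratio`, which decreases. Under clipping the
-- numerator is constant while the denominator decreases, so `hx` is essential.
lemma eta_anti {c : ℝ} (hc : 0 < c) {s t : ℕ} (hs : Real.exp 1 ≤ s / δ) (hst : s ≤ t)
    (hx : ratio A ρ δ s ≤ 1 / 2) : eta A c ρ δ t ≤ eta A c ρ δ s := by
  have hst' : (s : ℝ) / δ ≤ t / δ := by gcongr
  have ht := hs.trans hst'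
  have hd' : (0 : ℝ) < d := Nat.cast_pos.2 hd
  have hr := ratio_pos hd hN hρ ht
  have hr' := ratio_pos hd hN hρ hs
  have hle := ratio_anti (A := A) hρ hδ hs hst
  rw [eta_eq hρ (pos_of_exp_le ht), eta_eq hρ (pos_of_exp_le hs), gam_eq, gam_eq,
    min_eq_left hx, min_eq_left (hle.trans hx)]
  refine mul_le_mul_of_nonneg_left ?_ hc.le
  rw [div_le_div_iff₀ (by positivity) (by positivity)]
  nlinarith [mul_le_mul_of_nonneg_left hle (mul_pos hρ hd').le]

include hd hN hρ in
lemma eta_mul_dim_le {c : ℝ} (hc : 0 < c) (hc1 : c ≤ 1) {t : ℕ} (ht : Real.exp 1 ≤ t / δ) :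
    eta A c ρ δ t * (d / ρ) ≤ ratio A ρ δ t := by
  have hg := gam_pos hd hN hρ ht
  have hr := ratio_pos hd hN hρ ht
  have hd' : (0 : ℝ) < d := Nat.cast_pos.2 hd
  have hgr : gam A ρ δ t ≤ ratio A ρ δ t := min_le_left _ _
  rw [eta_eq hρ (pos_of_exp_le ht)]
  set g := gam A ρ δ t
  set x := ratio A ρ δ t
  have e : c * (ρ * g / (d + ρ * x)) * (d / ρ) = c * g * (d / (d + ρ * x)) := by field_simp
  have h1 : d / (d + ρ * x) ≤ 1 := by
    rw [div_le_one (by positivity)]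
    have := mul_pos hρ hr
    linarith
  rw [e]
  calc c * g * (d / (d + ρ * x)) ≤ c * g * 1 := by gcongr
    _ ≤ 1 * x * 1 := by gcongr
    _ = x := by ring

include hd hN hρ in
-- As `ρ x ≤ d`, the quotient is at most `2 d ln|A| / (c ρ x)` with `x = ratio`, and `x² ρ t = d
-- ln|A| ln(t/δ) ≥ d ln|A|` turns this into a multiple of `t x`.
lemma log_card_div_eta_le (hρ1 : ρ ≤ 1) {c : ℝ} (hc : 0 < c) {t : ℕ} (ht : Real.exp 1 ≤ t / δ)
    (hx : ratio A ρ δ t ≤ 1 / 2) :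
    Real.log A.card / eta A c ρ δ t ≤ 2 / c * lead A ρ δ t := by
  have htp := pos_of_exp_le ht
  have ht' : (0 : ℝ) < t := Nat.cast_pos.2 htp
  have hr := ratio_pos hd hN hρ ht
  have hd' : (1 : ℝ) ≤ d := by exact_mod_cast hd
  have hA : 0 < Real.log A.card := by linarith [log_card_gt hN]
  have hL := one_le_log ht
  rw [eta_eq hρ htp, gam_eq, min_eq_left hx, lead_eq hρ htp]
  have hsq : ratio A ρ δ t ^ 2 * (ρ * t) = d * Real.log A.card * Real.log (t / δ) := by
    rw [ratio, Real.sq_sqrt (by positivity)]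
    field_simp
  set x := ratio A ρ δ t
  have h1 : d * Real.log A.card ≤ x ^ 2 * (ρ * t) := by
    rw [hsq]
    have := mul_pos (zero_lt_one.trans_le hd') hA
    nlinarith
  rw [div_le_iff₀ (by positivity)]
  have e : 2 / c * (t * x) * (c * (ρ * x / (d + ρ * x))) = 2 * (x ^ 2 * (ρ * t)) / (d + ρ * x) := by
    field_simp
  rw [e, le_div_iff₀ (by positivity)]
  have h2 : ρ * x ≤ d := by nlinarith
  nlinarith [mul_le_mul_of_nonneg_left h2 hA.le]

include hd hN hρ hδ hδ1 in
lemma conf_div_le {t : ℕ} (ht : Real.exp 1 ≤ t / δ) (hx : ratio A ρ δ t ≤ 1 / 2) :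
    conf A δ t / ρ ≤ 4 * lead A ρ δ t := by
  have htp := pos_of_exp_le ht
  have ht' : (0 : ℝ) < t := Nat.cast_pos.2 htp
  have hr := ratio_pos hd hN hρ ht
  have hd' : (1 : ℝ) ≤ d := by exact_mod_cast hd
  have hA : 0 < Real.log A.card := by linarith [log_card_gt hN]
  have hL := one_le_log ht
  have hL0 : 0 < Real.log (t / δ) := by linarith
  have hc := conf_le hN hδ ht hδ1
  have hsq : ratio A ρ δ t ^ 2 * (ρ * t) = d * Real.log A.card * Real.log (t / δ) := by
    rw [ratio, Real.sq_sqrt (by positivity)]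
    field_simp
  rw [lead_eq hρ htp, div_le_iff₀ hρ]
  set x := ratio A ρ δ t
  have h1 : Real.log A.card * Real.log (t / δ) ≤ x ^ 2 * (ρ * t) := by
    rw [hsq, mul_assoc]
    have := mul_pos hA hL0
    nlinarith
  have h2 : x ^ 2 * (ρ * t) ≤ 1 / 2 * x * (ρ * t) := by
    rw [pow_two]
    gcongr
  linarith

lemma sum_inv_sqrt_le (s n : ℕ) : ∑ l ∈ Finset.Ioc s n, 1 / √(l : ℝ) ≤ 2 * √(n : ℝ) := by
  rcases lt_or_ge n s with hn | hn
  · rw [Finset.Ioc_eq_empty_of_le hn.le, Finset.sum_empty]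
    positivity
  induction n, hn using Nat.le_induction with
  | base => simp
  | succ n hn ih =>
    rw [Finset.sum_Ioc_succ_top (by omega)]
    have h1 : (√((n : ℝ) + 1)) ^ 2 = n + 1 := Real.sq_sqrt (by positivity)
    have h2 : (√(n : ℝ)) ^ 2 = n := Real.sq_sqrt (by positivity)
    have h3 : √(n : ℝ) ≤ √((n : ℝ) + 1) := Real.sqrt_le_sqrt (by linarith)
    have h4 : 0 < √((n : ℝ) + 1) := Real.sqrt_pos.2 (by positivity)
    have h5 : 1 / √((n : ℝ) + 1) ≤ 2 * √((n : ℝ) + 1) - 2 * √(n : ℝ) := by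
      rw [div_le_iff₀ h4]
      nlinarith [sq_nonneg (√((n : ℝ) + 1) - √(n : ℝ))]
    push_cast
    linarith

/-- Raising the logarithm to round `t` leaves only the factor `1 / √l`, whose sum is at most `2 √t`.
-/
lemma ratio_le_lead_div {l t : ℕ} (hρ : 0 < ρ) (hδ : 0 < δ) (hl : 0 < l) (hlt : l ≤ t) :
    ratio A ρ δ l ≤ lead A ρ δ t / √t * (1 / √l) := by
  have hl' : (0 : ℝ) < l := Nat.cast_pos.2 hl
  have ht' : (0 : ℝ) < t := Nat.cast_pos.2 (hl.trans_le hlt)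
  have hA : 0 ≤ Real.log A.card := Real.log_natCast_nonneg _
  have hlt' : (l : ℝ) ≤ t := by exact_mod_cast hlt
  rw [ratio, lead, ← Real.sqrt_div' _ ht'.le, ← Real.sqrt_one, ← Real.sqrt_div' _ hl'.le,
    ← Real.sqrt_mul' _ (by positivity)]
  refine Real.sqrt_le_sqrt ?_
  have e : (d : ℝ) * t * Real.log A.card / ρ * Real.log (t / δ) / t * (1 / l)
      = d * Real.log A.card * Real.log (t / δ) / (ρ * l) := by
    field_simp
  rw [e]
  gcongr

lemma sum_ratio_le (hρ : 0 < ρ) (hδ : 0 < δ) (s t : ℕ) :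
    ∑ l ∈ Finset.Ioc s t, ratio A ρ δ l ≤ 2 * lead A ρ δ t := by
  rcases Nat.eq_zero_or_pos t with rfl | ht
  · rw [Finset.Ioc_eq_empty_of_le (Nat.zero_le s), Finset.sum_empty]
    linarith [lead_nonneg (A := A) (ρ := ρ) (δ := δ) 0]
  have ht' : 0 < √(t : ℝ) := Real.sqrt_pos.2 (Nat.cast_pos.2 ht)
  calc ∑ l ∈ Finset.Ioc s t, ratio A ρ δ l
      ≤ ∑ l ∈ Finset.Ioc s t, lead A ρ δ t / √t * (1 / √l) :=
        Finset.sum_le_sum fun l hl => by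
          rw [Finset.mem_Ioc] at hl
          exact ratio_le_lead_div hρ hδ (by omega) hl.2
    _ = lead A ρ δ t / √t * ∑ l ∈ Finset.Ioc s t, 1 / √(l : ℝ) := by rw [Finset.mul_sum]
    _ ≤ lead A ρ δ t / √t * (2 * √t) :=
        mul_le_mul_of_nonneg_left (sum_inv_sqrt_le s t) (div_nonneg (lead_nonneg _) ht'.le)
    _ = 2 * lead A ρ δ t := by field_simp

end Scalars

/-! ### Estimates within one round -/

section Round

variable {d : ℕ} {A : Finset (Fin d → ℝ)}

/-- `p` mixes the distribution `q` with the exploration distribution `pE`. -/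
structure IsMixture (pE p q : A → ℝ) (γ : ℝ) : Prop where
  span : Submodule.span ℝ (A : Set (Fin d → ℝ)) = ⊤
  pE_nonneg : ∀ x, 0 ≤ pE x
  pE_sum : ∑ x, pE x = 1
  pE_spreads : Spreads pE d
  q_nonneg : ∀ x, 0 ≤ q x
  q_sum : ∑ x, q x = 1
  γ_pos : 0 < γ
  γ_le : γ ≤ 1 / 2
  eq : ∀ x, p x = (1 - γ) * q x + γ * pE x

namespace IsMixture

variable {pE p q : A → ℝ} {γ : ℝ} (h : IsMixture pE p q γ)
include h

lemma nonneg (x : A) : 0 ≤ p x := by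
  rw [h.eq]
  have h1 := h.γ_le
  exact add_nonneg (mul_nonneg (by linarith) (h.q_nonneg x)) (mul_nonneg h.γ_pos.le (h.pE_nonneg x))

lemma sum_eq_one : ∑ x, p x = 1 := by
  simp only [h.eq, Finset.sum_add_distrib, ← Finset.mul_sum, h.q_sum, h.pE_sum]
  ring

lemma mul_le (x : A) : γ * pE x ≤ p x := by
  rw [h.eq]
  have := mul_nonneg (show 0 ≤ 1 - γ by linarith [h.γ_le]) (h.q_nonneg x)
  linarith

lemma q_le (x : A) : q x ≤ 2 * p x := by
  rw [h.eq]
  have h1 := mul_nonneg h.γ_pos.le (h.pE_nonneg x)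
  nlinarith [h.q_nonneg x, h.γ_le]

lemma spreads : Spreads p (d / γ) := by
  intro x hx z
  refine (h.pE_spreads x hx z).trans ?_
  rw [div_mul_eq_mul_div, le_div_iff₀ h.γ_pos, mul_assoc, Finset.sum_mul]
  refine mul_le_mul_of_nonneg_left (Finset.sum_le_sum fun b _ => ?_) (Nat.cast_nonneg d)
  nlinarith [h.mul_le b, sq_nonneg ((b : Fin d → ℝ) ⬝ᵥ z)]

lemma posDef : (cov p).PosDef := cov_posDef h.nonneg h.spreads h.span

lemma kappa_nonneg : 0 ≤ (d : ℝ) / γ := div_nonneg (Nat.cast_nonneg d) h.γ_pos.le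

lemma abs_invForm_le {x y : Fin d → ℝ} (hx : x ∈ A) (hy : y ∈ A) : |invForm p x y| ≤ d / γ :=
  GeoHedge.abs_invForm_le h.posDef h.spreads h.kappa_nonneg hx hy

lemma invForm_self_le {x : Fin d → ℝ} (hx : x ∈ A) : invForm p x x ≤ d / γ :=
  GeoHedge.invForm_self_le h.posDef h.spreads h.kappa_nonneg hx

lemma invForm_self_nonneg (x : Fin d → ℝ) : 0 ≤ invForm p x x :=
  GeoHedge.invForm_self_nonneg h.posDef h.nonneg x

lemma abs_invForm_mean_le {y : Fin d → ℝ} (hy : y ∈ A) :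
    |invForm p (∑ x : A, q x • (x : Fin d → ℝ)) y| ≤ d / γ := by
  rw [invForm_sum_left]
  calc |∑ x : A, q x * invForm p x y| ≤ ∑ x : A, |q x * invForm p x y| :=
        Finset.abs_sum_le_sum_abs _ _
    _ ≤ ∑ x : A, q x * (d / γ) := Finset.sum_le_sum fun x _ => by
        rw [abs_mul, abs_of_nonneg (h.q_nonneg x)]
        exact mul_le_mul_of_nonneg_left (h.abs_invForm_le x.2 hy) (h.q_nonneg x)
    _ = d / γ := by rw [← Finset.sum_mul, h.q_sum, one_mul]

lemma sum_q_mul_invForm_self_le : ∑ x : A, q x * invForm p x x ≤ 2 * d := by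
  rw [← sum_mul_invForm_self h.posDef, Finset.mul_sum]
  refine Finset.sum_le_sum fun x _ => ?_
  rw [← mul_assoc]
  exact mul_le_mul_of_nonneg_right (h.q_le x) (h.invForm_self_nonneg x)

lemma sum_q_mul_invForm_sq_le (y : Fin d → ℝ) :
    ∑ x : A, q x * invForm p x y ^ 2 ≤ 2 * invForm p y y := by
  rw [← sum_mul_invForm_sq h.posDef, Finset.mul_sum]
  refine Finset.sum_le_sum fun x _ => ?_
  rw [← mul_assoc, invForm_comm]
  exact mul_le_mul_of_nonneg_right (h.q_le x) (sq_nonneg _)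

/-- The increment of the exponential weights bound in one round. -/
lemma sum_q_mul_rewardUpper_le {η β o : ℝ} (act : A) (hη : 0 ≤ η) (hβ : 0 ≤ β)
    (hηβ : η * (2 * (d / γ) * β) ≤ 1) :
    ∑ x : A, q x * (o * invForm p x act + 2 * invForm p x x * β)
      + η * ∑ x : A, q x * (o * invForm p x act + 2 * invForm p x x * β) ^ 2
    ≤ o * invForm p (∑ x : A, q x • (x : Fin d → ℝ)) act + 12 * (d * β)
      + 4 * (η * (o ^ 2 * invForm p act act)) := by
  have h1 : ∑ x : A, q x * (o * invForm p x act + 2 * invForm p x x * β)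
      = o * invForm p (∑ x : A, q x • (x : Fin d → ℝ)) act
        + 2 * β * ∑ x : A, q x * invForm p x x := by
    rw [invForm_sum_left, Finset.mul_sum, Finset.mul_sum, ← Finset.sum_add_distrib]
    exact Finset.sum_congr rfl fun x _ => by ring
  have h2 : η * ∑ x : A, q x * (o * invForm p x act + 2 * invForm p x x * β) ^ 2
      ≤ 2 * (η * o ^ 2) * ∑ x : A, q x * invForm p x act ^ 2
        + 4 * β * ∑ x : A, q x * invForm p x x := by
    rw [Finset.mul_sum, Finset.mul_sum, Finset.mul_sum, ← Finset.sum_add_distrib]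
    refine Finset.sum_le_sum fun x _ => ?_
    set u := invForm p x act
    have hv0 := h.invForm_self_nonneg (x : Fin d → ℝ)
    have hv1 := h.invForm_self_le x.2
    set v := invForm p x x
    have hq := h.q_nonneg x
    have h3 : η * (2 * v * β) ≤ 1 := by
      refine le_trans ?_ hηβ
      gcongr
    -- The squared bonus is absorbed into the bonus itself, so it costs only another multiple of `d
    -- β` on average.
    have h4 : η * (2 * v * β) ^ 2 ≤ 2 * v * β := by
      have : 0 ≤ 2 * v * β := by positivity
      nlinarith
    have h5 : (o * u + 2 * v * β) ^ 2 ≤ 2 * (o ^ 2 * u ^ 2) + 2 * (2 * v * β) ^ 2 := by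
      nlinarith [sq_nonneg (o * u - 2 * v * β)]
    calc η * (q x * (o * u + 2 * v * β) ^ 2)
        ≤ η * (q x * (2 * (o ^ 2 * u ^ 2) + 2 * (2 * v * β) ^ 2)) := by gcongr
      _ = q x * (2 * (η * o ^ 2) * u ^ 2 + 2 * (η * (2 * v * β) ^ 2)) := by ring
      _ ≤ q x * (2 * (η * o ^ 2) * u ^ 2 + 2 * (2 * v * β)) := by gcongr
      _ = 2 * (η * o ^ 2) * (q x * u ^ 2) + 4 * β * (q x * v) := by ring
  have h6 := mul_le_mul_of_nonneg_left h.sum_q_mul_invForm_self_le hβ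
  have h7 := mul_le_mul_of_nonneg_left (h.sum_q_mul_invForm_sq_le act)
    (mul_nonneg hη (sq_nonneg o))
  rw [h1]
  linarith

lemma abs_rewardUpper_le {β o ρ : ℝ} (x act : A) (hβ : 0 ≤ β)
    (hρ : 0 < ρ) (ho : |o| ≤ 1 / ρ) :
    |o * invForm p x act + 2 * invForm p x x * β| ≤ d / γ / ρ + 2 * (d / γ) * β := by
  have hv0 := h.invForm_self_nonneg (x : Fin d → ℝ)
  refine (abs_add_le _ _).trans (add_le_add ?_ ?_)
  · rw [abs_mul]
    calc |o| * |invForm p x act| ≤ 1 / ρ * (d / γ) :=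
          mul_le_mul ho (h.abs_invForm_le x.2 act.2) (abs_nonneg _) (by positivity)
      _ = d / γ / ρ := by ring
  · rw [abs_of_nonneg (by positivity)]
    have := h.invForm_self_le x.2
    gcongr

lemma abs_eta_mul_rewardUpper_le {η β o ρ : ℝ} (x act : A) (hη : 0 ≤ η) (hβ : 0 ≤ β)
    (hρ : 0 < ρ) (ho : |o| ≤ 1 / ρ) (hηβ : η * (d / γ / ρ + 2 * (d / γ) * β) ≤ 1) :
    |η * (o * invForm p x act + 2 * invForm p x x * β)| ≤ 1 := by
  rw [abs_mul, abs_of_nonneg hη]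
  exact le_trans (mul_le_mul_of_nonneg_left (h.abs_rewardUpper_le x act hβ hρ ho) hη) hηβ

/-- Exploration replaces a `γ` fraction of one mean in `[-1, 1]` by another. -/
lemma sum_q_mul_reward_le {θ : Fin d → ℝ} (hθ : ∀ x ∈ A, |x ⬝ᵥ θ| ≤ 1) :
    ∑ x : A, q x * ((x : Fin d → ℝ) ⬝ᵥ θ) ≤ ∑ x : A, p x * ((x : Fin d → ℝ) ⬝ᵥ θ) + 2 * γ := by
  have habs : ∀ r : A → ℝ, (∀ x, 0 ≤ r x) → ∑ x, r x = 1 →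
      |∑ x : A, r x * ((x : Fin d → ℝ) ⬝ᵥ θ)| ≤ 1 := fun r hr0 hr1 => by
    calc |∑ x : A, r x * ((x : Fin d → ℝ) ⬝ᵥ θ)| ≤ ∑ x : A, |r x * ((x : Fin d → ℝ) ⬝ᵥ θ)| :=
          Finset.abs_sum_le_sum_abs _ _
      _ ≤ ∑ x : A, r x := Finset.sum_le_sum fun x _ => by
          rw [abs_mul, abs_of_nonneg (hr0 x)]
          exact mul_le_of_le_one_right (hr0 x) (hθ x x.2)
      _ = 1 := hr1
  have e : ∑ x : A, p x * ((x : Fin d → ℝ) ⬝ᵥ θ)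
      = (1 - γ) * ∑ x : A, q x * ((x : Fin d → ℝ) ⬝ᵥ θ)
        + γ * ∑ x : A, pE x * ((x : Fin d → ℝ) ⬝ᵥ θ) := by
    rw [Finset.mul_sum, Finset.mul_sum, ← Finset.sum_add_distrib]
    exact Finset.sum_congr rfl fun x _ => by rw [h.eq]; ring
  have h1 := (abs_le.1 (habs q h.q_nonneg h.q_sum)).2
  have h2 := (abs_le.1 (habs pE h.pE_nonneg h.pE_sum)).1
  rw [e]
  nlinarith [h.γ_pos]

lemma abs_mean_dotProduct_le {θ : Fin d → ℝ} (hθ : ∀ x ∈ A, |x ⬝ᵥ θ| ≤ 1) :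
    |(∑ x : A, q x • (x : Fin d → ℝ)) ⬝ᵥ θ| ≤ 1 := by
  rw [sum_dotProduct]
  calc |∑ x : A, (q x • (x : Fin d → ℝ)) ⬝ᵥ θ| ≤ ∑ x : A, |(q x • (x : Fin d → ℝ)) ⬝ᵥ θ| :=
        Finset.abs_sum_le_sum_abs _ _
    _ ≤ ∑ x : A, q x := Finset.sum_le_sum fun x _ => by
        rw [smul_dotProduct, smul_eq_mul, abs_mul, abs_of_nonneg (h.q_nonneg x)]
        exact mul_le_of_le_one_right (h.q_nonneg x) (hθ x x.2)
    _ = 1 := h.q_sum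

end IsMixture

/-- Division by the scale turns a supermartingale bound into deviation plus scaled variance. -/
lemma sum_le_of_sum_mul_sub_le {I : Finset ℕ} {X V : ℕ → ℝ} {lam D : ℝ} (hlam : 0 < lam)
    (h : ∑ l ∈ I, (lam * X l - lam ^ 2 * V l) ≤ lam * D) :
    ∑ l ∈ I, X l ≤ D + ∑ l ∈ I, lam * V l := by
  refine le_of_mul_le_mul_left ?_ hlam
  rw [Finset.sum_sub_distrib, ← Finset.mul_sum, ← Finset.mul_sum] at h
  rw [← Finset.mul_sum]
  linarith

end Round

/-! ### Regret on the good event -/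

section Deterministic

variable {d : ℕ} {A : Finset (Fin d → ℝ)} {Ω : Type*} {pE : A → ℝ} {c ρ δ : ℝ}
  {θ : ℕ → Ω → Fin d → ℝ} {a : ℕ → Ω → A} {b : ℕ → Ω → Bool}

lemma isMixture_policyProc (hN : 0 < A.card)
    (hA : Submodule.span ℝ (A : Set (Fin d → ℝ)) = ⊤) (hE : IsJohnExploration A pE)
    {l : ℕ} (hl : 0 < gam A ρ δ l) (w : Ω) :
    IsMixture pE (policyProc pE c ρ δ θ a b l w) (hedgeProc pE c ρ δ θ a b l w) (gam A ρ δ l) := by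
  have hne : Nonempty A := by
    obtain ⟨x, hx⟩ := Finset.card_pos.1 hN
    exact ⟨⟨x, hx⟩⟩
  have hs := hE.spreads
  obtain ⟨Q, hQ, h0, h1, -, -, hdec⟩ := hE
  exact ⟨hA, h0, h1, hs, softmax_nonneg _ _, sum_softmax _ _, hl,
    gam_le_half l, fun x => rfl⟩

lemma cumProc_eq_add_sum {s t : ℕ} (hst : s ≤ t) (w : Ω) (x : A) :
    cumProc pE c ρ δ θ a b t w x = cumProc pE c ρ δ θ a b s w x + ∑ l ∈ Finset.Ioc s t,
      (obs ρ θ a b l w * invForm (policyProc pE c ρ δ θ a b l w) x (a l w)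
        + 2 * invForm (policyProc pE c ρ δ θ a b l w) x x * width A ρ δ l) := by
  induction t, hst using Nat.le_induction with
  | base => simp
  | succ t ht ih => rw [cumProc_succ, ih, Finset.sum_Ioc_succ_top (by omega), add_assoc]

lemma abs_obs_le (hρ : 0 < ρ) {l : ℕ} {w : Ω} (hθ : ∀ x ∈ A, |x ⬝ᵥ θ l w| ≤ 1) :
    |obs ρ θ a b l w| ≤ 1 / ρ := by
  unfold obs
  split_ifs
  · rw [abs_div, abs_of_pos hρ]
    exact div_le_div_of_nonneg_right (hθ _ (a l w).2) hρ.le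
  · rw [abs_zero]
    positivity

/-- Regret bound on the event that all deviations up to round `T` are small; the mixing coefficient
is clipped up to round `t₁`, and not clipped afterwards. -/
theorem sum_regret_le_of_deviations (hd : 0 < d) (hN : 2 ≤ A.card) (hρ : 0 < ρ) (hρ1 : ρ ≤ 1)
    (hδ : 0 < δ) (hδ1 : δ < 1) (hc : 0 < c) (hc1 : c ≤ 1 / 7)
    (hA : Submodule.span ℝ (A : Set (Fin d → ℝ)) = ⊤) (hE : IsJohnExploration A pE)
    {w : Ω} (hθ : ∀ l, 1 ≤ l → ∀ x ∈ A, |x ⬝ᵥ θ l w| ≤ 1)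
    {B : ℝ} {s t₁ T : ℕ} (hs : ∀ l : ℕ, s < l → Real.exp 1 ≤ l / δ)
    (hB : ∀ x, |cumProc pE c ρ δ θ a b s w x| ≤ B)
    (hst : s ≤ t₁) (htT : t₁ < T)
    (hlow : ∀ l, s < l → l ≤ t₁ → 1 / 2 ≤ ratio A ρ δ l)
    (hhigh : ∀ l, t₁ < l → l ≤ T → ratio A ρ δ l ≤ 1 / 2)
    {lam : ℝ} (hlam : lam = ρ * width A ρ δ T / 6)
    (H1 : ∀ x : A, ∑ l ∈ Finset.Ioc s T, (lam * ((x : Fin d → ℝ) ⬝ᵥ θ l w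
      - obs ρ θ a b l w * invForm (policyProc pE c ρ δ θ a b l w) x (a l w))
      - lam ^ 2 * invForm (policyProc pE c ρ δ θ a b l w) x x / ρ) ≤ conf A δ T)
    (H2 : ∑ l ∈ Finset.Ioc t₁ T, (-lam * ((∑ x : A, hedgeProc pE c ρ δ θ a b l w x
        • (x : Fin d → ℝ)) ⬝ᵥ θ l w
      - obs ρ θ a b l w * invForm (policyProc pE c ρ δ θ a b l w)
        (∑ x : A, hedgeProc pE c ρ δ θ a b l w x • (x : Fin d → ℝ)) (a l w))
      - (-lam) ^ 2 * invForm (policyProc pE c ρ δ θ a b l w)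
        (∑ x : A, hedgeProc pE c ρ δ θ a b l w x • (x : Fin d → ℝ))
        (∑ x : A, hedgeProc pE c ρ δ θ a b l w x • (x : Fin d → ℝ)) / ρ) ≤ conf A δ T)
    (H3 : ∑ l ∈ Finset.Ioc t₁ T, (lam * (∑ x : A, policyProc pE c ρ δ θ a b l w x
        * ((x : Fin d → ℝ) ⬝ᵥ θ l w) - (a l w : Fin d → ℝ) ⬝ᵥ θ l w) - lam ^ 2) ≤ conf A δ T)
    (H4 : ∑ l ∈ Finset.Ioc t₁ T, (ρ * eta A c ρ δ l * (obs ρ θ a b l w ^ 2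
        * invForm (policyProc pE c ρ δ θ a b l w) (a l w) (a l w))
      - 2 * (ρ * eta A c ρ δ l * (d / ρ))) ≤ conf A δ T)
    (H5 : ∀ x : A, ∑ l ∈ Finset.Ioc s t₁, (-lam * ((x : Fin d → ℝ) ⬝ᵥ θ l w
      - obs ρ θ a b l w * invForm (policyProc pE c ρ δ θ a b l w) x (a l w))
      - (-lam) ^ 2 * invForm (policyProc pE c ρ δ θ a b l w) x x / ρ) ≤ conf A δ T)
    (x : A) :
    ∑ l ∈ Finset.Icc 1 T, ((x : Fin d → ℝ) ⬝ᵥ θ l w - (a l w : Fin d → ℝ) ⬝ᵥ θ l w)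
      ≤ (240 + 2 / c) * lead A ρ δ T + 2 * B + 2 * s := by
  have hne : Nonempty A := ⟨x⟩
  set P := fun l => policyProc pE c ρ δ θ a b l w with hP
  set q := fun l => hedgeProc pE c ρ δ θ a b l w with hq
  set o := fun l => obs ρ θ a b l w with ho
  set m := fun l => ∑ x : A, q l x • (x : Fin d → ℝ) with hm
  set F := lead A ρ δ T with hF
  set W := fun l => width A ρ δ l with hW
  have hT0 : 0 < T := by omega
  have hT0' : (0 : ℝ) < T := Nat.cast_pos.2 hT0
  have hsT : Real.exp 1 ≤ T / δ := hs T (by omega)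
  have hd' : (1 : ℝ) ≤ d := by exact_mod_cast hd
  have hF0 : 0 ≤ F := lead_nonneg T
  have hMix : ∀ l, s < l → IsMixture pE (P l) (q l) (gam A ρ δ l) := fun l hl =>
    isMixture_policyProc (by omega) hA hE (gam_pos hd hN hρ (hs l hl)) w
  have hWT : 0 < W T := width_pos hd hN hρ hδ hδ1 hT0
  have hW0 : ∀ l, 0 ≤ W l := fun l => width_nonneg l
  have hWanti : ∀ l, s < l → l ≤ T → W T ≤ W l := fun l hl hlT =>
    width_anti hN hδ hδ1 hρ (by omega) hlT
  have hWx : ∀ l, s < l → d * W l ≤ 3 * ratio A ρ δ l := fun l hl =>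
    mul_width_le hd hN hρ hδ hδ1 (hs l hl)
  have hFT : F = T * ratio A ρ δ T := lead_eq hρ hT0
  have hTW : T * (d * W T) ≤ 3 * F := by
    rw [hFT]
    nlinarith [hWx T (by omega)]
  have hTW1 : T * W T ≤ 3 * F := by
    refine le_trans ?_ hTW
    have : W T ≤ d * W T := le_mul_of_one_le_left hWT.le hd'
    gcongr
  have hlam0 : 0 < lam := by rw [hlam]; positivity
  -- The level equals `ρ d T W²`, and `T d W ≤ 3 F`; dividing by the scale leaves a deviation of `18
  -- F` in every use.
  have hconf : conf A δ T ≤ lam * (18 * F) := by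
    rw [conf_eq_mul_width_sq hd hN hρ hδ hδ1 hT0, hlam]
    have : ρ * d * T * width A ρ δ T ^ 2 = (ρ * W T) * (T * (d * W T)) := by
      simp only [hW]
      ring
    rw [this]
    calc ρ * W T * (T * (d * W T)) ≤ ρ * W T * (3 * F) := by gcongr
      _ = ρ * W T / 6 * (18 * F) := by ring
  have hlamρ : lam / ρ = W T / 6 := by
    rw [hlam, mul_div_assoc, mul_div_cancel_left₀ _ hρ.ne']
  have hsum_ratio : ∀ k, ∑ l ∈ Finset.Ioc k T, ratio A ρ δ l ≤ 2 * F := fun k =>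
    sum_ratio_le hρ hδ k T
  -- estimates of the comparator
  have hX1 : ∑ l ∈ Finset.Ioc s T, ((x : Fin d → ℝ) ⬝ᵥ θ l w - o l * invForm (P l) x (a l w))
      ≤ 18 * F + ∑ l ∈ Finset.Ioc s T, 2 * invForm (P l) x x * W l := by
    refine (sum_le_of_sum_mul_sub_le (V := fun l => invForm (P l) x x / ρ) hlam0
      (((Finset.sum_congr rfl fun l _ => ?_).trans_le (H1 x)).trans hconf)).trans ?_
    · rw [mul_div_assoc]
    -- The bonus pays for the variance: `lam / ρ = W T / 6`, and widths decrease, so round `l`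
    -- offers more than is needed.
    · refine add_le_add le_rfl (Finset.sum_le_sum fun l hl => ?_)
      rw [Finset.mem_Ioc] at hl
      have h1 := (hMix l hl.1).invForm_self_nonneg (x : Fin d → ℝ)
      have h2 := hWanti l hl.1 hl.2
      calc lam * (invForm (P l) x x / ρ) = lam / ρ * invForm (P l) x x := by ring
        _ ≤ 2 * W l * invForm (P l) x x := by
            rw [hlamρ]
            gcongr
            linarith
        _ = 2 * invForm (P l) x x * W l := by ring
  have hA1 : ∑ l ∈ Finset.Ioc s T, (x : Fin d → ℝ) ⬝ᵥ θ l w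
      ≤ cumProc pE c ρ δ θ a b T w x + B + 18 * F := by
    rw [cumProc_eq_add_sum (by omega : s ≤ T)]
    rw [Finset.sum_sub_distrib] at hX1
    rw [Finset.sum_add_distrib]
    have := (abs_le.1 (hB x)).1
    linarith
  have ht1F : (t₁ : ℝ) - s ≤ 2 * F := by
    rcases hst.eq_or_lt with rfl | h
    · simpa using hF0
    · have h1 := hlow t₁ h le_rfl
      have h2 := lead_eq (A := A) (δ := δ) hρ (show 0 < t₁ by omega)
      have h3 := lead_mono (A := A) hρ hδ hδ1 (show 0 < t₁ by omega) htT.le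
      have h4 : (0 : ℝ) ≤ t₁ := Nat.cast_nonneg _
      have h5 : (0 : ℝ) ≤ s := Nat.cast_nonneg _
      nlinarith
  have hcard : ∑ _l ∈ Finset.Ioc s t₁, (1 : ℝ) ≤ 2 * F := by
    rw [Finset.sum_const, Nat.card_Ioc, nsmul_eq_mul, mul_one, Nat.cast_sub hst]
    exact ht1F
  -- the cumulative upper bounds at the end of the first phase
  have hM : ∀ y : A, cumProc pE c ρ δ θ a b t₁ w y ≤ B + 68 * F := by
    intro y
    have hX5 : ∑ l ∈ Finset.Ioc s t₁,
        -((y : Fin d → ℝ) ⬝ᵥ θ l w - o l * invForm (P l) y (a l w))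
        ≤ 18 * F + ∑ l ∈ Finset.Ioc s t₁, 2 * invForm (P l) y y * W l := by
      refine (sum_le_of_sum_mul_sub_le (V := fun l => invForm (P l) y y / ρ) hlam0
        (((Finset.sum_congr rfl fun l _ => ?_).trans_le (H5 y)).trans hconf)).trans ?_
      · rw [mul_div_assoc]
        ring
      · refine add_le_add le_rfl (Finset.sum_le_sum fun l hl => ?_)
        rw [Finset.mem_Ioc] at hl
        have h1 := (hMix l hl.1).invForm_self_nonneg (y : Fin d → ℝ)
        have h2 := hWanti l hl.1 (by omega)
        calc lam * (invForm (P l) y y / ρ) = lam / ρ * invForm (P l) y y := by ring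
          _ ≤ 2 * W l * invForm (P l) y y := by
              rw [hlamρ]
              gcongr
              linarith
          _ = 2 * invForm (P l) y y * W l := by ring
    -- Here `γ = 1/2`, so the norm is at most `2 d`. This sum enters twice, once as variance and
    -- once as bonus, giving `68 = 18 + 24 + 24 + 2`.
    have hK : ∑ l ∈ Finset.Ioc s t₁, 2 * invForm (P l) y y * W l
        ≤ 12 * ∑ l ∈ Finset.Ioc s t₁, ratio A ρ δ l := by
      rw [Finset.mul_sum]
      refine Finset.sum_le_sum fun l hl => ?_
      rw [Finset.mem_Ioc] at hl
      have h1 := (hMix l hl.1).invForm_self_le y.2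
      rw [gam_eq, min_eq_right (hlow l hl.1 hl.2)] at h1
      have h2 := hWx l hl.1
      have h3 := mul_le_mul_of_nonneg_right h1 (hW0 l)
      linarith
    have hR : ∑ l ∈ Finset.Ioc s t₁, ratio A ρ δ l ≤ 2 * F :=
      le_trans (Finset.sum_le_sum_of_subset_of_nonneg
        (Finset.Ioc_subset_Ioc_right htT.le) fun l _ _ => Real.sqrt_nonneg _) (hsum_ratio s)
    have hy1 : ∑ l ∈ Finset.Ioc s t₁, (y : Fin d → ℝ) ⬝ᵥ θ l w ≤ 2 * F := by
      refine le_trans (Finset.sum_le_sum fun l hl => ?_) hcard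
      rw [Finset.mem_Ioc] at hl
      exact (abs_le.1 (hθ l (by omega) y y.2)).2
    rw [cumProc_eq_add_sum hst, Finset.sum_add_distrib]
    rw [Finset.sum_neg_distrib, Finset.sum_sub_distrib] at hX5
    have := (abs_le.1 (hB y)).2
    linarith
  -- exponential weights
  have heta : ∀ l, t₁ < l → l ≤ T →
      eta A c ρ δ l * (d / gam A ρ δ l / ρ + 2 * (d / gam A ρ δ l) * W l) ≤ 1 := fun l hl _ =>
    eta_mul_le hd hN hρ hδ hδ1 hc hc1 (hs l (by omega))
  have heta0 : ∀ l, t₁ < l → l ≤ T → 0 < eta A c ρ δ l := fun l hl _ =>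
    eta_pos hd hN hρ hc (hs l (by omega))
  have hH := exponential_weights_bound (S := fun l => cumProc pE c ρ δ θ a b l w)
    (r := fun l y => o l * invForm (P l) y (a l w) + 2 * invForm (P l) y y * W l)
    (η := eta A c ρ δ) htT hM
    (fun l hl _ y => by
      obtain ⟨k, rfl⟩ : ∃ k, l = k + 1 := ⟨l - 1, by omega⟩
      exact cumProc_succ pE c ρ δ θ a b k w y)
    heta0
    (fun k l hk hkl hl => eta_anti hd hN hρ hδ hc (hs k (by omega)) hkl
      (hhigh k hk (by omega)))
    (fun l hl hlT y => (hMix l (by omega)).abs_eta_mul_rewardUpper_le y (a l w)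
      (heta0 l hl hlT).le (hW0 l) hρ (abs_obs_le hρ (hθ l (by omega))) (heta l hl hlT)) x
  have hround : ∀ l ∈ Finset.Ioc t₁ T,
      (∑ i, softmax (eta A c ρ δ l) (cumProc pE c ρ δ θ a b (l - 1) w) i
          * (o l * invForm (P l) i (a l w) + 2 * invForm (P l) i i * W l)
        + eta A c ρ δ l * ∑ i, softmax (eta A c ρ δ l) (cumProc pE c ρ δ θ a b (l - 1) w) i
          * (o l * invForm (P l) i (a l w) + 2 * invForm (P l) i i * W l) ^ 2)
      ≤ o l * invForm (P l) (m l) (a l w) + 36 * ratio A ρ δ l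
        + 4 * (eta A c ρ δ l * (o l ^ 2 * invForm (P l) (a l w) (a l w))) := by
    intro l hl
    rw [Finset.mem_Ioc] at hl
    have hmx := hMix l (by omega)
    have h1 := hmx.sum_q_mul_rewardUpper_le (o := o l) (a l w) (heta0 l hl.1 hl.2).le (hW0 l) (by
      refine le_trans (mul_le_mul_of_nonneg_left ?_ (heta0 l hl.1 hl.2).le) (heta l hl.1 hl.2)
      have := div_nonneg hmx.kappa_nonneg hρ.le
      linarith)
    have h2 := hWx l (by omega)
    refine h1.trans ?_
    linarith
  have hHsum := (Finset.sum_le_sum hround).trans_eq (by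
    rw [Finset.sum_add_distrib, Finset.sum_add_distrib, ← Finset.mul_sum, ← Finset.mul_sum])
  have hlogη : Real.log (Fintype.card A) / eta A c ρ δ T ≤ 2 / c * F := by
    rw [Fintype.card_coe]
    exact log_card_div_eta_le hd hN hρ hρ1 hc hsT (hhigh T htT le_rfl)
  -- the mean of the estimates
  have hX2 : ∑ l ∈ Finset.Ioc t₁ T, -(m l ⬝ᵥ θ l w - o l * invForm (P l) (m l) (a l w))
      ≤ 18 * F + ∑ l ∈ Finset.Ioc t₁ T, lam * (invForm (P l) (m l) (m l) / ρ) := by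
    refine sum_le_of_sum_mul_sub_le (V := fun l => invForm (P l) (m l) (m l) / ρ) hlam0
      (((Finset.sum_congr rfl fun l _ => ?_).trans_le H2).trans hconf)
    simp only [hm, hq, hP, ho]
    ring
  have hT1 : ∑ _l ∈ Finset.Ioc t₁ T, (1 : ℝ) ≤ T := by
    rw [Finset.sum_const, Nat.card_Ioc, nsmul_eq_mul, mul_one]
    exact_mod_cast Nat.sub_le T t₁
  -- The mean action carries no bonus, but its squared norm is at most 2, not `d / γ`.
  have hmm : ∑ l ∈ Finset.Ioc t₁ T, lam * (invForm (P l) (m l) (m l) / ρ) ≤ F := by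
    calc ∑ l ∈ Finset.Ioc t₁ T, lam * (invForm (P l) (m l) (m l) / ρ)
        ≤ ∑ l ∈ Finset.Ioc t₁ T, W T / 3 * 1 := Finset.sum_le_sum fun l hl => by
          rw [Finset.mem_Ioc] at hl
          have hmx := hMix l (by omega)
          have h1 := invForm_mean_le hmx.posDef hmx.q_nonneg hmx.q_sum hmx.q_le
          calc lam * (invForm (P l) (m l) (m l) / ρ) = lam / ρ * invForm (P l) (m l) (m l) := by
                ring
            _ ≤ lam / ρ * 2 := by
                gcongr
            _ = W T / 3 * 1 := by rw [hlamρ]; ring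
      _ ≤ W T / 3 * T := by
          rw [← Finset.mul_sum]
          gcongr
      _ ≤ F := by linarith
  have hqp : ∑ l ∈ Finset.Ioc t₁ T, m l ⬝ᵥ θ l w
      ≤ ∑ l ∈ Finset.Ioc t₁ T, (∑ y : A, P l y * ((y : Fin d → ℝ) ⬝ᵥ θ l w)
        + 2 * ratio A ρ δ l) := Finset.sum_le_sum fun l hl => by
    rw [Finset.mem_Ioc] at hl
    have h1 := (hMix l (by omega)).sum_q_mul_reward_le (hθ l (by omega))
    have h2 : gam A ρ δ l ≤ ratio A ρ δ l := min_le_left _ _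
    have h3 : m l ⬝ᵥ θ l w = ∑ y : A, q l y * ((y : Fin d → ℝ) ⬝ᵥ θ l w) := by
      simp only [hm, sum_dotProduct, smul_dotProduct, smul_eq_mul]
    rw [h3]
    linarith
  have hX3 : ∑ l ∈ Finset.Ioc t₁ T, (∑ y : A, P l y * ((y : Fin d → ℝ) ⬝ᵥ θ l w)
      - (a l w : Fin d → ℝ) ⬝ᵥ θ l w) ≤ 19 * F := by
    refine (sum_le_of_sum_mul_sub_le (V := fun _ => 1) hlam0
      (((Finset.sum_congr rfl fun l _ => ?_).trans_le H3).trans hconf)).trans ?_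
    · rw [mul_one]
    · rw [← Finset.mul_sum]
      have h1 : lam ≤ W T / 6 := by
        rw [hlam]
        have := mul_le_of_le_one_left hWT.le hρ1
        simp only [hW] at this ⊢
        linarith
      have h2 : lam * ∑ _l ∈ Finset.Ioc t₁ T, (1 : ℝ) ≤ W T / 6 * T := by gcongr
      linarith
  have hX4 : ∑ l ∈ Finset.Ioc t₁ T,
      eta A c ρ δ l * (o l ^ 2 * invForm (P l) (a l w) (a l w)) ≤ 8 * F := by
    have h1 := conf_div_le hd hN hρ hδ hδ1 hsT (hhigh T htT le_rfl)
    have h2 : ∑ l ∈ Finset.Ioc t₁ T, eta A c ρ δ l * (d / ρ) ≤ 2 * F :=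
      (Finset.sum_le_sum fun l hl => by
        rw [Finset.mem_Ioc] at hl
        exact eta_mul_dim_le hd hN hρ hc (by linarith) (hs l (by omega))).trans (hsum_ratio t₁)
    -- The supermartingale was scaled by `ρ η`, so removing `ρ` leaves a deviation `conf / ρ`, of
    -- leading order once clipping has ended.
    have h3 : ∑ l ∈ Finset.Ioc t₁ T, (eta A c ρ δ l * (o l ^ 2
        * invForm (P l) (a l w) (a l w)) - 2 * (eta A c ρ δ l * (d / ρ))) ≤ conf A δ T / ρ := by
      rw [le_div_iff₀' hρ, Finset.mul_sum]
      refine le_trans (le_of_eq (Finset.sum_congr rfl fun l _ => ?_)) H4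
      ring
    rw [Finset.sum_sub_distrib, ← Finset.mul_sum] at h3
    linarith
  -- the first phases
  have hfirst : ∀ I : Finset ℕ, (∀ l ∈ I, 1 ≤ l) →
      ∑ l ∈ I, -((a l w : Fin d → ℝ) ⬝ᵥ θ l w) ≤ ∑ _l ∈ I, (1 : ℝ) := fun I hI =>
    Finset.sum_le_sum fun l hl => by
      linarith [(abs_le.1 (hθ l (hI l hl) (a l w) (a l w).2)).1]
  have hr1 := (hfirst (Finset.Ioc s t₁) fun l hl => by rw [Finset.mem_Ioc] at hl; omega).trans hcard
  have h0s : ∑ l ∈ Finset.Ioc 0 s,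
      ((x : Fin d → ℝ) ⬝ᵥ θ l w - (a l w : Fin d → ℝ) ⬝ᵥ θ l w) ≤ 2 * s := by
    calc ∑ l ∈ Finset.Ioc 0 s, ((x : Fin d → ℝ) ⬝ᵥ θ l w - (a l w : Fin d → ℝ) ⬝ᵥ θ l w)
        ≤ ∑ l ∈ Finset.Ioc 0 s, (2 : ℝ) := Finset.sum_le_sum fun l hl => by
          rw [Finset.mem_Ioc] at hl
          linarith [(abs_le.1 (hθ l (by omega) (a l w) (a l w).2)).1,
            (abs_le.1 (hθ l (by omega) x x.2)).2]
      _ = 2 * s := by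
          rw [Finset.sum_const, Nat.card_Ioc, nsmul_eq_mul, Nat.sub_zero, mul_comm]
  have hsplit : ∀ f : ℕ → ℝ, ∑ l ∈ Finset.Icc 1 T, f l
      = ∑ l ∈ Finset.Ioc 0 s, f l + ∑ l ∈ Finset.Ioc s T, f l := fun f => by
    rw [Finset.sum_Ioc_consecutive _ (Nat.zero_le s) (by omega)]
    rfl
  have hsplit' : ∑ l ∈ Finset.Ioc s T, (a l w : Fin d → ℝ) ⬝ᵥ θ l w
      = ∑ l ∈ Finset.Ioc s t₁, (a l w : Fin d → ℝ) ⬝ᵥ θ l w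
        + ∑ l ∈ Finset.Ioc t₁ T, (a l w : Fin d → ℝ) ⬝ᵥ θ l w :=
    (Finset.sum_Ioc_consecutive _ hst htT.le).symm
  rw [hsplit, Finset.sum_sub_distrib (s := Finset.Ioc s T), hsplit']
  rw [Finset.sum_neg_distrib] at hr1 hX2
  rw [Finset.sum_sub_distrib] at hX2 hX3
  rw [Finset.sum_add_distrib, ← Finset.mul_sum] at hqp
  have hrt := hsum_ratio t₁
  -- The collected multiples of `F` are `18 + 68 + 19 + 72 + 32 + 4 + 19 + 2 = 234`, besides `2 /
  -- c`.
  have e : (240 + 2 / c) * F = 240 * F + 2 / c * F := by ring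
  rw [e]
  linarith

end Deterministic

/-! ### Probability of the bad events at a fixed horizon -/

section Events

variable {d : ℕ} {A : Finset (Fin d → ℝ)}

lemma sum_reward_sub_le {Ω : Type*} {θ : ℕ → Ω → Fin d → ℝ}
    {a : ℕ → Ω → A} {w : Ω} (hθ : ∀ l, 1 ≤ l → ∀ x ∈ A, |x ⬝ᵥ θ l w| ≤ 1) (T : ℕ) (x : A) :
    ∑ l ∈ Finset.Icc 1 T, ((x : Fin d → ℝ) ⬝ᵥ θ l w - (a l w : Fin d → ℝ) ⬝ᵥ θ l w)
      ≤ 2 * T := by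
  calc ∑ l ∈ Finset.Icc 1 T, ((x : Fin d → ℝ) ⬝ᵥ θ l w - (a l w : Fin d → ℝ) ⬝ᵥ θ l w)
      ≤ ∑ l ∈ Finset.Icc 1 T, (2 : ℝ) := Finset.sum_le_sum fun l hl => by
        rw [Finset.mem_Icc] at hl
        linarith [(abs_le.1 (hθ l hl.1 (a l w) (a l w).2)).1, (abs_le.1 (hθ l hl.1 x x.2)).2]
    _ = 2 * T := by
        rw [Finset.sum_const, Nat.card_Icc, nsmul_eq_mul, Nat.add_sub_cancel, mul_comm]

variable {Ω : Type*} [mΩ : MeasurableSpace Ω] {μ : Measure Ω}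
  [IsProbabilityMeasure μ] {G : Filtration ℕ mΩ} {pE : A → ℝ} {c ρ δ : ℝ}
  {θ : ℕ → Ω → Fin d → ℝ} {a : ℕ → Ω → A} {b : ℕ → Ω → Bool}

/-- Deviation of the least squares estimates in predictable directions. -/
lemma IsRun.measure_lt_sum_estimate_le (h : IsRun (geoHedge pE c ρ δ) ρ μ G θ a b)
    (hρ : 0 < ρ) (hρ1 : ρ ≤ 1) {s n : ℕ}
    (hMix : ∀ l, s < l → ∀ w, IsMixture pE (policyProc pE c ρ δ θ a b l w)
      (hedgeProc pE c ρ δ θ a b l w) (gam A ρ δ l))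
    {v : ℕ → Ω → Fin d → ℝ} (hv : ∀ l, s < l → Measurable[G l] (v l))
    (hvθ : ∀ l, s < l → ∀ w, |v l w ⬝ᵥ θ l w| ≤ 1)
    (hvκ : ∀ l, s < l → ∀ w, ∀ x ∈ A,
      |invForm (policyProc pE c ρ δ θ a b l w) (v l w) x| ≤ d / gam A ρ δ l)
    {lam : ℝ} (hlam : ∀ l, s < l → l ≤ n → |lam| * (1 + d / gam A ρ δ l / ρ) ≤ 1) (r : ℝ) :
    μ {w | r < ∑ l ∈ Finset.Ioc s n, (lam * (v l w ⬝ᵥ θ l w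
      - obs ρ θ a b l w * invForm (policyProc pE c ρ δ θ a b l w) (v l w) (a l w))
      - lam ^ 2 * invForm (policyProc pE c ρ δ θ a b l w) (v l w) (v l w) / ρ)}
      ≤ ENNReal.ofReal (Real.exp (-r)) := by
  refine h.measure_lt_sum_le (y := fun l i w => lam * (v l w ⬝ᵥ θ l w
      - drawObs ρ (θ l w) i * invForm (policyProc pE c ρ δ θ a b l w) (v l w) i.1)
      - lam ^ 2 * invForm (policyProc pE c ρ δ θ a b l w) (v l w) (v l w) / ρ)
    hρ.le hρ1 (fun l hl w => (hMix l hl w).nonneg) (fun l hl i => ?_) n (fun l hl hln w => ?_) r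
  · have hθ := h.measurable_reward l (by omega)
    have hP : ∀ x, Measurable[G l] fun w => policyProc pE c ρ δ θ a b l w x := fun x =>
      h.measurable_policyProc (by omega) x
    exact (((measurable_dotProduct (hv l hl) hθ).sub ((measurable_drawObs hθ i).mul
      (measurable_invForm hP (hv l hl) measurable_const))).const_mul lam).sub
      (((measurable_invForm hP (hv l hl) (hv l hl)).const_mul _).div_const ρ)
  · exact sum_drawLaw_mul_exp_estimate (hMix l hl w).nonneg (hMix l hl w).sum_eq_one
      (hMix l hl w).posDef hρ hρ1 (h.bounded l (by omega) w) (hvθ l hl w) (hvκ l hl w)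
      (hlam l hl hln)

/-- Deviation of the rewards from their conditional means. -/
lemma IsRun.measure_lt_sum_reward_le (h : IsRun (geoHedge pE c ρ δ) ρ μ G θ a b)
    (hρ : 0 < ρ) (hρ1 : ρ ≤ 1) {s n : ℕ}
    (hMix : ∀ l, s < l → ∀ w, IsMixture pE (policyProc pE c ρ δ θ a b l w)
      (hedgeProc pE c ρ δ θ a b l w) (gam A ρ δ l))
    {lam : ℝ} (hlam : |lam| * 2 ≤ 1) (r : ℝ) :
    μ {w | r < ∑ l ∈ Finset.Ioc s n, (lam * (∑ x : A, policyProc pE c ρ δ θ a b l w x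
        * ((x : Fin d → ℝ) ⬝ᵥ θ l w) - (a l w : Fin d → ℝ) ⬝ᵥ θ l w) - lam ^ 2)}
      ≤ ENNReal.ofReal (Real.exp (-r)) := by
  refine h.measure_lt_sum_le (y := fun l i w => lam * (∑ x : A, policyProc pE c ρ δ θ a b l w x
        * ((x : Fin d → ℝ) ⬝ᵥ θ l w) - (i.1 : Fin d → ℝ) ⬝ᵥ θ l w) - lam ^ 2)
    hρ.le hρ1 (fun l hl w => (hMix l hl w).nonneg) (fun l hl i => ?_) n (fun l hl hln w => ?_) r
  · have hθ := h.measurable_reward l (by omega)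
    have hx : ∀ x : A, Measurable[G l] fun w => (x : Fin d → ℝ) ⬝ᵥ θ l w := fun x =>
      measurable_dotProduct measurable_const hθ
    exact (((Finset.measurable_fun_sum _ fun x _ =>
      (h.measurable_policyProc (by omega) x).mul (hx x)).sub (hx i.1)).const_mul lam).sub_const _
  · exact sum_drawLaw_mul_exp_reward (hMix l hl w).nonneg (hMix l hl w).sum_eq_one hρ hρ1
      (h.bounded l (by omega) w) hlam

/-- Deviation of the squared norms of the least squares estimates. -/
lemma IsRun.measure_lt_sum_norm_le (h : IsRun (geoHedge pE c ρ δ) ρ μ G θ a b)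
    (hρ : 0 < ρ) (hρ1 : ρ ≤ 1) {s n : ℕ}
    (hMix : ∀ l, s < l → ∀ w, IsMixture pE (policyProc pE c ρ δ θ a b l w)
      (hedgeProc pE c ρ δ θ a b l w) (gam A ρ δ l))
    {lam : ℕ → ℝ} (hlam0 : ∀ l, s < l → 0 ≤ lam l)
    (hlam : ∀ l, s < l → l ≤ n → lam l * (d / gam A ρ δ l / ρ ^ 2) ≤ 1) (r : ℝ) :
    μ {w | r < ∑ l ∈ Finset.Ioc s n, (lam l * (obs ρ θ a b l w ^ 2
        * invForm (policyProc pE c ρ δ θ a b l w) (a l w) (a l w)) - 2 * (lam l * (d / ρ)))}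
      ≤ ENNReal.ofReal (Real.exp (-r)) := by
  refine h.measure_lt_sum_le (y := fun l i w => lam l * (drawObs ρ (θ l w) i ^ 2
        * invForm (policyProc pE c ρ δ θ a b l w) i.1 i.1) - 2 * (lam l * (d / ρ)))
    hρ.le hρ1 (fun l hl w => (hMix l hl w).nonneg) (fun l hl i => ?_) n (fun l hl hln w => ?_) r
  · have hθ := h.measurable_reward l (by omega)
    have hP : ∀ x, Measurable[G l] fun w => policyProc pE c ρ δ θ a b l w x := fun x =>
      h.measurable_policyProc (by omega) x
    exact ((((measurable_drawObs hθ i).pow_const 2).mul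
      (measurable_invForm hP measurable_const measurable_const)).const_mul _).sub_const _
  · exact sum_drawLaw_mul_exp_norm (hMix l hl w).nonneg (hMix l hl w).sum_eq_one
      (hMix l hl w).posDef hρ hρ1 (h.bounded l (by omega) w) (hlam0 l hl)
      (fun x hx => (hMix l hl w).invForm_self_le hx) (hlam l hl hln)

lemma exp_neg_conf (hN : 2 ≤ A.card) (hδ : 0 < δ) {T : ℕ} (hT : 0 < T) :
    Real.exp (-conf A δ T) = δ / (12 * T ^ 2 * A.card) := by
  have hT' : (0 : ℝ) < T := Nat.cast_pos.2 hT
  have hN' : (0 : ℝ) < A.card := Nat.cast_pos.2 (by omega)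
  rw [conf, Real.exp_neg, Real.exp_log (by positivity)]
  field_simp

/-- The regret bound of round `T` fails with probability at most `δ / (3 T²)`. -/
theorem IsRun.exists_exceptional_set (h : IsRun (geoHedge pE c ρ δ) ρ μ G θ a b)
    (hd : 0 < d) (hN : 2 ≤ A.card) (hρ : 0 < ρ) (hρ1 : ρ ≤ 1)
    (hδ : 0 < δ) (hδ1 : δ < 1) (hc : 0 < c) (hc1 : c ≤ 1 / 7)
    (hA : Submodule.span ℝ (A : Set (Fin d → ℝ)) = ⊤) (hE : IsJohnExploration A pE)
    {B : ℝ} {s : ℕ} (hs : ∀ l : ℕ, s < l → Real.exp 1 ≤ l / δ) (hB0 : 0 ≤ B)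
    (hB : ∀ w x, |cumProc pE c ρ δ θ a b s w x| ≤ B) {T : ℕ} (hT : 1 ≤ T) :
    ∃ S : Set Ω, μ S ≤ ENNReal.ofReal (δ / 3 * (1 / T ^ 2)) ∧ ∀ w ∉ S, ∀ x : A,
      ∑ l ∈ Finset.Icc 1 T, ((x : Fin d → ℝ) ⬝ᵥ θ l w - (a l w : Fin d → ℝ) ⬝ᵥ θ l w)
        ≤ (240 + 2 / c) * lead A ρ δ T + 2 * B + 2 * s := by
  have hF0 : 0 ≤ lead A ρ δ T := lead_nonneg T
  have hθ : ∀ w l, 1 ≤ l → ∀ x ∈ A, |x ⬝ᵥ θ l w| ≤ 1 := fun w l hl => h.bounded l hl w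
  have hcF : 0 ≤ 2 / c * lead A ρ δ T := by positivity
  have e : (240 + 2 / c) * lead A ρ δ T = 240 * lead A ρ δ T + 2 / c * lead A ρ δ T := by ring
  have hs0 : (0 : ℝ) ≤ s := Nat.cast_nonneg s
  rcases le_or_gt T s with hTs | hTs
  · refine ⟨∅, by simp, fun w _ x => (sum_reward_sub_le (hθ w) T x).trans ?_⟩
    have : (T : ℝ) ≤ s := by exact_mod_cast hTs
    rw [e]
    linarith
  rcases le_or_gt (1 / 2) (ratio A ρ δ T) with hx | hx
  -- If `T` itself is clipped, the trivial bound `2 T` is at most `4 * lead`.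
  · refine ⟨∅, by simp, fun w _ x => (sum_reward_sub_le (hθ w) T x).trans ?_⟩
    have h1 := lead_eq (A := A) (δ := δ) hρ hT
    have h2 : (0 : ℝ) ≤ T := Nat.cast_nonneg T
    rw [e]
    nlinarith
  obtain ⟨t₁, hst, htT, hlow, hhigh⟩ : ∃ t₁, s ≤ t₁ ∧ t₁ < T ∧
      (∀ l, s < l → l ≤ t₁ → 1 / 2 ≤ ratio A ρ δ l) ∧
      (∀ l, t₁ < l → l ≤ T → ratio A ρ δ l ≤ 1 / 2) := by
    classical
    -- The last round that is burn-in or clipped; since `ratio` decreases after the burn-in, every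
    -- earlier round after `s` is clipped too.
    set p : ℕ → Prop := fun l => l ≤ s ∨ 1 / 2 ≤ ratio A ρ δ l with hp
    have hps : p s := Or.inl le_rfl
    have h1 : s ≤ Nat.findGreatest p T := Nat.le_findGreatest hTs.le hps
    have h2 : p (Nat.findGreatest p T) := Nat.findGreatest_spec hTs.le hps
    have h3 : Nat.findGreatest p T ≤ T := Nat.findGreatest_le T
    refine ⟨Nat.findGreatest p T, h1, ?_, fun l hl hlt => ?_, fun l hl hlT => ?_⟩
    · refine lt_of_le_of_ne h3 fun heq => ?_
      rw [heq] at h2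
      rcases h2 with h2 | h2
      · omega
      · linarith
    · rcases h2 with h2 | h2
      · omega
      · exact h2.trans (ratio_anti hρ hδ (hs l hl) hlt)
    · have := Nat.findGreatest_is_greatest hl hlT
      rw [hp] at this
      push Not at this
      exact this.2.le
  have hMix : ∀ l, s < l → ∀ w, IsMixture pE (policyProc pE c ρ δ θ a b l w)
      (hedgeProc pE c ρ δ θ a b l w) (gam A ρ δ l) := fun l hl w =>
    isMixture_policyProc (by omega) hA hE (gam_pos hd hN hρ (hs l hl)) w
  have hMix' : ∀ l, t₁ < l → ∀ w, IsMixture pE (policyProc pE c ρ δ θ a b l w)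
      (hedgeProc pE c ρ δ θ a b l w) (gam A ρ δ l) := fun l hl w => hMix l (by omega) w
  have hd' : (1 : ℝ) ≤ d := by exact_mod_cast hd
  -- The denominator 6 is what the moment condition below requires: `2 lam d / (γ ρ)` becomes `d W /
  -- (3 γ) ≤ ratio / γ ≤ 1`.
  obtain ⟨lam, hlam⟩ : ∃ lam, lam = ρ * width A ρ δ T / 6 := ⟨_, rfl⟩
  have hw := width_pos (A := A) hd hN hρ hδ hδ1 hT
  have hlam0 : 0 < lam := by rw [hlam]; positivity
  have hkap : ∀ l, s < l → 1 ≤ d / gam A ρ δ l / ρ := fun l hl => by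
    have hg := gam_pos hd hN hρ (hs l hl)
    have hg1 := gam_le_half (A := A) (ρ := ρ) (δ := δ) l
    rw [div_div, one_le_div (by positivity)]
    nlinarith
  have hcond : ∀ l, s < l → l ≤ T → |lam| * (1 + d / gam A ρ δ l / ρ) ≤ 1 := fun l hl hlT => by
    have hg := gam_pos hd hN hρ (hs l hl)
    have h1 := mul_width_le hd hN hρ hδ hδ1 (hs T hTs)
    have h2 : ratio A ρ δ T ≤ gam A ρ δ l :=
      le_min (ratio_anti hρ hδ (hs l hl) hlT) hx.le
    rw [abs_of_pos hlam0]
    calc lam * (1 + d / gam A ρ δ l / ρ) ≤ lam * (d / gam A ρ δ l / ρ + d / gam A ρ δ l / ρ) := by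
          gcongr
          exact hkap l hl
      _ = d * width A ρ δ T / 3 / gam A ρ δ l := by
          rw [hlam]
          field_simp
          norm_num
      _ ≤ 1 := by
          rw [div_le_one hg]
          linarith
  have hcondT : |lam| * 2 ≤ 1 := by
    refine le_trans (mul_le_mul_of_nonneg_left ?_ (abs_nonneg _)) (hcond T hTs le_rfl)
    linarith [hkap T hTs]
  have hcondn : ∀ l, s < l → l ≤ T → |-lam| * (1 + d / gam A ρ δ l / ρ) ≤ 1 := fun l hl hlT => by
    rw [abs_neg]
    exact hcond l hl hlT
  set D := conf A δ T with hD
  set m : ℕ → Ω → Fin d → ℝ := fun l w =>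
    ∑ x : A, hedgeProc pE c ρ δ θ a b l w x • (x : Fin d → ℝ) with hm
  set ε := ENNReal.ofReal (Real.exp (-D)) with hε
  have E1 : ∀ x : A, _ ≤ ε := fun x =>
    h.measure_lt_sum_estimate_le hρ hρ1 (n := T) hMix (v := fun _ _ => (x : Fin d → ℝ))
      (fun l hl => measurable_const) (fun l hl w => hθ w l (by omega) x x.2)
      (fun l hl w y hy => (hMix l hl w).abs_invForm_le x.2 hy) hcond D
  have E5 : ∀ x : A, _ ≤ ε := fun x =>
    h.measure_lt_sum_estimate_le hρ hρ1 (n := t₁) hMix (v := fun _ _ => (x : Fin d → ℝ))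
      (fun l hl => measurable_const) (fun l hl w => hθ w l (by omega) x x.2)
      (fun l hl w y hy => (hMix l hl w).abs_invForm_le x.2 hy)
      (fun l hl hlt => hcondn l hl (by omega)) D
  have hmean : ∀ l, t₁ < l → Measurable[G l] (m l) := fun l hl =>
    Finset.measurable_fun_sum _ fun x _ =>
      (h.measurable_hedgeProc (by omega) x).smul_const (x : Fin d → ℝ)
  have E2 := h.measure_lt_sum_estimate_le hρ hρ1 (n := T) hMix' (v := m)
      hmean
      (fun l hl w => (hMix' l hl w).abs_mean_dotProduct_le (hθ w l (by omega)))
      (fun l hl w y hy => (hMix' l hl w).abs_invForm_mean_le hy)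
      (fun l hl hlt => hcondn l (by omega) hlt) D
  have E3 := h.measure_lt_sum_reward_le hρ hρ1 (n := T) hMix' hcondT D
  have E4 := h.measure_lt_sum_norm_le hρ hρ1 (n := T) hMix' (lam := fun l => ρ * eta A c ρ δ l)
      (fun l hl => mul_nonneg hρ.le (eta_pos hd hN hρ hc (hs l (by omega))).le)
      (fun l hl hlT => by
        have h1 := eta_mul_le hd hN hρ hδ hδ1 hc hc1 (hs l (by omega))
        have h2 := eta_pos hd hN hρ hc (hs l (by omega : s < l))
        have h3 := gam_pos hd hN hρ (hs l (by omega : s < l))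
        have h4 := width_nonneg (A := A) (ρ := ρ) (δ := δ) l
        refine le_trans ?_ h1
        have e1 : ρ * eta A c ρ δ l * (d / gam A ρ δ l / ρ ^ 2)
            = eta A c ρ δ l * (d / gam A ρ δ l / ρ) := by
          field_simp
        rw [e1]
        refine mul_le_mul_of_nonneg_left ?_ h2.le
        have : 0 ≤ 2 * (d / gam A ρ δ l) * width A ρ δ l := by positivity
        linarith) D
  refine ⟨_, (measure_union_le _ _).trans (add_le_add ((measure_union_le _ _).trans (add_le_add
    ((measure_iUnion_fintype_le μ _).trans (Finset.sum_le_sum fun x _ => E1 x))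
    ((measure_iUnion_fintype_le μ _).trans (Finset.sum_le_sum fun x _ => E5 x))))
    ((measure_union_le _ _).trans (add_le_add ((measure_union_le _ _).trans
      (add_le_add E2 E3)) E4))) |>.trans ?_, fun w hw x => ?_⟩
  · have hN' : (2 : ℝ) ≤ A.card := by exact_mod_cast hN
    have hT' : (0 : ℝ) < T := Nat.cast_pos.2 hT
    have e2 : ENNReal.ofReal (2 * A.card + 3) = 2 * (A.card : ENNReal) + 3 := by
      rw [ENNReal.ofReal_add (by positivity) (by norm_num), ENNReal.ofReal_mul (by norm_num)]
      simp
    calc (∑ _x : A, ε + ∑ _x : A, ε) + ((ε + ε) + ε)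
        = ENNReal.ofReal (2 * A.card + 3) * ε := by
          rw [e2, Finset.sum_const, Finset.card_univ, Fintype.card_coe, nsmul_eq_mul]
          ring
      _ = ENNReal.ofReal ((2 * A.card + 3) * (δ / (12 * T ^ 2 * A.card))) := by
          rw [hε, hD, exp_neg_conf hN hδ hT, ENNReal.ofReal_mul (by positivity)]
      _ ≤ ENNReal.ofReal (δ / 3 * (1 / T ^ 2)) := by
          refine ENNReal.ofReal_le_ofReal ?_
          have e3 : (2 * A.card + 3) * (δ / (12 * T ^ 2 * A.card))
              = δ / T ^ 2 * ((2 * A.card + 3) / (12 * A.card)) := by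
            field_simp
          have e4 : δ / 3 * (1 / T ^ 2) = δ / T ^ 2 * (1 / 3) := by ring
          rw [e3, e4]
          -- The union bound closes because `(2N + 3) / (12N) ≤ 1/3` for `N ≥ 2`.
          refine mul_le_mul_of_nonneg_left ?_ (by positivity)
          rw [div_le_iff₀ (by positivity)]
          linarith
  · simp only [Set.mem_union, Set.mem_iUnion, Set.mem_ofPred_eq, not_or, not_exists, not_lt] at hw
    obtain ⟨⟨hw1, hw5⟩, ⟨hw2, hw3⟩, hw4⟩ := hw
    exact sum_regret_le_of_deviations hd hN hρ hρ1 hδ hδ1 hc hc1 hA hE (hθ w) hs (hB w) hst htT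
      hlow hhigh hlam hw1 hw2 hw3 hw4 hw5 x

end Events

/-! ### Uniformity in time and the two regret statements -/

section Conclusion

variable {d : ℕ} {A : Finset (Fin d → ℝ)} {pE : A → ℝ} {c ρ δ : ℝ}

/-- A deterministic bound on the cumulative reward upper bounds after `s` rounds. -/
def cumBound (A : Finset (Fin d → ℝ)) (ρ δ : ℝ) (s : ℕ) : ℝ :=
  ∑ l ∈ Finset.Ioc 0 s, (d / gam A ρ δ l / ρ + 2 * (d / gam A ρ δ l) * width A ρ δ l)

lemma cumBound_nonneg (hρ : 0 < ρ) (s : ℕ) : 0 ≤ cumBound A ρ δ s :=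
  Finset.sum_nonneg fun l _ => by
    have h1 := gam_nonneg (A := A) (ρ := ρ) (δ := δ) l
    have h2 := width_nonneg (A := A) (ρ := ρ) (δ := δ) l
    positivity

lemma abs_cumProc_le {Ω : Type*} {θ : ℕ → Ω → Fin d → ℝ} {a : ℕ → Ω → A} {b : ℕ → Ω → Bool}
    (hd : 0 < d) (hN : 2 ≤ A.card) (hρ : 0 < ρ) (hδ : 0 < δ) (hδ1 : δ < 1)
    (hA : Submodule.span ℝ (A : Set (Fin d → ℝ)) = ⊤) (hE : IsJohnExploration A pE)
    {w : Ω} (hθ : ∀ l, 1 ≤ l → ∀ x ∈ A, |x ⬝ᵥ θ l w| ≤ 1) (s : ℕ) (x : A) :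
    |cumProc pE c ρ δ θ a b s w x| ≤ cumBound A ρ δ s := by
  rw [cumProc_eq_add_sum (Nat.zero_le s), show cumProc pE c ρ δ θ a b 0 w x = 0 from rfl, zero_add]
  refine (Finset.abs_sum_le_sum_abs _ _).trans (Finset.sum_le_sum fun l hl => ?_)
  rw [Finset.mem_Ioc] at hl
  have hl1 : (1 : ℝ) ≤ l := by exact_mod_cast hl.1
  have hg : 0 < gam A ρ δ l := lt_min (ratio_pos_of_one_lt hd hN hρ hl.1 (by
    rw [lt_div_iff₀ hδ]
    linarith)) (by norm_num)
  exact (isMixture_policyProc (by omega) hA hE hg w).abs_rewardUpper_le x (a l w)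
    (width_nonneg l) hρ (abs_obs_le hρ (hθ l hl.1))

/-- Union bound over time with `π² / 6 ≤ 3`. The good event and the bad sets cover the space, so
outer measure suffices and no measurability of either is required. -/
lemma one_sub_le_measureReal {Ω : Type*} [MeasurableSpace Ω] {μ : Measure Ω}
    [IsProbabilityMeasure μ] {S : ℕ → Set Ω} {p : ℕ → Ω → Prop} (hδ : 0 ≤ δ)
    (hS : ∀ t, 1 ≤ t → μ (S t) ≤ ENNReal.ofReal (δ / 3 * (1 / (t : ℝ) ^ 2)))
    (hp : ∀ t, 1 ≤ t → ∀ w ∉ S t, p t w) :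
    1 - δ ≤ μ.real {w | ∀ t, 1 ≤ t → p t w} := by
  have hsum := hasSum_zeta_two
  have hpi : Real.pi ^ 2 / 6 ≤ 3 := by nlinarith [Real.pi_lt_four, Real.pi_pos]
  have hbad : μ (⋃ t : ℕ, S (t + 1)) ≤ ENNReal.ofReal δ := by
    refine (measure_iUnion_le _).trans ?_
    have hs1 : Summable fun t : ℕ => δ / 3 * (1 / ((t + 1 : ℕ) : ℝ) ^ 2) :=
      ((summable_nat_add_iff 1).2 hsum.summable).mul_left _
    calc ∑' t : ℕ, μ (S (t + 1)) ≤ ∑' t : ℕ, ENNReal.ofReal (δ / 3 * (1 / ((t + 1 : ℕ) : ℝ) ^ 2)) :=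
          ENNReal.tsum_le_tsum fun t => hS (t + 1) (by omega)
      _ = ENNReal.ofReal (∑' t : ℕ, δ / 3 * (1 / ((t + 1 : ℕ) : ℝ) ^ 2)) :=
          (ENNReal.ofReal_tsum_of_nonneg (fun t => by positivity) hs1).symm
      _ ≤ ENNReal.ofReal δ := by
          refine ENNReal.ofReal_le_ofReal ?_
          rw [tsum_mul_left]
          have h1 := hsum.summable.tsum_eq_zero_add
          rw [hsum.tsum_eq] at h1
          simp only [Nat.cast_zero, ne_eq, OfNat.ofNat_ne_zero, not_false_eq_true, zero_pow,
            div_zero, zero_add] at h1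
          rw [← h1]
          nlinarith
  have hcover : (Set.univ : Set Ω) ⊆ (⋃ t : ℕ, S (t + 1)) ∪ {w | ∀ t, 1 ≤ t → p t w} := by
    intro w _
    by_cases hw : w ∈ ⋃ t : ℕ, S (t + 1)
    · exact Or.inl hw
    · refine Or.inr fun t ht => hp t ht w fun hwt => hw ?_
      obtain ⟨k, rfl⟩ : ∃ k, t = k + 1 := ⟨t - 1, by omega⟩
      exact Set.mem_iUnion.2 ⟨k, hwt⟩
  have h1 : (1 : ENNReal) ≤ ENNReal.ofReal δ + μ {w | ∀ t, 1 ≤ t → p t w} := by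
    rw [← measure_univ (μ := μ)]
    exact (measure_mono hcover).trans ((measure_union_le _ _).trans (add_le_add hbad le_rfl))
  have h2 := ENNReal.toReal_mono (by finiteness) h1
  rw [ENNReal.toReal_one, ENNReal.toReal_add ENNReal.ofReal_ne_top (measure_ne_top _ _),
    ENNReal.toReal_ofReal hδ] at h2
  rw [measureReal_def]
  linarith

lemma nonempty_of_span (hd : 0 < d) (hA : Submodule.span ℝ (A : Set (Fin d → ℝ)) = ⊤) :
    A.Nonempty := by
  rw [Finset.nonempty_iff_ne_empty]
  rintro rfl
  have : Nonempty (Fin d) := ⟨⟨0, hd⟩⟩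
  rw [Finset.coe_empty, Submodule.span_empty] at hA
  exact bot_ne_top hA

lemma regret_eq_zero_of_card {Ω : Type*} {θ : ℕ → Ω → Fin d → ℝ} {a : ℕ → Ω → A}
    (hN : A.card = 1) (t : ℕ) (w : Ω) : regret θ a t w = 0 := by
  have hsub : Subsingleton A := by
    rw [← Fintype.card_le_one_iff_subsingleton, Fintype.card_coe, hN]
  have hne : Nonempty A := ⟨a t w⟩
  unfold regret
  have : ∀ x : A, ∑ l ∈ Finset.Icc 1 t,
      ((x : Fin d → ℝ) ⬝ᵥ θ l w - (a l w : Fin d → ℝ) ⬝ᵥ θ l w) = 0 := fun x =>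
    Finset.sum_eq_zero fun l _ => by rw [Subsingleton.elim (a l w) x, sub_self]
  simp only [this, ciSup_const]

/-- The regret bound, where the first `s` rounds are treated as a burn-in phase. -/
theorem IsRun.regret_bound {Ω : Type*} [mΩ : MeasurableSpace Ω] {μ : Measure Ω}
    [IsProbabilityMeasure μ] {G : Filtration ℕ mΩ} {θ : ℕ → Ω → Fin d → ℝ} {a : ℕ → Ω → A}
    {b : ℕ → Ω → Bool} (h : IsRun (geoHedge pE c ρ δ) ρ μ G θ a b)
    (hd : 0 < d) (hρ : 0 < ρ) (hρ1 : ρ ≤ 1)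
    (hδ : 0 < δ) (hδ1 : δ < 1) (hc : 0 < c) (hc1 : c ≤ 1 / 7)
    (hA : Submodule.span ℝ (A : Set (Fin d → ℝ)) = ⊤) (hE : IsJohnExploration A pE)
    {s : ℕ} (hs : ∀ l : ℕ, s < l → Real.exp 1 ≤ l / δ) :
    1 - δ ≤ μ.real {w | ∀ t : ℕ, 1 ≤ t → regret θ a t w
      ≤ (240 + 2 / c) * lead A ρ δ t + 2 * cumBound A ρ δ s + 2 * s} := by
  have hB0 := cumBound_nonneg (A := A) (δ := δ) hρ s
  have hne : Nonempty A := (nonempty_of_span hd hA).to_subtype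
  rcases Nat.lt_or_ge A.card 2 with hN | hN
  -- With one action `ln|A| = 0`, so `γ` vanishes and the mixture estimates are unavailable; but
  -- there is no regret either.
  · have hN1 : A.card = 1 := by
      have := (nonempty_of_span hd hA).card_pos
      omega
    have : {w | ∀ t : ℕ, 1 ≤ t → regret θ a t w
        ≤ (240 + 2 / c) * lead A ρ δ t + 2 * cumBound A ρ δ s + 2 * s} = Set.univ := by
      refine Set.eq_univ_of_forall fun w t _ => ?_
      rw [regret_eq_zero_of_card hN1]
      have := lead_nonneg (A := A) (ρ := ρ) (δ := δ) t
      positivity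
    rw [this, probReal_univ]
    linarith
  · have hex := fun (t : ℕ) (ht : 1 ≤ t) =>
      h.exists_exceptional_set hd hN hρ hρ1 hδ hδ1 hc hc1 hA hE hs hB0
        (fun w x => abs_cumProc_le hd hN hρ hδ hδ1 hA hE (fun l hl => h.bounded l hl w) s x) ht
    choose S hS hSr using hex
    refine one_sub_le_measureReal (S := fun t => if ht : 1 ≤ t then S t ht else ∅) hδ.le
      (fun t ht => ?_) fun t ht w hw => ?_
    · simp only [ht, dif_pos]
      exact hS t ht
    · simp only [ht, dif_pos] at hw
      exact ciSup_le fun x => hSr t ht w hw x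

/-- The lower-order terms of the rate are nonnegative and not needed. -/
lemma lead_le_rate (hρ : 0 < ρ) (hδ : 0 < δ) (hδ1 : δ < 1) {t : ℕ} (ht : 1 ≤ t) :
    lead A ρ δ t ≤ rate A ρ δ t := by
  have ht' : (1 : ℝ) ≤ t := by exact_mod_cast ht
  have h1 : 0 ≤ Real.log A.card := Real.log_natCast_nonneg _
  have h2 : 0 ≤ Real.log t := Real.log_natCast_nonneg _
  have h3 : 0 ≤ Real.log (t / δ) := Real.log_nonneg <| by
    rw [le_div_iff₀ hδ]
    linarith
  unfold rate lead
  have e1 : 0 ≤ ρ * Real.log A.card * Real.log (t / δ) * Real.log t := by positivity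
  have e2 : 0 ≤ (Real.log A.card / d * Real.log (t / δ)) ^ (1 / 4 : ℝ) * (t : ℝ) ^ (1 / 4 : ℝ)
        * (1 / ρ) ^ (3 / 4 : ℝ) := by positivity
  have e3 : 0 ≤ 1 / ρ * Real.log (t / δ) := by positivity
  linarith

theorem regret_le_rate {Ω : Type*} [mΩ : MeasurableSpace Ω] {μ : Measure Ω}
    [IsProbabilityMeasure μ] {G : Filtration ℕ mΩ} {θ : ℕ → Ω → Fin d → ℝ} {a : ℕ → Ω → A}
    {b : ℕ → Ω → Bool} (h : IsRun (geoHedge pE c ρ δ) ρ μ G θ a b)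
    (hd : 0 < d) (hρ : 0 < ρ) (hρ1 : ρ ≤ 1)
    (hδ : 0 < δ) (hδ1 : δ < 1) (hc : 0 < c) (hc1 : c ≤ 1 / 7)
    (hA : Submodule.span ℝ (A : Set (Fin d → ℝ)) = ⊤) (hE : IsJohnExploration A pE) :
    1 - δ * (3 + 2 * (d : ℝ) ^ 2) ≤ μ.real {w | ∀ t : ℕ, 1 ≤ t →
      regret θ a t w ≤ (240 + 2 / c) * rate A ρ δ t} := by
  have hd' : (1 : ℝ) ≤ d := by exact_mod_cast hd
  have hd2 : (5 : ℝ) ≤ 3 + 2 * (d : ℝ) ^ 2 := by nlinarith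
  -- Either the claimed probability is nonpositive, or `δ < 1/5`, and then `l / δ ≥ 5 > e` from the
  -- first round on: no burn-in.
  rcases le_or_gt 1 (δ * (3 + 2 * (d : ℝ) ^ 2)) with h1 | h1
  · exact le_trans (by linarith) measureReal_nonneg
  have hδ5 : δ * 5 < 1 := lt_of_le_of_lt (mul_le_mul_of_nonneg_left hd2 hδ.le) h1
  have hs : ∀ l : ℕ, 0 < l → Real.exp 1 ≤ l / δ := fun l hl => by
    have hl' : (1 : ℝ) ≤ l := by exact_mod_cast hl
    rw [le_div_iff₀ hδ]
    nlinarith [Real.exp_one_lt_d9]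
  have h2 := h.regret_bound hd hρ hρ1 hδ hδ1 hc hc1 hA hE hs
  refine le_trans (by nlinarith) (h2.trans (measureReal_mono fun w hw t ht => (hw t ht).trans ?_))
  have h3 := mul_le_mul_of_nonneg_left (lead_le_rate (A := A) hρ hδ hδ1 ht)
    (show 0 ≤ 240 + 2 / c by positivity)
  simpa [cumBound] using h3

theorem hStable_geoHedge (hd : 0 < d) (hc : 0 < c) (hc1 : c ≤ 1 / 7)
    (hA : Submodule.span ℝ (A : Set (Fin d → ℝ)) = ⊤) (hE : IsJohnExploration A pE) :
    HStable.{u} A (fun ρ δ => geoHedge pE c ρ δ) (√((d : ℝ) * Real.log A.card))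
      (240 + 2 / c) := by
  intro ρ δ hρ hρ1 hδ hδ1
  -- For arbitrary `δ < 1` two burn-in rounds suffice, since `3 > e`; their contribution is constant
  -- in `t`.
  refine ⟨fun _ => 2 * cumBound A ρ δ 2 + 2 * (2 : ℕ), ?_, ?_⟩
  · refine isLittleO_const_left.2 (Or.inr ?_)
    refine tendsto_norm_atTop_atTop.comp (Real.tendsto_sqrt_atTop.comp ?_)
    exact tendsto_natCast_atTop_atTop.atTop_mul_atTop₀
      (Real.tendsto_log_atTop.comp tendsto_natCast_atTop_atTop)
  · intro Ω mΩ μ _ G θ a b h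
    have hs : ∀ l : ℕ, 2 < l → Real.exp 1 ≤ l / δ := fun l hl => by
      have hl' : (3 : ℝ) ≤ l := by exact_mod_cast hl
      rw [le_div_iff₀ hδ]
      nlinarith [Real.exp_one_lt_d9, Real.exp_pos 1]
    refine (h.regret_bound hd hρ hρ1 hδ hδ1 hc hc1 hA hE hs).trans
      (measureReal_mono fun w hw t ht => (hw t ht).trans (le_of_eq ?_))
    have hlead : lead A ρ δ t
        = √((d : ℝ) * Real.log A.card) * √((t : ℝ) / ρ * Real.log (t / δ)) := by
      have : 0 ≤ Real.log A.card := Real.log_natCast_nonneg _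
      rw [lead, ← Real.sqrt_mul (by positivity)]
      congr 1
      ring
    rw [hlead]
    ring

end Conclusion

/-! ### Existence of John's exploration distribution -/

section John

variable {d : ℕ}

lemma dotProduct_transpose_mul_mulVec (B M : Matrix (Fin d) (Fin d) ℝ) (x y : Fin d → ℝ) :
    x ⬝ᵥ ((Bᵀ * M) *ᵥ y) = (B *ᵥ x) ⬝ᵥ (M *ᵥ y) := by
  rw [← Matrix.mulVec_mulVec, Matrix.dotProduct_mulVec, Matrix.vecMul_transpose]

/-- The ellipsoid is the preimage of the unit ball under `B`, so minimizing volume means maximizing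
`|det B|`. -/
lemma volume_ellipsoid {B : Matrix (Fin d) (Fin d) ℝ} (hB : B.det ≠ 0) :
    volume (ellipsoid (Bᵀ * B)) = ENNReal.ofReal |B.det⁻¹| * volume (ellipsoid (1 : Matrix (Fin d) (Fin d) ℝ)) := by
  have h1 : ellipsoid (Bᵀ * B) = Matrix.toLin' B ⁻¹' ellipsoid 1 := by
    ext x
    simp only [ellipsoid, Set.mem_ofPred_eq, Set.mem_preimage, Matrix.toLin'_apply,
      Matrix.one_mulVec, dotProduct_transpose_mul_mulVec]
  have hdet : LinearMap.det (Matrix.toLin' B) = B.det := LinearMap.det_toLin' B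
  rw [h1, Measure.addHaar_preimage_linearMap _ (by rwa [hdet]), hdet]

open scoped MatrixOrder in
lemma exists_transpose_mul_self {Q : Matrix (Fin d) (Fin d) ℝ} (hQ : Q.PosDef) :
    ∃ B : Matrix (Fin d) (Fin d) ℝ, B.det ≠ 0 ∧ Q = Bᵀ * B := by
  obtain ⟨B, hB⟩ := CStarAlgebra.nonneg_iff_eq_star_mul_self.1 hQ.posSemidef.nonneg
  rw [Matrix.star_eq_conjTranspose, Matrix.conjTranspose_eq_transpose_of_trivial] at hB
  refine ⟨B, fun h => hQ.det_pos.ne' ?_, hB⟩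
  rw [hB, Matrix.det_mul, h, mul_zero]

lemma posDef_transpose_mul_self {B : Matrix (Fin d) (Fin d) ℝ} (hB : B.det ≠ 0) :
    (Bᵀ * B).PosDef := by
  rw [← Matrix.conjTranspose_eq_transpose_of_trivial]
  exact Matrix.PosDef.conjTranspose_mul_self _
    (Matrix.mulVec_injective_iff_isUnit.2 ((Matrix.isUnit_iff_isUnit_det B).2 hB.isUnit))

/-- The matrices which map a set into the Euclidean unit ball. -/
def feasible (A : Finset (Fin d → ℝ)) : Set (Matrix (Fin d) (Fin d) ℝ) :=
  {B | ∀ x ∈ A, (B *ᵥ x) ⬝ᵥ (B *ᵥ x) ≤ 1}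

variable {A : Finset (Fin d → ℝ)}

/-- The constraints are closed; since the actions span, each coordinate vector is a combination of
them, which bounds every entry of `B`. -/
lemma isCompact_feasible (hA : Submodule.span ℝ (A : Set (Fin d → ℝ)) = ⊤) :
    IsCompact (feasible A) := by
  have hc : ∀ j : Fin d, ∃ f : (Fin d → ℝ) → ℝ, ∑ x ∈ A, f x • x = Pi.single j 1 := fun j => by
    have hj : (Pi.single j 1 : Fin d → ℝ) ∈ Submodule.span ℝ (A : Set (Fin d → ℝ)) :=
      hA ▸ Submodule.mem_top
    obtain ⟨f, -, hf⟩ := Submodule.mem_span_finset.1 hj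
    exact ⟨f, hf⟩
  choose f hf using hc
  have hclosed : IsClosed (feasible A) := by
    have : feasible A = ⋂ x ∈ A, {B | (B *ᵥ x) ⬝ᵥ (B *ᵥ x) ≤ 1} := by
      ext B
      simp [feasible]
    rw [this]
    refine isClosed_biInter fun x _ => isClosed_le ?_ continuous_const
    have h : Continuous fun B : Matrix (Fin d) (Fin d) ℝ => B *ᵥ x :=
      continuous_id.matrix_mulVec continuous_const
    exact h.dotProduct h
  have hcomp : IsCompact (Set.univ.pi fun _ : Fin d => Set.univ.pi fun j : Fin d =>
      Set.Icc (-∑ x ∈ A, |f j x|) (∑ x ∈ A, |f j x|)) :=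
    isCompact_univ_pi fun _ => isCompact_univ_pi fun _ => isCompact_Icc
  refine hcomp.of_isClosed_subset hclosed fun (B : Matrix (Fin d) (Fin d) ℝ) hB => ?_
  refine Set.mem_univ_pi.2 fun i => Set.mem_univ_pi.2 fun j => ?_
  have hent : ∀ x ∈ A, |(B *ᵥ x) i| ≤ 1 := fun x hx => by
    rw [← sq_le_one_iff_abs_le_one]
    refine le_trans ?_ (hB x hx)
    rw [pow_two]
    exact Finset.single_le_sum (f := fun i => (B *ᵥ x) i * (B *ᵥ x) i)
      (fun i _ => mul_self_nonneg _) (Finset.mem_univ i)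
  have hBij : B i j = ∑ x ∈ A, f j x * (B *ᵥ x) i := by
    have h1 : (B *ᵥ Pi.single j 1) i = B i j := by simp
    rw [← h1, ← hf j, Matrix.mulVec_sum, Finset.sum_apply]
    exact Finset.sum_congr rfl fun x _ => by simp [Matrix.mulVec_smul]
  rw [Set.mem_Icc, ← abs_le, hBij]
  refine (Finset.abs_sum_le_sum_abs _ _).trans (Finset.sum_le_sum fun x hx => ?_)
  rw [abs_mul]
  exact mul_le_of_le_one_right (abs_nonneg _) (hent x hx)

lemma exists_feasible_det_ne_zero (A : Finset (Fin d → ℝ)) : ∃ B ∈ feasible A, B.det ≠ 0 := by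
  set M := 1 + ∑ x ∈ A, x ⬝ᵥ x with hM
  have h0 : ∀ x : Fin d → ℝ, 0 ≤ x ⬝ᵥ x := fun x => Finset.sum_nonneg fun i _ => mul_self_nonneg _
  have hM1 : 1 ≤ M := by
    have := Finset.sum_nonneg fun x (_ : x ∈ A) => h0 x
    linarith
  have hM0 : 0 < M := by linarith
  refine ⟨M⁻¹ • 1, fun x hx => ?_, ?_⟩
  · rw [Matrix.smul_mulVec, Matrix.one_mulVec, smul_dotProduct, dotProduct_smul, smul_eq_mul,
      smul_eq_mul]
    have h1 : x ⬝ᵥ x ≤ M := by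
      have := Finset.single_le_sum (f := fun x => x ⬝ᵥ x) (fun x _ => h0 x) hx
      linarith
    have h2 : M⁻¹ * (x ⬝ᵥ x) ≤ 1 := by
      rw [inv_mul_le_iff₀ hM0, mul_one]
      exact h1
    have h3 : M⁻¹ ≤ 1 := inv_le_one_of_one_le₀ hM1
    exact mul_le_one₀ h3 (mul_nonneg (by positivity) (h0 x)) h2
  · rw [Matrix.det_smul, Matrix.det_one, mul_one]
    positivity

/-- A feasible matrix of maximal determinant. -/
lemma exists_feasible_max (hA : Submodule.span ℝ (A : Set (Fin d → ℝ)) = ⊤) :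
    ∃ B ∈ feasible A, B.det ≠ 0 ∧ ∀ B' ∈ feasible A, B'.det ^ 2 ≤ B.det ^ 2 := by
  obtain ⟨B₀, hB₀, hdet₀⟩ := exists_feasible_det_ne_zero A
  have hcont : Continuous fun B : Matrix (Fin d) (Fin d) ℝ => B.det ^ 2 :=
    (continuous_id.matrix_det).pow 2
  obtain ⟨B, hB, hmax⟩ := (isCompact_feasible hA).exists_isMaxOn ⟨B₀, hB₀⟩ hcont.continuousOn
  refine ⟨B, hB, fun h => ?_, fun B' hB' => hmax hB'⟩
  have h1 : B₀.det ^ 2 ≤ B.det ^ 2 := hmax hB₀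
  rw [h] at h1
  have := sq_pos_of_ne_zero hdet₀
  nlinarith

lemma isJohnEllipsoid_of_max {B : Matrix (Fin d) (Fin d) ℝ} (hB : B ∈ feasible A)
    (hdet : B.det ≠ 0) (hmax : ∀ B' ∈ feasible A, B'.det ^ 2 ≤ B.det ^ 2) :
    IsJohnEllipsoid (A : Set (Fin d → ℝ)) (Bᵀ * B) := by
  refine ⟨posDef_transpose_mul_self hdet, fun x hx => ?_, fun Q hQ hAQ => ?_⟩
  · simp only [ellipsoid, Set.mem_ofPred_eq, dotProduct_transpose_mul_mulVec]
    exact hB x hx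
  · obtain ⟨B', hdet', rfl⟩ := exists_transpose_mul_self hQ
    have hB' : B' ∈ feasible A := fun x hx => by
      have := hAQ hx
      simpa only [ellipsoid, Set.mem_ofPred_eq, dotProduct_transpose_mul_mulVec] using this
    rw [volume_ellipsoid hdet, volume_ellipsoid hdet']
    refine mul_le_mul_left (ENNReal.ofReal_le_ofReal ?_) _
    rw [abs_inv, abs_inv]
    exact inv_anti₀ (abs_pos.2 hdet') (sq_le_sq.1 (hmax B' hB'))

/-- Optimality condition: no symmetric direction improves a feasible matrix of maximal
determinant. -/
lemma trace_le_zero_of_max {B : Matrix (Fin d) (Fin d) ℝ} (hB : B ∈ feasible A)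
    (hdet : B.det ≠ 0) (hmax : ∀ B' ∈ feasible A, B'.det ^ 2 ≤ B.det ^ 2)
    {H : Matrix (Fin d) (Fin d) ℝ}
    (hneg : ∀ x ∈ A, (B *ᵥ x) ⬝ᵥ (B *ᵥ x) = 1 → x ⬝ᵥ (H *ᵥ x) < 0) :
    (H * (Bᵀ * B)⁻¹).trace ≤ 0 := by
  by_contra! htr
  have hu : IsUnit B.det := hdet.isUnit
  have hut : IsUnit Bᵀ.det := by rwa [Matrix.det_transpose]
  -- Moving `B` to `B + ε M = B (1 + ε N)` changes `xᵀ Bᵀ B x` by `2 ε xᵀ H x` to first order, while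
  -- the trace of `N` is that of `H (Bᵀ B)⁻¹`.
  set M := (Bᵀ)⁻¹ * H with hM
  have hBM : Bᵀ * M = H := by rw [hM, ← Matrix.mul_assoc, Matrix.mul_nonsing_inv _ hut, Matrix.one_mul]
  set N := B⁻¹ * M with hN
  have hBN : B * N = M := by rw [hN, ← Matrix.mul_assoc, Matrix.mul_nonsing_inv _ hu, Matrix.one_mul]
  have hNtr : 0 < N.trace := by
    rw [hN, hM, ← Matrix.mul_assoc, Matrix.trace_mul_comm]
    rwa [Matrix.mul_inv_rev] at htr
  -- Slack constraints survive small `ε` by continuity; at contact points the strictly negative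
  -- first-order term beats the quadratic one.
  have hfeas : ∀ᶠ ε : ℝ in nhdsWithin 0 (Set.Ioi 0), B + ε • M ∈ feasible A := by
    have hquad : ∀ (ε : ℝ) (x : Fin d → ℝ), ((B + ε • M) *ᵥ x) ⬝ᵥ ((B + ε • M) *ᵥ x)
        = (B *ᵥ x) ⬝ᵥ (B *ᵥ x) + ε * (2 * (x ⬝ᵥ (H *ᵥ x)) + ε * ((M *ᵥ x) ⬝ᵥ (M *ᵥ x))) := by
      intro ε x
      rw [← hBM, dotProduct_transpose_mul_mulVec, Matrix.add_mulVec, Matrix.smul_mulVec]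
      simp only [add_dotProduct, dotProduct_add, smul_dotProduct, dotProduct_smul, smul_eq_mul]
      rw [dotProduct_comm (M *ᵥ x) (B *ᵥ x)]
      ring
    simp only [feasible, Set.mem_ofPred_eq, hquad]
    refine (Finset.eventually_all A).2 fun x hx => ?_
    rcases (hB x hx).lt_or_eq with hlt | heq
    · have hcont : Continuous fun ε : ℝ => (B *ᵥ x) ⬝ᵥ (B *ᵥ x)
          + ε * (2 * (x ⬝ᵥ (H *ᵥ x)) + ε * ((M *ᵥ x) ⬝ᵥ (M *ᵥ x))) := by fun_prop
      have := hcont.tendsto 0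
      simp only [zero_mul, add_zero] at this
      filter_upwards [(this.mono_left nhdsWithin_le_nhds).eventually_lt_const hlt] with ε hε
      exact hε.le
    · have hcont : Continuous fun ε : ℝ =>
          2 * (x ⬝ᵥ (H *ᵥ x)) + ε * ((M *ᵥ x) ⬝ᵥ (M *ᵥ x)) := by fun_prop
      have := hcont.tendsto 0
      simp only [zero_mul, add_zero] at this
      filter_upwards [(this.mono_left nhdsWithin_le_nhds).eventually_lt_const
        (show 2 * (x ⬝ᵥ (H *ᵥ x)) < 0 by linarith [hneg x hx heq]), self_mem_nhdsWithin] with ε hε h0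
      rw [heq]
      nlinarith [Set.mem_Ioi.1 h0]
  -- The expansion `det (1 + ε N) = 1 + ε tr N + O(ε²)`, with the remainder as an explicit
  -- polynomial.
  have hgain : ∀ᶠ ε : ℝ in nhdsWithin 0 (Set.Ioi 0), 1 < (1 + ε • N).det := by
    set p := (det (1 + (Polynomial.X : Polynomial ℝ) • N.map Polynomial.C)).divX.divX with hp
    have hcont : Continuous fun ε : ℝ => N.trace + p.eval ε * ε := by fun_prop
    have := hcont.tendsto 0
    simp only [mul_zero, add_zero] at this
    filter_upwards [(this.mono_left nhdsWithin_le_nhds).eventually_const_lt hNtr,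
      self_mem_nhdsWithin] with ε hε h0
    rw [Matrix.det_one_add_smul, ← hp]
    nlinarith [mul_pos (Set.mem_Ioi.1 h0) hε]
  obtain ⟨ε, h1, h2⟩ := (hfeas.and hgain).exists
  have h3 := hmax _ h1
  have h4 : B + ε • M = B * (1 + ε • N) := by
    rw [Matrix.mul_add, Matrix.mul_one, Matrix.mul_smul, hBN]
  rw [h4, Matrix.det_mul, mul_pow] at h3
  have h5 := sq_pos_of_ne_zero hdet
  have h6 : 1 < (1 + ε • N).det ^ 2 := by nlinarith
  nlinarith

/-- John's decomposition of the identity, as a statement on convex hulls. -/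
lemma inv_mem_convexHull {B : Matrix (Fin d) (Fin d) ℝ} (hd : 0 < d) (hB : B ∈ feasible A)
    (hdet : B.det ≠ 0) (hmax : ∀ B' ∈ feasible A, B'.det ^ 2 ≤ B.det ^ 2) :
    (fun i j => (d : ℝ)⁻¹ * (Bᵀ * B)⁻¹ i j) ∈ convexHull ℝ
      ((fun (x : Fin d → ℝ) (i j : Fin d) => x i * x j) ''
        {x | x ∈ A ∧ (B *ᵥ x) ⬝ᵥ (B *ᵥ x) = 1}) := by
  by_contra hnot
  have hfin : ((fun (x : Fin d → ℝ) (i j : Fin d) => x i * x j) ''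
        {x | x ∈ A ∧ (B *ᵥ x) ⬝ᵥ (B *ᵥ x) = 1}).Finite :=
    (A.finite_toSet.subset fun x hx => hx.1).image _
  obtain ⟨f, u, hf1, hf2⟩ := geometric_hahn_banach_closed_point (convex_convexHull ℝ _)
    (hfin.isClosed_convexHull ℝ) hnot
  set H : Matrix (Fin d) (Fin d) ℝ := fun i j => f (Pi.single i (Pi.single j 1)) with hH
  have hfM : ∀ M : Fin d → Fin d → ℝ, f M = ∑ i, ∑ j, M i j * H i j := by
    intro M
    have hM : M = ∑ i, ∑ j, M i j • (Pi.single i (Pi.single j 1) : Fin d → Fin d → ℝ) := by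
      ext k l
      simp [Finset.sum_apply, Pi.single_apply, ite_apply]
    conv_lhs => rw [hM]
    simp only [map_sum, map_smul, smul_eq_mul, hH]
  set Q := Bᵀ * B with hQ
  have hQpos : Q.PosDef := posDef_transpose_mul_self hdet
  have hQs : (Q⁻¹)ᵀ = Q⁻¹ := by
    rw [Matrix.transpose_nonsing_inv, hQ, Matrix.transpose_mul, Matrix.transpose_transpose]
  have hquad : ∀ x : Fin d → ℝ, x ⬝ᵥ (H *ᵥ x) = f fun i j => x i * x j := fun x => by
    rw [hfM]
    simp only [dotProduct, Matrix.mulVec, Finset.mul_sum]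
    exact Finset.sum_congr rfl fun i _ => Finset.sum_congr rfl fun j _ => by ring
  have htr : (H * Q⁻¹).trace = d * f fun i j => (d : ℝ)⁻¹ * Q⁻¹ i j := by
    have hd' : (d : ℝ) ≠ 0 := by positivity
    rw [hfM, Finset.mul_sum, Matrix.trace]
    refine Finset.sum_congr rfl fun i _ => ?_
    rw [Matrix.diag_apply, Matrix.mul_apply, Finset.mul_sum]
    refine Finset.sum_congr rfl fun j _ => ?_
    rw [← Matrix.transpose_apply Q⁻¹ i j, hQs]
    field_simp
  -- Subtracting `u Q` moves the threshold to zero: contact points satisfy `xᵀ Q x = 1`, and the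
  -- trace of `Q Q⁻¹` is `d`.
  have hle := trace_le_zero_of_max (H := H - u • Q) hB hdet hmax (fun x hx h1 => by
    rw [Matrix.sub_mulVec, dotProduct_sub, Matrix.smul_mulVec, dotProduct_smul, hquad, hQ,
      dotProduct_transpose_mul_mulVec, h1]
    have := hf1 _ (subset_convexHull ℝ _ ⟨x, ⟨hx, h1⟩, rfl⟩)
    simp only [smul_eq_mul, mul_one]
    linarith)
  rw [← hQ, Matrix.sub_mul, Matrix.trace_sub, htr, Matrix.smul_mul,
    Matrix.mul_nonsing_inv _ hQpos.det_pos.ne'.isUnit, Matrix.trace_smul, Matrix.trace_one,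
    Fintype.card_fin, smul_eq_mul] at hle
  have hd' : (0 : ℝ) < d := Nat.cast_pos.2 hd
  nlinarith

/-- Affinely independent symmetric matrices are few. -/
lemma card_le_of_affineIndependent {ι : Type*} [Fintype ι] {z : ι → Fin d → Fin d → ℝ}
    (hz : AffineIndependent ℝ z) (hsymm : ∀ k i j, z k i j = z k j i) :
    Fintype.card ι ≤ d * (d + 1) / 2 + 1 := by
  refine hz.card_le_finrank_succ.trans (Nat.add_le_add_right ?_ 1)
  set V : Submodule ℝ (Fin d → Fin d → ℝ) :=
    { carrier := {M | ∀ i j, M i j = M j i}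
      add_mem' := fun {M N} hM hN i j => by
        simp only [Pi.add_apply]
        rw [hM i j, hN i j]
      zero_mem' := fun i j => rfl
      smul_mem' := fun r M hM i j => by
        simp only [Pi.smul_apply]
        rw [hM i j] } with hV
  have hle : vectorSpan ℝ (Set.range z) ≤ V := by
    rw [vectorSpan, Submodule.span_le]
    rintro _ ⟨_, ⟨k, rfl⟩, _, ⟨l, rfl⟩, rfl⟩ i j
    simp only [vsub_eq_sub, Pi.sub_apply]
    rw [hsymm k i j, hsymm l i j]
  -- A symmetric matrix is determined by its entries on unordered index pairs, of which there are `d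
  -- (d + 1) / 2`.
  let T : V →ₗ[ℝ] (Sym2 (Fin d) → ℝ) :=
    { toFun := fun M s => (M : Fin d → Fin d → ℝ) (Quot.out s).1 (Quot.out s).2
      map_add' := fun M N => rfl
      map_smul' := fun r M => rfl }
  have hT : Function.Injective T := by
    rw [← LinearMap.ker_eq_bot, LinearMap.ker_eq_bot']
    intro M hM
    ext i j
    have h1 := congrFun hM s(i, j)
    have h2 : s((Quot.out s(i, j)).1, (Quot.out s(i, j)).2) = s(i, j) := Quot.out_eq s(i, j)
    rw [Sym2.eq_iff] at h2
    change (M : Fin d → Fin d → ℝ) (Quot.out s(i, j)).1 (Quot.out s(i, j)).2 = 0 at h1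
    rcases h2 with ⟨h3, h4⟩ | ⟨h3, h4⟩
    · rw [h3, h4] at h1
      exact h1
    · rw [h3, h4] at h1
      rw [M.2 i j]
      exact h1
  calc Module.finrank ℝ (vectorSpan ℝ (Set.range z)) ≤ Module.finrank ℝ V :=
        Submodule.finrank_mono hle
    _ ≤ Module.finrank ℝ (Sym2 (Fin d) → ℝ) := LinearMap.finrank_le_finrank_of_injective hT
    _ = d * (d + 1) / 2 := by
        rw [Module.finrank_pi, Sym2.card, Fintype.card_fin, Nat.choose_two_right,
          Nat.add_sub_cancel, mul_comm]

/-- Carathéodory writes `Q⁻¹ / d` as a combination of affinely independent `x xᵀ` over contact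
points; applying this identity to `Q y` gives the decomposition of `y`. -/
theorem exists_isJohnExploration (hd : 0 < d)
    (hA : Submodule.span ℝ (A : Set (Fin d → ℝ)) = ⊤) : ∃ pE : A → ℝ, IsJohnExploration A pE := by
  classical
  obtain ⟨B, hB, hdet, hmax⟩ := exists_feasible_max hA
  obtain ⟨ι, _, z, w, hz, hind, hw0, hw1, hwz⟩ :=
    eq_pos_convex_span_of_mem_convexHull (inv_mem_convexHull hd hB hdet hmax)
  have hg : ∀ k, ∃ x : A, (B *ᵥ (x : Fin d → ℝ)) ⬝ᵥ (B *ᵥ (x : Fin d → ℝ)) = 1 ∧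
      (fun i j => (x : Fin d → ℝ) i * (x : Fin d → ℝ) j) = z k := fun k => by
    obtain ⟨x, ⟨hx, h1⟩, h2⟩ := hz ⟨k, rfl⟩
    exact ⟨⟨x, hx⟩, h1, h2⟩
  choose g hg1 hgz using hg
  set Q := Bᵀ * B with hQ
  have hQpos : Q.PosDef := posDef_transpose_mul_self hdet
  -- Distinct indices may select the same action, so their weights are added.
  set pE : A → ℝ := fun x => ∑ k with g k = x, w k with hpE
  have hsum : ∀ F : A → Fin d → ℝ, ∑ x, pE x • F x = ∑ k, w k • F (g k) := fun F => by
    rw [← Finset.sum_fiberwise (s := Finset.univ) (g := g)]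
    refine Finset.sum_congr rfl fun x _ => ?_
    rw [hpE, Finset.sum_smul]
    refine Finset.sum_congr rfl fun k hk => ?_
    rw [(Finset.mem_filter.1 hk).2]
  have hex : ∀ x, pE x ≠ 0 → ∃ k, g k = x := fun x hx => by
    obtain ⟨k, hk, -⟩ := Finset.exists_ne_zero_of_sum_ne_zero hx
    exact ⟨k, (Finset.mem_filter.1 hk).2⟩
  refine ⟨pE, Q, isJohnEllipsoid_of_max hB hdet hmax,
    fun x => Finset.sum_nonneg fun k _ => (hw0 k).le, ?_, fun x hx => ?_, ?_, fun y => ?_⟩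
  · rw [← hw1, ← Finset.sum_fiberwise (s := Finset.univ) (g := g)]
  · obtain ⟨k, rfl⟩ := hex x hx
    rw [hQ, dotProduct_transpose_mul_mulVec]
    exact hg1 k
  · have hsub : {x : A | pE x ≠ 0} ⊆ Set.range g := fun x hx => hex x hx
    refine (Set.ncard_le_ncard hsub (Set.finite_range g)).trans ?_
    rw [← Set.image_univ]
    refine (Set.ncard_image_le Set.finite_univ).trans ?_
    rw [Set.ncard_univ, Nat.card_eq_fintype_card]
    exact card_le_of_affineIndependent hind fun k i j => by
      rw [← hgz k]
      exact mul_comm _ _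
  · have hd' : (d : ℝ) ≠ 0 := by positivity
    have h1 : ∑ x : A, (pE x * ((x : Fin d → ℝ) ⬝ᵥ (Q *ᵥ y))) • (x : Fin d → ℝ)
        = ∑ k, w k • (((g k : Fin d → ℝ) ⬝ᵥ (Q *ᵥ y)) • (g k : Fin d → ℝ)) := by
      rw [← hsum fun x => ((x : Fin d → ℝ) ⬝ᵥ (Q *ᵥ y)) • (x : Fin d → ℝ)]
      exact Finset.sum_congr rfl fun x _ => mul_smul _ _ _
    have h2 : Q⁻¹ *ᵥ (Q *ᵥ y) = y := by
      rw [Matrix.mulVec_mulVec, Matrix.nonsing_inv_mul _ hQpos.det_pos.ne'.isUnit,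
        Matrix.one_mulVec]
    rw [h1]
    conv_lhs => rw [← h2]
    ext i
    have h3 : ∀ j, Q⁻¹ i j
        = d * ∑ k, w k * ((g k : Fin d → ℝ) i * (g k : Fin d → ℝ) j) := fun j => by
      rw [eq_comm, ← eq_inv_mul_iff_mul_eq₀ hd', ← congrFun (congrFun hwz i) j, Finset.sum_apply,
        Finset.sum_apply]
      refine Finset.sum_congr rfl fun k _ => ?_
      rw [← hgz k]
      rfl
    rw [Pi.smul_apply, smul_eq_mul, Finset.sum_apply, Matrix.mulVec, dotProduct]
    simp only [h3, Pi.smul_apply, smul_eq_mul, mul_assoc]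
    rw [← Finset.mul_sum]
    congr 1
    simp only [Finset.sum_mul]
    rw [Finset.sum_comm]
    refine Finset.sum_congr rfl fun k _ => ?_
    rw [dotProduct, Finset.sum_mul, Finset.mul_sum]
    exact Finset.sum_congr rfl fun j _ => by ring

end John

end GeoHedge

end

theorem mainTheorem4 :
    -- John's exploration is available for every finite spanning action set
    (∀ (d : ℕ) (A : Finset (Fin d → ℝ)), 0 < d →
      Submodule.span ℝ (A : Set (Fin d → ℝ)) = ⊤ →
      ∃ pE : A → ℝ, GeoHedge.IsJohnExploration A pE) ∧
    -- regret bound and h-stability, for every small enough absolute constant in `η`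
    ∃ c₀ : ℝ, 0 < c₀ ∧ ∀ c : ℝ, 0 < c → c ≤ c₀ →
      ∃ C : ℝ, 0 < C ∧
        ∀ (d : ℕ) (A : Finset (Fin d → ℝ)) (pE : A → ℝ), 0 < d →
          Submodule.span ℝ (A : Set (Fin d → ℝ)) = ⊤ →
          GeoHedge.IsJohnExploration A pE →
          (∀ ρ δ : ℝ, 0 < ρ → ρ ≤ 1 → 0 < δ → δ < 1 →
            ∀ (Ω : Type u) [mΩ : MeasurableSpace Ω] (μ : MeasureTheory.Measure Ω)
              [MeasureTheory.IsProbabilityMeasure μ]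
              (G : MeasureTheory.Filtration ℕ mΩ)
              (θ : ℕ → Ω → Fin d → ℝ) (a : ℕ → Ω → A) (b : ℕ → Ω → Bool),
              GeoHedge.IsRun (GeoHedge.geoHedge pE c ρ δ) ρ μ G θ a b →
              1 - δ * (3 + 2 * (d : ℝ) ^ 2) ≤
                μ.real {w | ∀ t : ℕ, 1 ≤ t →
                  GeoHedge.regret θ a t w ≤ C * GeoHedge.rate A ρ δ t}) ∧
          GeoHedge.HStable.{u} A (fun ρ δ => GeoHedge.geoHedge pE c ρ δ)
            (√((d : ℝ) * Real.log A.card)) C := by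
  refine ⟨fun d A hd hA => ?_, 1 / 7, by norm_num, fun c hc hc1 => ⟨240 + 2 / c, by positivity,
    fun d A pE hd hA hE => ⟨fun ρ δ hρ hρ1 hδ hδ1 Ω mΩ μ _ G θ a b h => ?_,
      GeoHedge.hStable_geoHedge hd hc hc1 hA hE⟩⟩⟩
  · exact GeoHedge.exists_isJohnExploration hd hA
  · exact GeoHedge.regret_le_rate h hd hρ hρ1 hδ hδ1 hc hc1 hA hE
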